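/- **Conventions.** Let $E,F$ be (complete) Hilbert C$^*$-modules over a C$^*$-algebra $A$. $\mathcal L(E,F)$ denotes the adjointable operators from $E$ to $F$, and $\mathcal L(E)=\mathcal L(E,E)$. Operators written without further comment may be unbounded; they are composed on maximal domains, and $P\subseteq Q$ means that $Q$ extends $P$. * For a densely defined $A$-linear $T$ from within $E$ into $F$, $D(T^*)$ is the set of $v\in F$ for which there is $w\in E$ with $\langle Tu,v\rangle=\langle u,w\rangle$ for all $u\in D(T)$, and then $T^*v=w$. $T$ is *regular* if it is closed, $T^*$ is densely defined and $1+T^*T$ has dense range. A regular operator $T$ in $E$ is *normal* if $D(T)=D(T^*)$ and $\langle Tv,Tv\rangle=\langle T^*v,T^*v\rangle$ for $v\in D(T)$. A regular $T$ is *invertible* if it is injective and $T^{-1}$ is regular. The spectrum $\sigma(T)$ of a normal $T$ is the set of $c\in\mathbb C$ for which there is no $R\in\mathcal L(E)$ with $R(T-c1)\subseteq (T-c1)R=1$. The $z$-transform of a regular $T$ is the unique $z_T\in\mathcal L(E,F)$ with $\|z_T\|\le 1$, $D(T)=(1-z_T^*z_T)^{1/2}E$ and $T(1-z_T^*z_T)^{1/2}v=z_Tv$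 for all $v\in E$. * If $X$ is a locally compact space, $\pi:\mathrm C_0(X)\to\mathcal L(E)$ a non-degenerate $^*$-homomorphism and $f\in \mathrm C(X)$, then $\pi(f)$ is the regular operator in $E$ with $z$-transform $\pi\bigl(f/(1+|f|^2)^{1/2}\bigr)$, where $\pi$ is extended to bounded continuous functions by $\pi(h)\pi(g)=\pi(hg)$ for $g\in \mathrm C_0(X)$. * $G\subseteq\mathbb C$ is *almost closed* if $G\cup K$ is closed for some finite $K\subseteq\mathbb C$. $G$ is *compatible* with a normal $T$ if it is almost closed and there is a finite $K\subseteq\mathbb C$ such that $T-\lambda 1$ is invertible for every $\lambda\in K$ and $\sigma(T)\setminus K\subseteq G$. In this case, for continuous $f:G\to\mathbb C$, $f(T)$ denotes $\pi(f|_{\sigma(T)\setminus K})$, where $\pi:\mathrm C_0(\sigma(T)\setminus K)\to\mathcal L(E)$ is the non-degenerate $^*$-homomorphism such that $\pi$ of the identity function is $T$. **Theorem (Fuglede–Putnam for Hilbert C$^*$-modules).** Let $E,F$ be Hilbert C$^*$-modules over a C$^*$-algebra $A$, $U:E\to F$ a bounded ($\mathbb C$-)linear map, $S$ a normal regular operator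 in $E$ and $T$ a normal regular operator in $F$ such that $US\subseteq TU$. Then: 1. $US^*\subseteq T^*U$. 2. Let $G\subseteq\mathbb C$ be compatible with both $S$ and $T$, and let $f:G\to\mathbb C$ be continuous. Then $f(S)$ and $f(T)$ are well defined (they exist and do not depend on the choices of $K$ and $\pi$), and $Uf(S)\subseteq f(T)U$. 3. If, in the situation of 2, $U$ is moreover unitary (that is, $U\in\mathcal L(E,F)$ with $U^*U=1$ and $UU^*=1$), then $Uf(S)=f(T)U$. -/

import Mathlib

open scoped ZeroAtInfty

namespace HilbertModule

noncomputable section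

/-! ### Partially defined operators -/

section PartialMaps

variable {E F G : Type*} [NormedAddCommGroup E] [NormedSpace ℂ E]
  [NormedAddCommGroup F] [NormedSpace ℂ F] [NormedAddCommGroup G] [NormedSpace ℂ G]

/-- The composition `g f` of partially defined operators, on its maximal domain
`{x ∈ D(f) | f x ∈ D(g)}`. -/
def pcomp (g : F →ₗ.[ℂ] G) (f : E →ₗ.[ℂ] F) : E →ₗ.[ℂ] G :=
  g.comp (f.domRestrict ((g.domain.comap f.toFun).map f.domain.subtype)) (by
    rintro ⟨x, hx⟩
    obtain ⟨⟨y, hy, rfl⟩, h2⟩ := Submodule.mem_inf.mp hx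
    exact hy)

theorem mem_graph_pcomp (g : F →ₗ.[ℂ] G) (f : E →ₗ.[ℂ] F) (x : E) (z : G) :
    (x, z) ∈ (pcomp g f).graph ↔ ∃ y, (x, y) ∈ f.graph ∧ (y, z) ∈ g.graph := by
  simp only [LinearPMap.mem_graph_iff]
  constructor
  · rintro ⟨⟨w, hw⟩, rfl, rfl⟩
    obtain ⟨⟨y, hy, rfl⟩, h2⟩ := Submodule.mem_inf.mp hw
    exact ⟨f y, ⟨y, rfl, rfl⟩, ⟨f y, hy⟩, rfl, rfl⟩
  · rintro ⟨_, ⟨y, rfl, rfl⟩, ⟨w, hw⟩, hwy, rfl⟩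
    have hwy' : w = f y := hwy
    subst hwy'
    exact ⟨⟨y, Submodule.mem_inf.mpr ⟨⟨y, hw, rfl⟩, y.2⟩⟩, rfl, rfl⟩

/-- A bounded operator viewed as an everywhere defined partial operator. -/
def toP (U : E →L[ℂ] F) : E →ₗ.[ℂ] F := (U : E →ₗ[ℂ] F).toPMap ⊤

/-- The operator `T - c 1`, with domain `D(T)`. -/
def subScalar (T : E →ₗ.[ℂ] E) (c : ℂ) : E →ₗ.[ℂ] E :=
  T - toP (c • ContinuousLinearMap.id ℂ E)

end PartialMaps

/-! ### Adjointable and regular operators between Hilbert C⋆-modules -/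

section Operators

variable (A : Type*) [NonUnitalCStarAlgebra A] [PartialOrder A] [StarOrderedRing A]
  {E F : Type*}
  [NormedAddCommGroup E] [NormedSpace ℂ E] [SMul A E] [CStarModule A E]
  [NormedAddCommGroup F] [NormedSpace ℂ F] [SMul A F] [CStarModule A F]

/-- `s` is the adjoint of `t` with respect to the `A`-valued inner products. -/
def IsAdjointPair (t : E →L[ℂ] F) (s : F →L[ℂ] E) : Prop :=
  ∀ x y, inner A (t x) y = inner A x (s y)

/-- `t` belongs to `𝓛(E, F)`. -/
def IsAdjointable (t : E →L[ℂ] F) : Prop := ∃ s : F →L[ℂ] E, IsAdjointPair A t s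

/-- `U` is a unitary element of `𝓛(E, F)`. -/
def IsUnitary (U : E →L[ℂ] F) : Prop :=
  ∃ V : F →L[ℂ] E, IsAdjointPair A U V ∧
    V.comp U = ContinuousLinearMap.id ℂ E ∧ U.comp V = ContinuousLinearMap.id ℂ F

/-- `q` is a positive element of `𝓛(E)`. -/
def IsPositive (q : E →L[ℂ] E) : Prop :=
  IsAdjointPair A q q ∧ ∀ v, 0 ≤ inner A v (q v)

/-- The pairs `(v, w)` such that `⟨T u, v⟩ = ⟨u, w⟩` for every `u ∈ D(T)`. -/
def adjointGraph (T : E →ₗ.[ℂ] F) : Submodule ℂ (F × E) where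
  carrier := {p | ∀ u : T.domain, inner A (T u) p.1 = inner A (u : E) p.2}
  add_mem' := by
    intro p q hp hq u
    simp [hp u, hq u]
  zero_mem' := by
    intro u
    simp
  smul_mem' := by
    intro c p hp u
    simp [hp u]

/-- The adjoint `T⋆` of a densely defined operator. (The relation `adjointGraph A T` is the graph
of a function as soon as `D(T)` is dense, the only case in which this is used.) -/
def adjoint (T : E →ₗ.[ℂ] F) : F →ₗ.[ℂ] E := (adjointGraph A T).toLinearPMap

/-- `D(T)` is stable under the action of `A` and `T` commutes with this action. -/
def IsModuleMap (T : E →ₗ.[ℂ] F) : Prop :=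
  ∀ (a : A) (x : T.domain), ∃ h : a • (x : E) ∈ T.domain, T ⟨a • (x : E), h⟩ = a • T x

/-- `T` is a regular operator from within `E` into `F`. -/
structure IsRegular (T : E →ₗ.[ℂ] F) : Prop where
  dense_domain : Dense (T.domain : Set E)
  moduleMap : IsModuleMap A T
  closed : T.IsClosed
  dense_adjoint_domain : Dense ((adjoint A T).domain : Set F)
  dense_range :
    DenseRange (toP (ContinuousLinearMap.id ℂ E) + pcomp (adjoint A T) T).toFun

/-- `T` is a normal regular operator in `E`. -/
structure IsNormal (T : E →ₗ.[ℂ] E) : Prop where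
  regular : IsRegular A T
  domain_eq : T.domain = (adjoint A T).domain
  inner_eq : ∀ (v : T.domain) (w : (adjoint A T).domain), (v : E) = w →
    inner A (T v) (T v) = inner A (adjoint A T w) (adjoint A T w)

/-- `z` is the `z`-transform of `T`: `z ∈ 𝓛(E, F)`, `‖z‖ ≤ 1`, `D(T) = (1 - z⋆z)^{1/2} E` and
`T ((1 - z⋆z)^{1/2} v) = z v` for all `v`. Here `s = z⋆` and `q` is the positive square root of
`1 - z⋆z`; the last two conditions together say that the graph of `T` is `{(q v, z v) | v ∈ E}`. -/
def IsZTransform (T : E →ₗ.[ℂ] F) (z : E →L[ℂ] F) : Prop :=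
  ‖z‖ ≤ 1 ∧ ∃ (s : F →L[ℂ] E) (q : E →L[ℂ] E),
    IsAdjointPair A z s ∧ IsPositive A q ∧
    q.comp q = ContinuousLinearMap.id ℂ E - s.comp z ∧
    T.graph = LinearMap.range ((q : E →ₗ[ℂ] E).prod (z : E →ₗ[ℂ] F))

/-- `T` is invertible among regular operators: it is injective with regular inverse. -/
def IsInvertible (T : E →ₗ.[ℂ] F) : Prop :=
  Function.Injective T.toFun ∧ IsRegular A T.inverse

/-- `T` is adjointable invertible: there is `R ∈ 𝓛(F, E)` with `R T ⊆ T R = 1`. -/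
def IsAdjointableInvertible (T : E →ₗ.[ℂ] F) : Prop :=
  ∃ R : F →L[ℂ] E, IsAdjointable A R ∧
    pcomp (toP R) T ≤ toP (ContinuousLinearMap.id ℂ E) ∧
    pcomp T (toP R) = toP (ContinuousLinearMap.id ℂ F)

/-- The spectrum of `T`. -/
def spec (T : E →ₗ.[ℂ] E) : Set ℂ := {c | ¬ IsAdjointableInvertible A (subScalar T c)}

end Operators

/-! ### Functional calculus -/

section ZFunction

variable {X : Type*} [TopologicalSpace X]

/-- The function `f / (1 + |f|²)^{1/2}`: the `z`-transform of `f`, where `f ∈ C(X)` is regarded as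
an element affiliated with `C₀(X)`. -/
def zFun (f : C(X, ℂ)) : C(X, ℂ) where
  toFun x := f x / (√(1 + ‖f x‖ ^ 2) : ℝ)
  continuous_toFun := by
    refine f.continuous.div (by fun_prop) fun x => ?_
    have : 0 < √(1 + ‖f x‖ ^ 2) := by positivity
    exact_mod_cast this.ne'

theorem norm_zFun_le (f : C(X, ℂ)) (x : X) : ‖zFun f x‖ ≤ 1 := by
  have h : ‖f x‖ ≤ √(1 + ‖f x‖ ^ 2) := Real.le_sqrt_of_sq_le (by linarith)
  have h0 : 0 < √(1 + ‖f x‖ ^ 2) := by positivity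
  change ‖f x / ((√(1 + ‖f x‖ ^ 2) : ℝ) : ℂ)‖ ≤ 1
  rw [norm_div, Complex.norm_real, Real.norm_of_nonneg h0.le]
  exact (div_le_one h0).mpr h

/-- The product of the bounded function `zFun f` with an element of `C₀(X)`. -/
def zMul (f : C(X, ℂ)) (g : C₀(X, ℂ)) : C₀(X, ℂ) where
  toFun x := zFun f x * g x
  continuous_toFun := (zFun f).continuous.mul (map_continuous g)
  zero_at_infty' := by
    refine squeeze_zero_norm (fun x => ?_) (by simpa using (zero_at_infty g).norm)
    rw [norm_mul]
    exact mul_le_of_le_one_left (norm_nonneg _) (norm_zFun_le f x)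

end ZFunction

section Calculus

variable (A : Type*) [NonUnitalCStarAlgebra A] [PartialOrder A] [StarOrderedRing A]
  {E : Type*} [NormedAddCommGroup E] [NormedSpace ℂ E] [SMul A E] [CStarModule A E]

/-- `π` is a non-degenerate `⋆`-homomorphism from `C₀(X)` into `𝓛(E)`. -/
structure IsNondegenerateStarHom {X : Type*} [TopologicalSpace X]
    (π : C₀(X, ℂ) →ₙₐ[ℂ] (E →L[ℂ] E)) : Prop where
  adjoint : ∀ g, IsAdjointPair A (π g) (π (star g))
  nondegenerate :
    Dense (Submodule.span ℂ {y : E | ∃ (g : C₀(X, ℂ)) (v : E), π g v = y} : Set E)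

/-- `R = π(f)` for `f ∈ C(X)`: the regular operator whose `z`-transform is the value at `zFun f` of
the canonical extension of `π` to `M(C₀(X)) = C_b(X)`, i.e. the operator `z` with
`z π(g) = π(zFun f · g)` for all `g ∈ C₀(X)`. -/
def IsImage {X : Type*} [TopologicalSpace X] (π : C₀(X, ℂ) →ₙₐ[ℂ] (E →L[ℂ] E))
    (f : C(X, ℂ)) (R : E →ₗ.[ℂ] E) : Prop :=
  IsRegular A R ∧ ∃ z : E →L[ℂ] E, IsZTransform A R z ∧
    ∀ (g : C₀(X, ℂ)) (v : E), z (π g v) = π (zMul f g) v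

/-- `G` is almost closed: it becomes closed by adding finitely many points. -/
def IsAlmostClosed (G : Set ℂ) : Prop := ∃ K : Set ℂ, K.Finite ∧ IsClosed (G ∪ K)

/-- `G` is compatible with the normal operator `T`. -/
def IsCompatible (T : E →ₗ.[ℂ] E) (G : Set ℂ) : Prop :=
  IsAlmostClosed G ∧ ∃ K : Set ℂ, K.Finite ∧
    (∀ c ∈ K, IsInvertible A (subScalar T c)) ∧ spec A T \ K ⊆ G

/-- `R = f(T)` for a normal operator `T` and `f ∈ C(G)`: for some finite set `K` such that `T - c 1`
is invertible for every `c ∈ K` and such that `f` is defined on `σ(T) \ K`, and for a non-degenerate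
`⋆`-homomorphism `π : C₀(σ(T) \ K) → 𝓛(E)` sending the identity function of `σ(T) \ K` to `T`, the
operator `R` is `π` of the restriction of `f`. -/
def IsFunctionOf (T : E →ₗ.[ℂ] E) {G : Set ℂ} (f : C(G, ℂ)) (R : E →ₗ.[ℂ] E) : Prop :=
  ∃ K : Set ℂ, K.Finite ∧ (∀ c ∈ K, IsInvertible A (subScalar T c)) ∧
    ∃ (h : spec A T \ K ⊆ G)
      (π : C₀((spec A T \ K : Set ℂ), ℂ) →ₙₐ[ℂ] (E →L[ℂ] E)),
      IsNondegenerateStarHom A π ∧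
      IsImage A π ⟨fun x => (x : ℂ), continuous_subtype_val⟩ T ∧
      IsImage A π (f.comp ⟨Set.inclusion h, continuous_inclusion h⟩) R

end Calculus

end

end HilbertModule

set_option linter.unusedSectionVars false

namespace HilbertModule

noncomputable section

/-! ### The C⋆-algebra 𝓛(E) of adjointable operators -/

section AdjointableAlgebra

variable {A : Type*} [NonUnitalCStarAlgebra A] [PartialOrder A] [StarOrderedRing A]
  {E F : Type*}
  [NormedAddCommGroup E] [NormedSpace ℂ E] [SMul A E] [CStarModule A E]
  [NormedAddCommGroup F] [NormedSpace ℂ F] [SMul A F] [CStarModule A F]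

/-! Everything is moved to bounded operators through the z-transform. If z is the z-transform of a
normal regular T and q = (1 - z⋆z)^{1/2}, then z is normal, q is injective with dense range, and
formally T = z q⁻¹: the graph of T is {(q v, z v)}, and also {(x, y) | z x = q y}. With (z, q) for S
and (z', q') for T, the inclusion US ⊆ TU becomes the single bounded identity z'Uq = q'Uz.

The bounded Fuglede–Putnam theorem (`Intertwines.star_right`) is Rosenblum's Liouville argument,
which needs neither an adjoint of U nor A-linearity. To apply it, q is cut off near 0: with χ and k
functions of q such that k = q⁻¹ where χ ≠ 0, the operator zk is bounded and normal, and χ'Uχ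
intertwines zk and z'k'. Taking adjoints and removing the cut-offs gives z'⋆Uq = q'Uz⋆
(`star_relation`). The two identities and q² + z⋆z = 1 imply Uq² = q'²U, so U intertwines q, z and
z⋆ with their counterparts (`intertwines_of_relation`); this contains part 1.

For part 2, c ↦ c/√(1+|c|²) identifies σ(T) with the part of σ(z) in the open unit disc
(`IsZPair.mem_spec_iff`). The z-transform of f(T) should be Φ(z), where Φ is f/√(1+|f|²) in the disc
coordinate; but Φ may be discontinuous on the unit circle and at the finitely many points coming
from K. Multiplication by h = `vanishing K`, which is zero exactly there, makes Φh continuous, and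
h(z) = q ∏ (z - cq) has dense range because the T - c are invertible. So t h(z) = (Φh)(z) has at
most one solution t. Such a t exists (`IsZPair.exists_value`), and every admissible choice of K and
π leads to this equation (`IsFunctionOf.exists_isZPair`).

Since U intertwines continuous functions of z and z' (`cfc_rel`), cancelling h(z) shows that U
intertwines the z-transforms of f(S) and f(T), and then their square roots
(`intertwines_of_isFunctionOf`). The case U = 1 gives independence of the choices. If U is
bijective, so is the map it induces on the parameters v of the graphs, and the inclusion is an
equality. -/

variable (A) in
theorem ext_inner {x y : E} (h : ∀ w, inner A w x = inner A w y) : x = y := by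
  rw [← sub_eq_zero, ← CStarModule.inner_self (A := A)]
  simp [h]

variable (A) in
theorem ext_inner_of_denseRange {X : Type*} {p : X → E} (hp : DenseRange p) {x y : E}
    (h : ∀ w, inner A (p w) x = inner A (p w) y) : x = y := by
  refine ext_inner A fun w => ?_
  have h1 : Continuous fun w : E => inner A w x :=
    CStarModule.continuous_inner.comp (by fun_prop : Continuous fun w : E => (w, x))
  have h2 : Continuous fun w : E => inner A w y :=
    CStarModule.continuous_inner.comp (by fun_prop : Continuous fun w : E => (w, y))
  exact congrFun (hp.equalizer h1 h2 (funext h)) w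

theorem norm_le_of_inner_le {x : E} {y : F} (h : inner A x x ≤ inner A y y) : ‖x‖ ≤ ‖y‖ := by
  rw [CStarModule.norm_eq_sqrt_norm_inner_self (A := A) x,
    CStarModule.norm_eq_sqrt_norm_inner_self (A := A) y]
  exact Real.sqrt_le_sqrt
    (CStarAlgebra.norm_le_norm_of_nonneg_of_le CStarModule.inner_self_nonneg h)

theorem IsAdjointPair.symm {t : E →L[ℂ] F} {s : F →L[ℂ] E} (h : IsAdjointPair A t s) :
    IsAdjointPair A s t := fun x y => by
  rw [← CStarModule.star_inner y (s x), ← h, CStarModule.star_inner]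

theorem IsAdjointPair.unique {t : E →L[ℂ] F} {s s' : F →L[ℂ] E} (h : IsAdjointPair A t s)
    (h' : IsAdjointPair A t s') : s = s' :=
  ContinuousLinearMap.ext fun y => ext_inner A fun w => by rw [← h, ← h']

theorem IsAdjointPair.norm_le {t : E →L[ℂ] F} {s : F →L[ℂ] E} (h : IsAdjointPair A t s) :
    ‖s‖ ≤ ‖t‖ := by
  refine s.opNorm_le_bound (norm_nonneg _) fun y => ?_
  rcases eq_or_ne (s y) 0 with h0 | h0
  · rw [h0, norm_zero]; positivity
  · refine le_of_mul_le_mul_right ?_ (norm_pos_iff.mpr h0)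
    calc ‖s y‖ * ‖s y‖ = ‖inner A (s y) (s y)‖ := by
          rw [← CStarModule.norm_sq_eq A, sq]
      _ = ‖inner A (t (s y)) y‖ := by rw [h]
      _ ≤ ‖t (s y)‖ * ‖y‖ := CStarModule.norm_inner_le F
      _ ≤ (‖t‖ * ‖s y‖) * ‖y‖ := by gcongr; exact t.le_opNorm _
      _ = ‖t‖ * ‖y‖ * ‖s y‖ := by ring

theorem IsAdjointPair.map_smul {t : E →L[ℂ] F} {s : F →L[ℂ] E} (h : IsAdjointPair A t s)
    (a : A) (x : E) : t (a • x) = a • t x := by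
  refine ext_inner A fun w => ?_
  rw [← h.symm, CStarModule.inner_op_smul_right, CStarModule.inner_op_smul_right, h.symm]

variable (A E) in
/-- The algebra `𝓛(E)` of adjointable operators. -/
def adjointableSubalgebra : Subalgebra ℂ (E →L[ℂ] E) where
  carrier := {t | IsAdjointable A t}
  mul_mem' := by
    rintro t t' ⟨s, hs⟩ ⟨s', hs'⟩
    exact ⟨s' * s, fun x y => by simp [hs _ _, hs' _ _]⟩
  add_mem' := by
    rintro t t' ⟨s, hs⟩ ⟨s', hs'⟩
    exact ⟨s + s', fun x y => by simp [hs _ _, hs' _ _]⟩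
  algebraMap_mem' := fun c => ⟨algebraMap ℂ _ (star c), fun x y => by
    simp [Algebra.algebraMap_eq_smul_one]⟩

/-- The choice is harmless because adjoints are unique; `star_eq_of_isAdjointPair_aux` removes it.
-/
instance : Star (adjointableSubalgebra A E) :=
  ⟨fun t => ⟨t.2.choose, (t : E →L[ℂ] E), t.2.choose_spec.symm⟩⟩

theorem star_eq_of_isAdjointPair_aux {t s : adjointableSubalgebra A E}
    (h : IsAdjointPair A (t : E →L[ℂ] E) s) : star t = s :=
  Subtype.ext (t.2.choose_spec.unique h)

theorem inner_left_eq_aux (t : adjointableSubalgebra A E) (x y : E) :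
    inner A ((t : E →L[ℂ] E) x) y = inner A x ((star t : adjointableSubalgebra A E).1 y) :=
  t.2.choose_spec x y

instance : StarRing (adjointableSubalgebra A E) where
  star_involutive t := star_eq_of_isAdjointPair_aux t.2.choose_spec.symm
  star_mul t s := star_eq_of_isAdjointPair_aux fun x y => by simp [inner_left_eq_aux]
  star_add t s := star_eq_of_isAdjointPair_aux fun x y => by simp [inner_left_eq_aux]

instance : StarModule ℂ (adjointableSubalgebra A E) where
  star_smul c t := star_eq_of_isAdjointPair_aux fun x y => by simp [inner_left_eq_aux]

instance : CStarRing (adjointableSubalgebra A E) where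
  norm_mul_self_le t := by
    have h : ‖(t : E →L[ℂ] E)‖ ≤ √‖star t * t‖ := by
      refine ContinuousLinearMap.opNorm_le_bound _ (Real.sqrt_nonneg _) fun x => ?_
      have hn : 0 ≤ ‖star t * t‖ := norm_nonneg _
      refine (pow_le_pow_iff_left₀ (norm_nonneg _) (by positivity) two_ne_zero).mp ?_
      rw [mul_pow, Real.sq_sqrt hn, CStarModule.norm_sq_eq A, inner_left_eq_aux]
      calc _ ≤ ‖x‖ * ‖(star t * t).1 x‖ := CStarModule.norm_inner_le E
        _ ≤ ‖x‖ * (‖star t * t‖ * ‖x‖) := by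
          gcongr; exact ContinuousLinearMap.le_opNorm _ _
        _ = _ := by ring
    calc ‖t‖ * ‖t‖ ≤ √‖star t * t‖ * √‖star t * t‖ := by gcongr <;> exact h
      _ = _ := Real.mul_self_sqrt (norm_nonneg _)

/-- Taking adjoints does not increase norms, so the adjoints of a Cauchy sequence are Cauchy, and
the adjoint relation survives in the limit. -/
theorem isClosed_adjointableSubalgebra [CompleteSpace E] :
    IsClosed (adjointableSubalgebra A E : Set (E →L[ℂ] E)) := by
  refine isClosed_of_closure_subset fun t ht => ?_
  obtain ⟨u, hu, hlim⟩ := mem_closure_iff_seq_limit.mp ht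
  choose s hs using hu
  have hc : CauchySeq s := by
    have := hlim.cauchySeq
    rw [Metric.cauchySeq_iff] at this ⊢
    intro ε hε
    obtain ⟨N, hN⟩ := this ε hε
    refine ⟨N, fun m hm n hn => lt_of_le_of_lt ?_ (hN m hm n hn)⟩
    rw [dist_eq_norm, dist_eq_norm]
    have : IsAdjointPair A (u m - u n) (s m - s n) := fun x y => by
      simp [hs m _ _, hs n _ _]
    exact this.norm_le
  obtain ⟨s', hs'⟩ := cauchySeq_tendsto_of_complete hc
  refine ⟨s', fun x y => ?_⟩
  have h1 : Filter.Tendsto (fun n => inner A (u n x) y) Filter.atTop (nhds (inner A (t x) y)) :=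
    (CStarModule.continuous_inner.tendsto (t x, y)).comp
      (((ContinuousLinearMap.apply ℂ E x).continuous.tendsto t |>.comp hlim).prodMk_nhds
        tendsto_const_nhds)
  have h2 : Filter.Tendsto (fun n => inner A x (s n y)) Filter.atTop (nhds (inner A x (s' y))) :=
    (CStarModule.continuous_inner.tendsto (x, s' y)).comp
      (tendsto_const_nhds.prodMk_nhds
        ((ContinuousLinearMap.apply ℂ E y).continuous.tendsto s' |>.comp hs'))
  exact tendsto_nhds_unique h1 (h2.congr fun n => (hs n x y).symm)

instance [CompleteSpace E] : CompleteSpace (adjointableSubalgebra A E) :=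
  isClosed_adjointableSubalgebra.completeSpace_coe

instance [CompleteSpace E] : CStarAlgebra (adjointableSubalgebra A E) where

variable (A E) in
/-- The C⋆-algebra `𝓛(E)` of adjointable operators. -/
def Adj : Type _ := adjointableSubalgebra A E

variable [CompleteSpace E]

instance : CStarAlgebra (Adj A E) :=
  inferInstanceAs (CStarAlgebra (adjointableSubalgebra A E))

namespace Adj

/-- The underlying bounded operator. -/
def op (t : Adj A E) : E →L[ℂ] E := Subtype.val t

/-- The element of `𝓛(E)` given by an operator with an adjoint. -/
def mk {t s : E →L[ℂ] E} (h : IsAdjointPair A t s) : Adj A E := ⟨t, s, h⟩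

theorem ext {t s : Adj A E} (h : ∀ x, t.op x = s.op x) : t = s :=
  Subtype.ext (ContinuousLinearMap.ext h)

theorem congr_op {t s : Adj A E} (h : t = s) (x : E) : t.op x = s.op x := by rw [h]

@[simp] theorem mul_op (t s : Adj A E) (x : E) : (t * s).op x = t.op (s.op x) := rfl
@[simp] theorem add_op (t s : Adj A E) (x : E) : (t + s).op x = t.op x + s.op x := rfl
@[simp] theorem sub_op (t s : Adj A E) (x : E) : (t - s).op x = t.op x - s.op x := rfl
@[simp] theorem zero_op (x : E) : (0 : Adj A E).op x = 0 := rfl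
@[simp] theorem one_op (x : E) : (1 : Adj A E).op x = x := rfl
@[simp] theorem smul_op (c : ℂ) (t : Adj A E) (x : E) : (c • t).op x = c • t.op x := rfl

theorem norm_def (t : Adj A E) : ‖t‖ = ‖t.op‖ := rfl

variable (A E) in
/-- The inclusion of `𝓛(E)` into the bounded operators. -/
def opL : Adj A E →L[ℂ] (E →L[ℂ] E) :=
  LinearMap.mkContinuous ⟨⟨op, fun _ _ => rfl⟩, fun _ _ => rfl⟩ 1 fun t => by
    rw [one_mul]; exact le_rfl

@[simp] theorem opL_apply (t : Adj A E) : opL A E t = t.op := rfl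

theorem continuous_op : Continuous (op : Adj A E → E →L[ℂ] E) := (opL A E).continuous

theorem isAdjointPair_star (t : Adj A E) : IsAdjointPair A t.op (star t).op :=
  fun x y => inner_left_eq_aux (show adjointableSubalgebra A E from t) x y

theorem inner_left_eq (t : Adj A E) (x y : E) : inner A (t.op x) y = inner A x ((star t).op y) :=
  isAdjointPair_star t x y

theorem inner_right_eq (t : Adj A E) (x y : E) : inner A x (t.op y) = inner A ((star t).op x) y :=
  ((isAdjointPair_star t).symm x y).symm

theorem op_star_eq {t : Adj A E} {s : E →L[ℂ] E} (h : IsAdjointPair A t.op s) :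
    (star t).op = s :=
  (isAdjointPair_star t).unique h

theorem star_eq_of_isAdjointPair {t s : Adj A E} (h : IsAdjointPair A t.op s.op) : star t = s :=
  Subtype.ext (op_star_eq h)

end Adj

end AdjointableAlgebra

/-! ### Functional calculus in 𝓛(E), intertwining, positivity and density of ranges -/

section Calculus

/-- The pairs satisfying P together with their adjoints form a closed star subalgebra of B × C. It
contains (a, b), hence also φ(a, b) = (φ(a), φ(b)). This serves both for intertwining relations and
for comparing operators with multipliers of C₀(X). -/
theorem cfc_rel {B C : Type*} [CStarAlgebra B] [CStarAlgebra C] {P : B → C → Prop}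
    (halg : ∀ c : ℂ, P (algebraMap ℂ B c) (algebraMap ℂ C c))
    (hadd : ∀ x x' y y', P x y → P x' y' → P (x + x') (y + y'))
    (hmul : ∀ x x' y y', P x y → P x' y' → P (x * x') (y * y'))
    (hclosed : IsClosed {p : B × C | P p.1 p.2}) {a : B} {b : C}
    (ha : IsStarNormal a) (hb : IsStarNormal b) {φ : ℂ → ℂ}
    (hφ : ContinuousOn φ (spectrum ℂ a ∪ spectrum ℂ b)) (h : P a b) (h' : P (star a) (star b)) :
    P (cfc φ a) (cfc φ b) := by
  let W : StarSubalgebra ℂ (B × C) :=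
    { carrier := {p | P p.1 p.2 ∧ P (star p.1) (star p.2)}
      mul_mem' := by
        rintro p q ⟨h1, h2⟩ ⟨h3, h4⟩
        exact ⟨hmul _ _ _ _ h1 h3, by simpa using hmul _ _ _ _ h4 h2⟩
      add_mem' := by
        rintro p q ⟨h1, h2⟩ ⟨h3, h4⟩
        exact ⟨hadd _ _ _ _ h1 h3, by simpa using hadd _ _ _ _ h2 h4⟩
      algebraMap_mem' := fun c => ⟨halg c, by
        simpa [Algebra.algebraMap_eq_smul_one] using halg (star c)⟩
      star_mem' := by
        rintro p ⟨h1, h2⟩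
        exact ⟨h2, by simpa using h1⟩ }
  have hW : IsClosed (W : Set (B × C)) :=
    hclosed.inter (hclosed.preimage (continuous_star (R := B × C)))
  have hab : IsStarNormal (a, b) := ⟨Prod.ext ha.1 hb.1⟩
  have := cfc_mem (𝕜 := ℂ) (𝕜' := ℂ) (s := W) φ (a := (a, b)) ⟨h, h'⟩
  rw [cfc_map_prod (S := ℂ) φ a b hφ hab ha hb] at this
  exact this.1

variable {A : Type*} [NonUnitalCStarAlgebra A] [PartialOrder A] [StarOrderedRing A]
  {E F : Type*}
  [NormedAddCommGroup E] [NormedSpace ℂ E] [SMul A E] [CStarModule A E] [CompleteSpace E]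
  [NormedAddCommGroup F] [NormedSpace ℂ F] [SMul A F] [CStarModule A F] [CompleteSpace F]

/-- `U a = b U`. -/
def Intertwines (U : E →L[ℂ] F) (a : Adj A E) (b : Adj A F) : Prop :=
  ∀ x, U (a.op x) = b.op (U x)

theorem isClosed_setOf_intertwines (U : E →L[ℂ] F) :
    IsClosed {p : Adj A E × Adj A F | Intertwines U p.1 p.2} := by
  simp only [Intertwines, Set.ofPred_forall]
  refine isClosed_iInter fun x => isClosed_eq ?_ ?_
  · exact U.continuous.comp ((ContinuousLinearMap.apply ℂ E x).continuous.comp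
      (Adj.continuous_op.comp continuous_fst))
  · exact (ContinuousLinearMap.apply ℂ F (U x)).continuous.comp
      (Adj.continuous_op.comp continuous_snd)

theorem Intertwines.cfc {U : E →L[ℂ] F} {a : Adj A E} {b : Adj A F}
    (ha : IsStarNormal a) (hb : IsStarNormal b) (h : Intertwines U a b)
    (h' : Intertwines U (star a) (star b)) {φ : ℂ → ℂ}
    (hφ : ContinuousOn φ (spectrum ℂ a ∪ spectrum ℂ b)) :
    Intertwines U (cfc φ a) (cfc φ b) := by
  refine cfc_rel (P := Intertwines U) (fun c x => ?_) (fun p p' r r' h1 h2 x => ?_)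
    (fun p p' r r' h1 h2 x => ?_) (isClosed_setOf_intertwines U) ha hb hφ h h'
  · simp [Algebra.algebraMap_eq_smul_one]
  · simp [h1 x, h2 x]
  · simp [h1 _, h2 x]

/-! ### Positivity -/

theorem inner_star_mul_self_nonneg (a : Adj A E) (v : E) :
    0 ≤ inner A v ((star a * a).op v) := by
  have : inner A v ((star a * a).op v) = inner A (a.op v) (a.op v) := by
    rw [Adj.inner_left_eq]; rfl
  rw [this]
  exact CStarModule.inner_self_nonneg

theorem inner_cfc_nonneg {a : Adj A E} {φ : ℂ → ℝ}
    (hφ : ContinuousOn φ (spectrum ℂ a)) (h0 : ∀ x ∈ spectrum ℂ a, 0 ≤ φ x) (v : E) :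
    0 ≤ inner A v ((cfc (fun x => (φ x : ℂ)) a).op v) := by
  have h : cfc (fun x => (φ x : ℂ)) a =
      star (cfc (fun x => ((√(φ x) : ℝ) : ℂ)) a) * cfc (fun x => ((√(φ x) : ℝ) : ℂ)) a := by
    have hc : ContinuousOn (fun x => ((√(φ x) : ℝ) : ℂ)) (spectrum ℂ a) :=
      Complex.continuous_ofReal.comp_continuousOn hφ.sqrt
    rw [← cfc_star, ← cfc_mul _ _ a hc.star hc]
    refine cfc_congr fun x hx => ?_
    simp only [Complex.star_def, Complex.conj_ofReal, ← Complex.ofReal_mul]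
    rw [Real.mul_self_sqrt (h0 x hx)]
  rw [h]
  exact inner_star_mul_self_nonneg _ v

theorem star_cfc_ofReal (a : Adj A E) (φ : ℂ → ℝ) :
    star (cfc (fun x => (φ x : ℂ)) a) = cfc (fun x => (φ x : ℂ)) a := by
  rw [← cfc_star]
  exact cfc_congr fun x _ => by simp

theorem IsPositive.star_eq {q : Adj A E} (hq : IsPositive A q.op) : star q = q :=
  Adj.star_eq_of_isAdjointPair hq.1

theorem isPositive_of_star_eq {q : Adj A E} (hq : star q = q)
    (h : ∀ v, 0 ≤ inner A v (q.op v)) : IsPositive A q.op :=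
  ⟨fun x y => by rw [Adj.inner_left_eq, hq], h⟩

theorem isPositive_cfc_ofReal {a : Adj A E} {φ : ℂ → ℝ}
    (hφ : ContinuousOn φ (spectrum ℂ a)) (h0 : ∀ x ∈ spectrum ℂ a, 0 ≤ φ x) :
    IsPositive A (cfc (fun x => (φ x : ℂ)) a).op :=
  isPositive_of_star_eq (star_cfc_ofReal a φ) (inner_cfc_nonneg hφ h0)

theorem eq_zero_of_star_mul_self {a : Adj A E} {v : E} (h : (star a * a).op v = 0) :
    a.op v = 0 := by
  rw [← CStarModule.inner_self (A := A), Adj.inner_left_eq]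
  rw [show (star a).op (a.op v) = (star a * a).op v from rfl, h]
  simp

/-- Two commuting positive operators with the same square coincide. -/
theorem eq_of_sq_eq_of_commute {p r q : Adj A E} (hp : p = star r * r)
    (hq : IsPositive A q.op) (hc : Commute p q) (h : p * p = q * q) : p = q := by
  have hps : star p = p := by simp [hp]
  have hqs := hq.star_eq
  have hsum : (p + q) * (p - q) = 0 := by
    rw [add_mul, mul_sub, mul_sub, h, hc.eq]; abel
  -- On a vector w in the range of p - q the operator p + q vanishes, so the nonnegative elements
  -- ⟨w, p w⟩ and ⟨w, q w⟩ add up to 0. The factorisation p = r⋆r turns ⟨w, p w⟩ = 0 into p w = 0,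
  -- and then q w = 0.
  have key : (p - q) * (p - q) = 0 := by
    refine Adj.ext fun v => ?_
    set w := (p - q).op v with hw
    have hw0 : p.op w + q.op w = 0 := congrArg (fun t : Adj A E => t.op v) hsum
    have h1 : 0 ≤ inner A w (p.op w) := by rw [hp]; exact inner_star_mul_self_nonneg r w
    have h2 := hq.2 w
    have h3 : inner A w (p.op w) + inner A w (q.op w) = 0 := by
      rw [← CStarModule.inner_add_right, hw0]; simp
    have h4 : inner A w (p.op w) = 0 := ((add_eq_zero_iff_of_nonneg h1 h2).mp h3).1
    have h5 : r.op w = 0 := by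
      rw [← CStarModule.inner_self (A := A), Adj.inner_left_eq, ← h4, hp]; rfl
    have h6 : p.op w = 0 := by
      rw [hp]; change (star r).op (r.op w) = 0; rw [h5]; simp
    have h7 : q.op w = 0 := by rw [h6, zero_add] at hw0; exact hw0
    change p.op w - q.op w = 0
    rw [h6, h7, sub_zero]
  have hs : star (p - q) = p - q := by rw [star_sub, hps, hqs]
  refine Adj.ext fun v => ?_
  have := eq_zero_of_star_mul_self (a := p - q) (v := v) (by rw [hs, key]; rfl)
  exact sub_eq_zero.mp this

/-- The positive square root, given by the functional calculus. -/
def posSqrt (b : Adj A E) : Adj A E := cfc (fun x => ((√x.re : ℝ) : ℂ)) b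

/-- The calculus gives |q|, since the spectrum of q is not yet known to be nonnegative. But |q| and
q commute, have the same square and are positive for the inner product, so they agree. -/
theorem posSqrt_mul_self {q : Adj A E} (hq : IsPositive A q.op) :
    posSqrt (q * q) = q := by
  have hsa : IsSelfAdjoint q := hq.star_eq
  have hn : IsStarNormal q := hsa.isStarNormal
  have hre : ∀ x ∈ spectrum ℂ q, x = x.re := fun x hx => hsa.mem_spectrum_eq_re hx
  have h1 : posSqrt (q * q) = cfc (fun x => ((√(x * x).re : ℝ) : ℂ)) q := by
    rw [posSqrt, cfc_comp' (fun x => ((√x.re : ℝ) : ℂ)) (fun x => x * x) q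
      (by fun_prop) (by fun_prop), cfc_mul (fun x : ℂ => x) (fun x => x) q, cfc_id' ℂ q]
  have h0 : ∀ x ∈ spectrum ℂ q, 0 ≤ √(x * x).re := fun x _ => Real.sqrt_nonneg _
  rw [h1]
  refine eq_of_sq_eq_of_commute (r := cfc (fun x => ((√√(x * x).re : ℝ) : ℂ)) q) ?_ hq ?_ ?_
  · rw [star_cfc_ofReal, ← cfc_mul _ _ q (by fun_prop) (by fun_prop)]
    refine cfc_congr fun x hx => ?_
    simp only [← Complex.ofReal_mul]
    rw [Real.mul_self_sqrt (h0 x hx)]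
  · have := cfc_commute_cfc (fun x : ℂ => ((√(x * x).re : ℝ) : ℂ)) (fun x => x) q
    rwa [cfc_id' ℂ q] at this
  · rw [← cfc_mul _ _ q (by fun_prop) (by fun_prop)]
    conv_rhs => rw [← cfc_id' ℂ q, ← cfc_mul _ _ q (by fun_prop) (by fun_prop)]
    refine cfc_congr fun x hx => ?_
    simp only [← Complex.ofReal_mul]
    rw [hre x hx, ← Complex.ofReal_mul, Complex.ofReal_re, Real.mul_self_sqrt (mul_self_nonneg _)]

/-- Operators that intertwine the squares of positive operators intertwine these operators. -/
theorem Intertwines.of_mul_self {U : E →L[ℂ] F} {p : Adj A E} {q : Adj A F}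
    (hp : IsPositive A p.op) (hq : IsPositive A q.op) (h : Intertwines U (p * p) (q * q)) :
    Intertwines U p q := by
  have hps := hp.star_eq
  have hqs := hq.star_eq
  have h1 : IsSelfAdjoint (p * p) := by simp [IsSelfAdjoint, hps]
  have h2 : IsSelfAdjoint (q * q) := by simp [IsSelfAdjoint, hqs]
  have := Intertwines.cfc (φ := fun x => ((√x.re : ℝ) : ℂ)) h1.isStarNormal h2.isStarNormal h
    (by rwa [h1.star_eq, h2.star_eq]) (by fun_prop)
  rwa [← posSqrt, ← posSqrt, posSqrt_mul_self hp, posSqrt_mul_self hq] at this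

theorem eq_of_mul_self_eq {p q : Adj A E}
    (hp : IsPositive A p.op) (hq : IsPositive A q.op) (h : p * p = q * q) : p = q := by
  rw [← posSqrt_mul_self hp, h, posSqrt_mul_self hq]

/-! ### Density of ranges and multipliers -/

theorem injective_of_denseRange_star {a : Adj A E} (h : DenseRange (star a).op) {v : E}
    (hv : a.op v = 0) : v = 0 :=
  ext_inner_of_denseRange A h fun w => by
    rw [← Adj.inner_right_eq, hv]; simp

theorem eq_of_mul_eq_of_denseRange {a b d : Adj A E} (hd : DenseRange d.op)
    (h : a * d = b * d) : a = b := by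
  refine Adj.ext fun v => ?_
  refine congrFun (hd.equalizer a.op.continuous b.op.continuous (funext fun w => ?_)) v
  exact congrArg (fun t : Adj A E => t.op w) h

theorem denseRange_mul {a b : Adj A E} (ha : DenseRange a.op) (hb : DenseRange b.op) :
    DenseRange (a * b).op :=
  DenseRange.comp (g := a.op) (f := b.op) ha hb a.op.continuous

/-- A Dini argument: the open sets where the strict inequality holds increase with n and cover the
compact space. It says that ψ/(1 + n|φ|²) becomes uniformly small. -/
theorem exists_norm_le_mul {X : Type*} [TopologicalSpace X] [CompactSpace X] {φ ψ : X → ℂ}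
    (hφ : Continuous φ) (hψ : Continuous ψ) (h : ∀ x, φ x = 0 → ψ x = 0) {ε : ℝ} (hε : 0 < ε) :
    ∃ n : ℕ, ∀ x, ‖ψ x‖ ≤ ε * (1 + n * ‖φ x‖ ^ 2) := by
  have hcover : Set.univ ⊆ ⋃ n : ℕ, {x | ‖ψ x‖ < ε * (1 + n * ‖φ x‖ ^ 2)} := by
    intro x _
    rw [Set.mem_iUnion]
    by_cases hx : φ x = 0
    · exact ⟨0, by simp [h x hx, hε]⟩
    · have hp : 0 < ε * ‖φ x‖ ^ 2 := by positivity
      obtain ⟨n, hn⟩ := exists_nat_gt (‖ψ x‖ / (ε * ‖φ x‖ ^ 2))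
      refine ⟨n, ?_⟩
      rw [div_lt_iff₀ hp] at hn
      simp only [Set.mem_ofPred_eq]
      nlinarith
  obtain ⟨n, hn⟩ := (isCompact_univ (X := X)).elim_directed_cover
    (fun n : ℕ => {x | ‖ψ x‖ < ε * (1 + n * ‖φ x‖ ^ 2)})
    (fun n => isOpen_lt (by fun_prop) (by fun_prop)) hcover
    (directed_of_isDirected_le fun m n hmn x (hx : _ < _) =>
      show ‖ψ x‖ < ε * (1 + n * ‖φ x‖ ^ 2) from hx.trans_le (by gcongr))
  exact ⟨n, fun x => (hn (Set.mem_univ x)).le⟩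

/-- On the spectrum, ψ is a uniform limit of the multiples φ k with k = n φ̄ψ/(1 + n|φ|²), the error
being ψ/(1 + n|φ|²). So the closure of the range of φ(a) contains the range of ψ(a). -/
theorem denseRange_cfc {a : Adj A E} {φ ψ : ℂ → ℂ}
    (hφ : ContinuousOn φ (spectrum ℂ a)) (hψ : ContinuousOn ψ (spectrum ℂ a))
    (h : ∀ x ∈ spectrum ℂ a, φ x = 0 → ψ x = 0) (hd : DenseRange (cfc ψ a).op) :
    DenseRange (cfc φ a).op := by
  refine Dense.of_closure (hd.mono ?_)
  rintro _ ⟨w, rfl⟩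
  rw [Metric.mem_closure_iff]
  intro ε hε
  have hε' : 0 < ε / (‖w‖ + 1) := by positivity
  have : CompactSpace (spectrum ℂ a) := isCompact_iff_compactSpace.mp (spectrum.isCompact a)
  obtain ⟨n, hn⟩ := exists_norm_le_mul hφ.domRestrict hψ.domRestrict (fun x => h x x.2) hε'
  have hpos : ∀ x, (0 : ℝ) < 1 + n * ‖φ x‖ ^ 2 := fun x => by positivity
  set k : ℂ → ℂ := fun x => star (φ x) * ψ x * n / ((1 + n * ‖φ x‖ ^ 2 : ℝ) : ℂ) with hk
  have hkc : ContinuousOn k (spectrum ℂ a) := by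
    refine ContinuousOn.div ((hφ.star.mul hψ).mul continuousOn_const) ?_ fun x _ => ?_
    · exact Complex.continuous_ofReal.comp_continuousOn
        (continuousOn_const.add (continuousOn_const.mul (hφ.norm.pow 2)))
    · exact_mod_cast (hpos x).ne'
  refine ⟨_, ⟨(cfc k a).op w, rfl⟩, ?_⟩
  have hnorm : ‖cfc ψ a - cfc φ a * cfc k a‖ ≤ ε / (‖w‖ + 1) := by
    rw [← cfc_mul _ _ a hφ hkc, ← cfc_sub ψ (fun x => φ x * k x) a hψ (hφ.mul hkc)]
    refine norm_cfc_le hε'.le fun x hx => ?_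
    have hne : ((1 + n * ‖φ x‖ ^ 2 : ℝ) : ℂ) ≠ 0 := by exact_mod_cast (hpos x).ne'
    have : ψ x - φ x * k x = ψ x / ((1 + n * ‖φ x‖ ^ 2 : ℝ) : ℂ) := by
      rw [hk, eq_div_iff hne, sub_mul]
      have e : φ x * star (φ x) = ((‖φ x‖ ^ 2 : ℝ) : ℂ) := by
        rw [Complex.star_def, Complex.mul_conj, Complex.normSq_eq_norm_sq]
      have : φ x * (star (φ x) * ψ x * n / ((1 + n * ‖φ x‖ ^ 2 : ℝ) : ℂ)) *
          ((1 + n * ‖φ x‖ ^ 2 : ℝ) : ℂ) = (φ x * star (φ x)) * ψ x * n := by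
        field_simp
      rw [this, e]; push_cast; ring
    rw [this, norm_div, Complex.norm_real, Real.norm_of_nonneg (hpos x).le, div_le_iff₀ (hpos x)]
    exact hn ⟨x, hx⟩
  rw [dist_eq_norm]
  calc ‖(cfc ψ a).op w - (cfc φ a).op ((cfc k a).op w)‖
      = ‖(cfc ψ a - cfc φ a * cfc k a).op w‖ := rfl
    _ ≤ ‖cfc ψ a - cfc φ a * cfc k a‖ * ‖w‖ := ContinuousLinearMap.le_opNorm _ _
    _ ≤ ε / (‖w‖ + 1) * ‖w‖ := by gcongr
    _ < ε := by
      rw [div_mul_eq_mul_div, div_lt_iff₀ (by positivity)]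
      nlinarith

/-- Extension of a bounded densely defined operator with a bounded densely defined adjoint. -/
theorem exists_adjointable_extension {X Y : Type*} [AddCommGroup X] [Module ℂ X]
    [AddCommGroup Y] [Module ℂ Y] {p m : X →ₗ[ℂ] E} {p' m' : Y →ₗ[ℂ] E} (hp : DenseRange p)
    (hp' : DenseRange p') (hm : ∀ x, ‖m x‖ ≤ ‖p x‖) (hm' : ∀ y, ‖m' y‖ ≤ ‖p' y‖)
    (h : ∀ x y, inner A (m x) (p' y) = inner A (p x) (m' y)) :
    ∃ t : Adj A E, ‖t‖ ≤ 1 ∧ (∀ x, t.op (p x) = m x) ∧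
      ∀ y, (star t).op (p' y) = m' y := by
  have hm1 : ∀ x, ‖m x‖ ≤ 1 * ‖p x‖ := by simpa using hm
  have hm1' : ∀ x, ‖m' x‖ ≤ 1 * ‖p' x‖ := by simpa using hm'
  have e := LinearMap.extendOfNorm_eq (f := m) hp ⟨1, hm1⟩
  have e' := LinearMap.extendOfNorm_eq (f := m') hp' ⟨1, hm1'⟩
  have hadj : IsAdjointPair A (m.extendOfNorm p) (m'.extendOfNorm p') := by
    intro x y
    have c1 : Continuous fun z : E × E => inner A (m.extendOfNorm p z.1) z.2 :=
      CStarModule.continuous_inner.comp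
        (by fun_prop : Continuous fun z : E × E => (m.extendOfNorm p z.1, z.2))
    have c2 : Continuous fun z : E × E => inner A z.1 (m'.extendOfNorm p' z.2) :=
      CStarModule.continuous_inner.comp
        (by fun_prop : Continuous fun z : E × E => (z.1, m'.extendOfNorm p' z.2))
    refine congrFun ((hp.prodMap hp').equalizer c1 c2 (funext fun z => ?_)) (x, y)
    simp only [Function.comp, Prod.map]
    rw [e, e', h]
  refine ⟨Adj.mk hadj, ?_, e, fun y => ?_⟩
  · exact LinearMap.opNorm_extendOfNorm_le hp zero_le_one hm1
  · rw [Adj.op_star_eq (t := Adj.mk hadj) hadj, e']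

/-- The A-valued squares of the two vectors differ by ⟨v, (|ψ|² - |φ|²)(z) v⟩ ≥ 0. -/
theorem norm_cfc_apply_le {z : Adj A E} {φ ψ : ℂ → ℂ}
    (hφ : ContinuousOn φ (spectrum ℂ z)) (hψ : ContinuousOn ψ (spectrum ℂ z))
    (h : ∀ x ∈ spectrum ℂ z, ‖φ x‖ ≤ ‖ψ x‖) (v : E) : ‖(cfc φ z).op v‖ ≤ ‖(cfc ψ z).op v‖ := by
  have e : ∀ χ : ℂ → ℂ, ContinuousOn χ (spectrum ℂ z) →
      inner A ((cfc χ z).op v) ((cfc χ z).op v) =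
        inner A v ((cfc (fun x => star (χ x) * χ x) z).op v) := fun χ hχ => by
    rw [Adj.inner_left_eq, cfc_mul _ _ z hχ.star hχ, cfc_star]; rfl
  refine norm_le_of_inner_le (A := A) ?_
  rw [e φ hφ, e ψ hψ, ← sub_nonneg, ← CStarModule.inner_sub_right]
  have := inner_cfc_nonneg (a := z) (φ := fun x => ‖ψ x‖ ^ 2 - ‖φ x‖ ^ 2)
    ((hψ.norm.pow 2).sub (hφ.norm.pow 2))
    (fun x hx => sub_nonneg.mpr (pow_le_pow_left₀ (norm_nonneg _) (h x hx) 2)) v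
  convert this using 2
  rw [← Adj.sub_op,
    ← cfc_sub (fun x => star (ψ x) * ψ x) (fun x => star (φ x) * φ x) z
      (hψ.star.mul hψ) (hφ.star.mul hφ)]
  refine congrArg (fun t : Adj A E => t.op v) (cfc_congr fun x _ => ?_)
  simp [Complex.conj_mul']

/-- A bounded function which becomes continuous after multiplication by a function `h`, where
`h(z)` has dense range, defines a bounded operator. -/
theorem exists_multiplier {z : Adj A E} {φ h : ℂ → ℂ}
    (hφ1 : ∀ x ∈ spectrum ℂ z, ‖φ x‖ ≤ 1) (hh : ContinuousOn h (spectrum ℂ z))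
    (hφ : ContinuousOn (fun x => φ x * h x) (spectrum ℂ z))
    (hφ' : ContinuousOn (fun x => star (φ x) * h x) (spectrum ℂ z))
    (hd : DenseRange (cfc h z).op) :
    ∃ t : Adj A E, ‖t‖ ≤ 1 ∧ t * cfc h z = cfc (fun x => φ x * h x) z ∧
      star t * cfc h z = cfc (fun x => star (φ x) * h x) z := by
  have hle : ∀ χ : ℂ → ℂ, (∀ x ∈ spectrum ℂ z, ‖χ x‖ ≤ 1) →
      ∀ x ∈ spectrum ℂ z, ‖χ x * h x‖ ≤ ‖h x‖ := fun χ hχ x hx => by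
    rw [norm_mul]; exact mul_le_of_le_one_left (norm_nonneg _) (hχ x hx)
  have hadj : ∀ x y, inner A ((cfc (fun x => φ x * h x) z).op x) ((cfc h z).op y) =
      inner A ((cfc h z).op x) ((cfc (fun x => star (φ x) * h x) z).op y) := fun x y => by
    rw [Adj.inner_left_eq, Adj.inner_left_eq, ← cfc_star, ← cfc_star]
    change inner A x ((cfc (fun x => star (φ x * h x)) z * cfc h z).op y) =
      inner A x ((cfc (fun x => star (h x)) z * cfc (fun x => star (φ x) * h x) z).op y)
    rw [← cfc_mul _ _ z hφ.star hh, ← cfc_mul _ _ z hh.star hφ']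
    congr 4
    ext x
    rw [star_mul]; ring
  obtain ⟨t, ht1, ht2, ht3⟩ := exists_adjointable_extension (A := A)
    (p := ((cfc h z).op : E →ₗ[ℂ] E)) (m := ((cfc (fun x => φ x * h x) z).op : E →ₗ[ℂ] E))
    (p' := ((cfc h z).op : E →ₗ[ℂ] E)) (m' := ((cfc (fun x => star (φ x) * h x) z).op : E →ₗ[ℂ] E))
    hd hd (norm_cfc_apply_le hφ hh (hle φ hφ1))
    (norm_cfc_apply_le hφ' hh (hle _ fun x hx => by simpa using hφ1 x hx)) hadj
  exact ⟨t, ht1, Adj.ext ht2, Adj.ext ht3⟩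

end Calculus

/-! ### The Fuglede–Putnam theorem for bounded normal operators -/

section BoundedFuglede

variable {A : Type*} [NonUnitalCStarAlgebra A] [PartialOrder A] [StarOrderedRing A]
  {E F : Type*}
  [NormedAddCommGroup E] [NormedSpace ℂ E] [SMul A E] [CStarModule A E] [CompleteSpace E]
  [NormedAddCommGroup F] [NormedSpace ℂ F] [SMul A F] [CStarModule A F] [CompleteSpace F]

open NormedSpace

theorem Intertwines.exp {U : E →L[ℂ] F} {a : Adj A E} {b : Adj A F} (h : Intertwines U a b) :
    Intertwines U (NormedSpace.exp a) (NormedSpace.exp b) := by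
  intro x
  have hpow : ∀ n : ℕ, Intertwines U (a ^ n) (b ^ n) := fun n => by
    induction n with
    | zero => intro x; simp
    | succ n ih => intro x; rw [pow_succ, pow_succ, Adj.mul_op, Adj.mul_op, ih, h]
  have h1 := (exp_series_hasSum_exp' (𝕂 := ℂ) a).mapL (Adj.opL A E)
  have h2 := (exp_series_hasSum_exp' (𝕂 := ℂ) b).mapL (Adj.opL A F)
  have h3 := (h1.mapL (ContinuousLinearMap.apply ℂ E x)).mapL U
  have h4 := h2.mapL (ContinuousLinearMap.apply ℂ F (U x))
  refine h3.unique ?_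
  convert! h4 using 2 with n
  simp [hpow n x]

/-- The exponential of a skew-adjoint element is an isometry. Only ≤ 1 is claimed since the algebra
may be zero. -/
theorem norm_le_one_of_star_eq_neg {B : Type*} [CStarAlgebra B] {w : B} (hw : star w = -w) :
    ‖NormedSpace.exp w‖ ≤ 1 := by
  let _ : NormedAlgebra ℚ B := .restrictScalars ℚ ℂ B
  have h : star (NormedSpace.exp w) * NormedSpace.exp w = 1 := by
    rw [star_exp, hw, ← exp_add_of_commute ((Commute.refl w).neg_left), neg_add_cancel, exp_zero]
  have h1 : ‖NormedSpace.exp w‖ * ‖NormedSpace.exp w‖ = ‖(1 : B)‖ := by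
    rw [← CStarRing.norm_star_mul_self, h]
  have h2 : ‖(1 : B)‖ ≤ 1 := by
    have := CStarRing.norm_star_mul_self (x := (1 : B))
    rw [star_one, one_mul] at this
    nlinarith [norm_nonneg (1 : B)]
  nlinarith [norm_nonneg (NormedSpace.exp w)]

theorem hasDerivAt_exp_smul_op (t : Adj A E) (x : E) :
    HasDerivAt (fun c : ℂ => (NormedSpace.exp (c • t)).op x) (t.op x) 0 := by
  have h0 : HasDerivAt (fun c : ℂ => NormedSpace.exp (c • t)) t 0 := by
    simpa using hasDerivAt_exp_smul_const t (0 : ℂ)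
  exact ((ContinuousLinearMap.apply ℂ E x).comp (Adj.opL A E)).hasFDerivAt.comp_hasDerivAt 0 h0

/-- Rosenblum's argument: f(c) = exp(c b⋆) U exp(-c a⋆) is entire and bounded, hence constantly U by
Liouville. Comparing derivatives at 0 in U exp(c a⋆) = exp(c b⋆) U gives the claim. -/
theorem Intertwines.star_right {U : E →L[ℂ] F} {a : Adj A E} {b : Adj A F} (ha : IsStarNormal a)
    (hb : IsStarNormal b) (h : Intertwines U a b) : Intertwines U (star a) (star b) := by
  let _ : NormedAlgebra ℚ (Adj A E) := .restrictScalars ℚ ℂ _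
  let _ : NormedAlgebra ℚ (Adj A F) := .restrictScalars ℚ ℂ _
  set f : ℂ → (E →L[ℂ] F) := fun c =>
    (Adj.opL A F (NormedSpace.exp (c • star b))).comp
      (U.comp (Adj.opL A E (NormedSpace.exp (c • -star a)))) with hf
  have hdiff : Differentiable ℂ f := by
    have h1 : Differentiable ℂ fun c : ℂ => Adj.opL A F (NormedSpace.exp (c • star b)) :=
      (Adj.opL A F).differentiable.comp fun c => (hasDerivAt_exp_smul_const _ c).differentiableAt
    have h2 : Differentiable ℂ fun c : ℂ => Adj.opL A E (NormedSpace.exp (c • -star a)) :=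
      (Adj.opL A E).differentiable.comp fun c => (hasDerivAt_exp_smul_const _ c).differentiableAt
    exact h1.clm_comp ((differentiable_const U).clm_comp h2)
  have hbound : ∀ c, ‖f c‖ ≤ ‖U‖ := fun c => by
    set d := star c with hd
    have hexp := (show Intertwines U (d • a) (d • b) from fun x => by simp [h x]).exp
    have hcb : Commute (c • star b) (-(d • b)) :=
      ((hb.star_comm_self.smul_left c).smul_right d).neg_right
    have hca : Commute (d • a) (c • -star a) :=
      ((ha.star_comm_self.symm.neg_right).smul_left d).smul_right c
    -- Insert U = exp(-d b) U exp(d a) with d = c̄. By normality the exponentials combine, and the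
    -- exponents c b⋆ - c̄ b and c̄ a - c a⋆ are skew-adjoint.
    have e : f c = ((NormedSpace.exp (c • star b + -(d • b))).op).comp
        (U.comp (NormedSpace.exp (d • a + c • -star a)).op) := by
      ext x
      simp only [hf, Adj.opL_apply, ContinuousLinearMap.comp_apply]
      rw [exp_add_of_commute hcb, exp_add_of_commute hca, Adj.mul_op, Adj.mul_op, hexp,
        ← Adj.mul_op (NormedSpace.exp (-(d • b))), ← exp_add_of_commute
        ((Commute.refl (d • b)).neg_left), neg_add_cancel, exp_zero, Adj.one_op]
    have n1 : ‖NormedSpace.exp (c • star b + -(d • b))‖ ≤ 1 :=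
      norm_le_one_of_star_eq_neg (by simp [hd])
    have n2 : ‖NormedSpace.exp (d • a + c • -star a)‖ ≤ 1 :=
      norm_le_one_of_star_eq_neg (by simp [hd])
    rw [Adj.norm_def] at n1 n2
    rw [e]
    calc _ ≤ ‖(NormedSpace.exp (c • star b + -(d • b))).op‖ *
          (‖U‖ * ‖(NormedSpace.exp (d • a + c • -star a)).op‖) :=
        (ContinuousLinearMap.opNorm_comp_le _ _).trans
          (by gcongr; exact ContinuousLinearMap.opNorm_comp_le _ _)
      _ ≤ 1 * (‖U‖ * 1) := by gcongr
      _ = ‖U‖ := by ring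
  have hconst : ∀ c, f c = U := fun c => by
    rw [hdiff.apply_eq_apply_of_bounded (isBounded_iff_forall_norm_le.mpr
      ⟨‖U‖, by rintro _ ⟨c, rfl⟩; exact hbound c⟩) c 0]
    ext x
    simp [hf]
  have hkey : ∀ (c : ℂ) x, U ((NormedSpace.exp (c • star a)).op x) =
      (NormedSpace.exp (c • star b)).op (U x) := fun c x => by
    have := DFunLike.congr_fun (hconst c) ((NormedSpace.exp (c • star a)).op x)
    rw [← this]
    simp only [hf, Adj.opL_apply, ContinuousLinearMap.comp_apply]
    rw [← Adj.mul_op, ← exp_add_of_commute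
      (by rw [smul_neg]; exact (Commute.refl (c • star a)).neg_left), smul_neg,
      neg_add_cancel, exp_zero, Adj.one_op]
  intro x
  have d1 := U.hasFDerivAt.comp_hasDerivAt 0 (hasDerivAt_exp_smul_op (star a) x)
  have d2 := hasDerivAt_exp_smul_op (star b) (U x)
  refine d1.unique ?_
  convert! d2 using 1
  funext c
  exact hkey c x

end BoundedFuglede

/-! ### Adjoints of densely defined operators and the bounded inverse of 1 + T⋆T -/

section ZTransform

variable {A : Type*} [NonUnitalCStarAlgebra A] [PartialOrder A] [StarOrderedRing A]
  {E F : Type*}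
  [NormedAddCommGroup E] [NormedSpace ℂ E] [SMul A E] [CStarModule A E]
  [NormedAddCommGroup F] [NormedSpace ℂ F] [SMul A F] [CStarModule A F]

/-! ### The adjoint of a densely defined operator -/

theorem mem_adjointGraph_iff {T : E →ₗ.[ℂ] F} {v : F} {w : E} :
    (v, w) ∈ adjointGraph A T ↔ ∀ x y, (x, y) ∈ T.graph → inner A y v = inner A x w := by
  constructor
  · intro h x y hxy
    obtain ⟨u, rfl, rfl⟩ := (LinearPMap.mem_graph_iff T).mp hxy
    exact h u
  · exact fun h u => h _ _ (LinearPMap.mem_graph T u)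

theorem adjoint_graph {T : E →ₗ.[ℂ] F} (hd : Dense (T.domain : Set E)) :
    (adjoint A T).graph = adjointGraph A T := by
  refine Submodule.toLinearPMap_graph_eq _ fun p hp h0 => ?_
  refine ext_inner_of_denseRange A (p := fun u : T.domain => (u : E)) hd.denseRange_val
    fun u => ?_
  rw [← hp u, h0]
  simp

theorem isClosed_adjointGraph (T : E →ₗ.[ℂ] F) : IsClosed (adjointGraph A T : Set (F × E)) := by
  have : (adjointGraph A T : Set (F × E)) =
      ⋂ u : T.domain, {p | inner A (T u) p.1 = inner A (u : E) p.2} := by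
    ext p; simp only [Set.mem_iInter]; rfl
  rw [this]
  refine isClosed_iInter fun u => isClosed_eq ?_ ?_
  · exact CStarModule.continuous_inner.comp
      (by fun_prop : Continuous fun p : F × E => (T u, p.1))
  · exact CStarModule.continuous_inner.comp
      (by fun_prop : Continuous fun p : F × E => ((u : E), p.2))

/-! ### The resolvent `(1 + T⋆T)⁻¹` -/

theorem norm_le_of_inner_add_eq {x : E} {y : F} {e x' : E}
    (h : inner A x x + inner A y y = inner A x' e) : ‖x‖ ^ 2 ≤ ‖x'‖ * ‖e‖ ∧
      ‖y‖ ^ 2 ≤ ‖x'‖ * ‖e‖ := by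
  constructor
  · rw [CStarModule.norm_sq_eq A]
    refine (CStarAlgebra.norm_le_norm_of_nonneg_of_le CStarModule.inner_self_nonneg ?_).trans
      (CStarModule.norm_inner_le E)
    rw [← h]
    exact le_add_of_nonneg_right CStarModule.inner_self_nonneg
  · rw [CStarModule.norm_sq_eq A]
    refine (CStarAlgebra.norm_le_norm_of_nonneg_of_le CStarModule.inner_self_nonneg ?_).trans
      (CStarModule.norm_inner_le E)
    rw [← h]
    exact le_add_of_nonneg_left CStarModule.inner_self_nonneg

/-- With y = Tx and w = T⋆y one has ⟨x, x⟩ + ⟨y, y⟩ = ⟨x, (1 + T⋆T)x⟩, and Cauchy–Schwarz applies.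
This a priori estimate gives uniqueness and continuity of the solution of (1 + T⋆T)x = e. -/
theorem norm_le_of_graph {T : E →ₗ.[ℂ] F} {x : E} {y : F} {w : E} (hxy : (x, y) ∈ T.graph)
    (hyw : (y, w) ∈ adjointGraph A T) : ‖x‖ ≤ ‖x + w‖ ∧ ‖y‖ ≤ ‖x + w‖ := by
  have h : inner A x x + inner A y y = inner A x (x + w) := by
    rw [CStarModule.inner_add_right, mem_adjointGraph_iff.mp hyw x y hxy]
  obtain ⟨h1, h2⟩ := norm_le_of_inner_add_eq h
  have h3 : ‖x‖ ≤ ‖x + w‖ := by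
    by_contra hlt
    push Not at hlt
    nlinarith [norm_nonneg (x + w)]
  refine ⟨h3, ?_⟩
  by_contra hlt
  push Not at hlt
  nlinarith [norm_nonneg (x + w), mul_le_mul_of_nonneg_right h3 (norm_nonneg (x + w))]

variable [CompleteSpace E] [CompleteSpace F]

/-- The range of 1 + T⋆T is dense by regularity. By the a priori estimate, solutions for a
convergent sequence of right-hand sides are Cauchy in x and Tx, and the graphs are closed; so 1 +
T⋆T is onto. -/
theorem exists_graph_add_eq {T : E →ₗ.[ℂ] F} (hT : IsRegular A T) (e : E) :
    ∃ p : E × F, p ∈ T.graph ∧ (p.2, e - p.1) ∈ adjointGraph A T := by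
  have hd := hT.dense_range e
  obtain ⟨s, hs, hlim⟩ := mem_closure_iff_seq_limit.mp hd
  have hs' : ∀ n, ∃ p : E × F, p ∈ T.graph ∧ (p.2, s n - p.1) ∈ adjointGraph A T := fun n => by
    obtain ⟨⟨x, hx⟩, hxs⟩ := hs n
    have hx2 := (Submodule.mem_inf.mp hx).2
    have hg := LinearPMap.mem_graph (pcomp (adjoint A T) T) ⟨x, hx2⟩
    obtain ⟨y, hy1, hy2⟩ := (mem_graph_pcomp _ _ _ _).mp hg
    refine ⟨(x, y), hy1, ?_⟩
    rw [adjoint_graph hT.dense_domain] at hy2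
    convert! hy2 using 2
    rw [← hxs, LinearPMap.toFun_eq_coe, LinearPMap.add_apply]
    exact add_sub_cancel_left _ _
  choose p hp1 hp2 using hs'
  have hcs : CauchySeq p := by
    have hc := hlim.cauchySeq
    rw [Metric.cauchySeq_iff] at hc ⊢
    intro ε hε
    obtain ⟨N, hN⟩ := hc ε hε
    refine ⟨N, fun m hm n hn => lt_of_le_of_lt ?_ (hN m hm n hn)⟩
    have h1 : ((p m).1 - (p n).1, (p m).2 - (p n).2) ∈ T.graph := T.graph.sub_mem (hp1 m) (hp1 n)
    have h2 := (adjointGraph A T).sub_mem (hp2 m) (hp2 n)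
    have h3 := norm_le_of_graph h1 h2
    have e : (p m).1 - (p n).1 + (s m - (p m).1 - (s n - (p n).1)) = s m - s n := by abel
    change ‖(p m).1 - (p n).1‖ ≤ ‖(p m).1 - (p n).1 + (s m - (p m).1 - (s n - (p n).1))‖ ∧
      ‖(p m).2 - (p n).2‖ ≤ ‖(p m).1 - (p n).1 + (s m - (p m).1 - (s n - (p n).1))‖ at h3
    rw [e] at h3
    rw [dist_eq_norm, dist_eq_norm]
    exact max_le h3.1 h3.2
  obtain ⟨r, hr⟩ := cauchySeq_tendsto_of_complete hcs
  refine ⟨r, ?_, ?_⟩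
  · have hcl : IsClosed (T.graph : Set (E × F)) := hT.closed
    exact hcl.mem_of_tendsto hr (Filter.Eventually.of_forall hp1)
  · refine (isClosed_adjointGraph T).mem_of_tendsto (b := Filter.atTop)
      (f := fun n => ((p n).2, s n - (p n).1)) ?_ (Filter.Eventually.of_forall hp2)
    exact ((continuous_snd.tendsto r).comp hr).prodMk_nhds
      (hlim.sub ((continuous_fst.tendsto r).comp hr))

/-- The operators `(1 + T⋆T)⁻¹` and `T(1 + T⋆T)⁻¹`. -/
theorem exists_resolvent {T : E →ₗ.[ℂ] F} (hT : IsRegular A T) :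
    ∃ (R : E →L[ℂ] E) (N : E →L[ℂ] F), ∀ e, (R e, N e) ∈ T.graph ∧
      (N e, e - R e) ∈ adjointGraph A T := by
  choose p hp1 hp2 using exists_graph_add_eq hT
  have huniq : ∀ (e : E) (r : E × F), r ∈ T.graph → (r.2, e - r.1) ∈ adjointGraph A T →
      p e = r := fun e r h1 h2 => by
    have h3 := norm_le_of_graph (T.graph.sub_mem (hp1 e) h1)
      ((adjointGraph A T).sub_mem (hp2 e) h2)
    have e' : (p e).1 - r.1 + (e - (p e).1 - (e - r.1)) = 0 := by abel
    change ‖(p e).1 - r.1‖ ≤ ‖(p e).1 - r.1 + (e - (p e).1 - (e - r.1))‖ ∧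
      ‖(p e).2 - r.2‖ ≤ ‖(p e).1 - r.1 + (e - (p e).1 - (e - r.1))‖ at h3
    rw [e', norm_zero, norm_le_zero_iff, norm_le_zero_iff, sub_eq_zero, sub_eq_zero] at h3
    exact Prod.ext h3.1 h3.2
  let L : E →ₗ[ℂ] E × F :=
    { toFun := p
      map_add' := fun e e' => huniq _ _ (T.graph.add_mem (hp1 e) (hp1 e')) (by
        have := (adjointGraph A T).add_mem (hp2 e) (hp2 e')
        convert! this using 2
        simp only [Prod.fst_add, Prod.snd_add]; abel)
      map_smul' := fun c e => huniq _ _ (T.graph.smul_mem c (hp1 e)) (by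
        have := (adjointGraph A T).smul_mem c (hp2 e)
        convert! this using 2
        simp [smul_sub]) }
  let L' : E →L[ℂ] E × F := L.mkContinuous 1 fun e => by
    have h := norm_le_of_graph (hp1 e) (hp2 e)
    rw [add_sub_cancel] at h
    rw [one_mul]
    exact max_le h.1 h.2
  exact ⟨(ContinuousLinearMap.fst ℂ E F).comp L', (ContinuousLinearMap.snd ℂ E F).comp L',
    fun e => ⟨hp1 e, hp2 e⟩⟩

/-- The domain of `T⋆T` is a core for `T`. -/
theorem exists_resolvent_near {T : E →ₗ.[ℂ] F} (hT : IsRegular A T) {R : E →L[ℂ] E}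
    {N : E →L[ℂ] F} (hRN : ∀ e, (R e, N e) ∈ T.graph ∧ (N e, e - R e) ∈ adjointGraph A T)
    {x : E} {y : F} (hxy : (x, y) ∈ T.graph) {ε : ℝ} (hε : 0 < ε) :
    ∃ e, ‖x - R e‖ < ε ∧ ‖y - N e‖ < ε := by
  -- Approximate y = Tx by y' in D(T⋆) and take e = x + T⋆y'. With u = R e and n = T u this yields
  -- ⟨x - u, x - u⟩ + ⟨y - n, y - n⟩ = ⟨y - n, y - y'⟩, so both errors are controlled by ‖y - y'‖.
  obtain ⟨y', hy', hlt⟩ := Metric.mem_closure_iff.mp (hT.dense_adjoint_domain y) ε hε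
  obtain ⟨w, hw⟩ := LinearPMap.mem_domain_iff.mp hy'
  rw [adjoint_graph hT.dense_domain] at hw
  obtain ⟨h1, h2⟩ := hRN (x + w)
  set u := R (x + w)
  set n := N (x + w)
  have hg : (x - u, y - n) ∈ T.graph := T.graph.sub_mem hxy h1
  have hb : (y' - n, u - x) ∈ adjointGraph A T := by
    have := (adjointGraph A T).sub_mem hw h2
    convert! this using 2
    change u - x = w - (x + w - u)
    abel
  have h3 : inner A (x - u) (x - u) + inner A (y - n) (y - n) = inner A (y - n) (y - y') := by
    have h4 := mem_adjointGraph_iff.mp hb _ _ hg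
    have e1 : inner A (y - n) (y - y') = inner A (y - n) (y - n) - inner A (y - n) (y' - n) := by
      rw [← CStarModule.inner_sub_right]; congr 1; abel
    have e2 : inner A (x - u) (u - x) = -inner A (x - u) (x - u) := by
      rw [← CStarModule.inner_neg_right]; congr 1; abel
    rw [e1, h4, e2]; abel
  rw [add_comm] at h3
  obtain ⟨h4, h5⟩ := norm_le_of_inner_add_eq h3
  rw [dist_eq_norm] at hlt
  have h6 : ‖y - n‖ < ε := by
    by_contra hle
    push Not at hle
    nlinarith
  refine ⟨x + w, ?_, h6⟩
  by_contra hle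
  push Not at hle
  nlinarith [norm_nonneg (y - n), norm_nonneg (y - y')]

end ZTransform

/-! ### Construction of the z-transform of a regular operator -/

section ZTransform

variable {A : Type*} [NonUnitalCStarAlgebra A] [PartialOrder A] [StarOrderedRing A]
  {E F : Type*}
  [NormedAddCommGroup E] [NormedSpace ℂ E] [SMul A E] [CStarModule A E] [CompleteSpace E]
  [NormedAddCommGroup F] [NormedSpace ℂ F] [SMul A F] [CStarModule A F] [CompleteSpace F]

/-- An operator that is positive with respect to the inner product has nonnegative spectrum. -/
theorem IsPositive.re_nonneg_of_mem_spectrum {a : Adj A E} (ha : IsPositive A a.op) {x : ℂ}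
    (hx : x ∈ spectrum ℂ a) : 0 ≤ x.re := by
  have hsa : IsSelfAdjoint a := ha.star_eq
  have hn : IsStarNormal a := hsa.isStarNormal
  -- m is the negative part and n = m(a), s = m^{3/2}(a). Since n a n = -m³(a) = -s⋆s, positivity of
  -- a on the vectors n v forces s = 0, so m vanishes on the spectrum.
  set m : ℂ → ℝ := fun x => max (-x.re) 0 with hm
  have hmc : Continuous m := by fun_prop
  set n : Adj A E := cfc (fun x => (m x : ℂ)) a
  set s : Adj A E := cfc (fun x => ((√(m x ^ 3) : ℝ) : ℂ)) a with hs
  have hss : star s * s = cfc (fun x => ((m x ^ 3 : ℝ) : ℂ)) a := by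
    rw [hs, star_cfc_ofReal, ← cfc_mul _ _ a (by fun_prop) (by fun_prop)]
    refine cfc_congr fun x _ => ?_
    simp only [← Complex.ofReal_mul]
    rw [Real.mul_self_sqrt (pow_nonneg (le_max_right _ _) 3)]
  have hnan : n * a * n = -(star s * s) := by
    have : n * a * n = cfc (fun x => (m x : ℂ) * x * m x) a := by
      rw [cfc_mul (fun x => (m x : ℂ) * x) (fun x => (m x : ℂ)) a (by fun_prop) (by fun_prop),
        cfc_mul (fun x => (m x : ℂ)) (fun x => x) a (by fun_prop) (by fun_prop), cfc_id' ℂ a]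
    rw [this, hss, ← cfc_neg]
    refine cfc_congr fun x hx => ?_
    have hre := hsa.mem_spectrum_eq_re hx
    rw [hre]
    simp only [hm, Complex.ofReal_re, ← Complex.ofReal_mul, ← Complex.ofReal_neg]
    congr 1
    rcases le_total x.re 0 with h | h
    · rw [max_eq_left (by linarith)]; ring
    · rw [max_eq_right (by linarith)]; ring
  have hs0 : s = 0 := Adj.ext fun v => by
    have h1 := ha.2 (n.op v)
    have hns : star n = n := star_cfc_ofReal a m
    rw [Adj.inner_left_eq, hns, ← Adj.mul_op, ← Adj.mul_op, hnan] at h1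
    have h2 := inner_star_mul_self_nonneg s v
    have h3 : inner A v ((-(star s * s)).op v) = -inner A v ((star s * s).op v) := by
      rw [← CStarModule.inner_neg_right]; rfl
    rw [h3] at h1
    have h4 : inner A v ((star s * s).op v) = 0 := le_antisymm (neg_nonneg.mp h1) h2
    rw [Adj.zero_op, ← CStarModule.inner_self (A := A), Adj.inner_left_eq, ← Adj.mul_op, h4]
  have h0 : Set.EqOn (fun x => ((√(m x ^ 3) : ℝ) : ℂ)) (fun _ => 0) (spectrum ℂ a) :=
    eqOn_of_cfc_eq_cfc (by rw [← hs, hs0, cfc_const_zero]) (by fun_prop) (by fun_prop)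
  have h1 : √(m x ^ 3) = 0 := Complex.ofReal_eq_zero.mp (h0 hx)
  have h2 : m x = 0 := by
    have h3 : m x ^ 3 = 0 := by
      rwa [Real.sqrt_eq_zero (pow_nonneg (le_max_right _ _) 3)] at h1
    exact pow_eq_zero_iff (by norm_num) |>.mp h3
  have h3 : -x.re ≤ m x := le_max_left _ _
  linarith

theorem exists_positive_sqrt {a : Adj A E} (ha : IsPositive A a.op) :
    ∃ q : Adj A E, IsPositive A q.op ∧ q * q = a := by
  have hsa : IsSelfAdjoint a := ha.star_eq
  have hn : IsStarNormal a := hsa.isStarNormal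
  refine ⟨posSqrt a, isPositive_cfc_ofReal (by fun_prop) fun x _ => Real.sqrt_nonneg _, ?_⟩
  rw [posSqrt, ← cfc_mul _ _ a (by fun_prop) (by fun_prop)]
  conv_rhs => rw [← cfc_id' ℂ a]
  refine cfc_congr fun x hx => ?_
  simp only [← Complex.ofReal_mul]
  rw [Real.mul_self_sqrt (ha.re_nonneg_of_mem_spectrum hx)]
  exact (hsa.mem_spectrum_eq_re hx).symm

/-- `z` and `q = (1 - z⋆z)^{1/2}` describe the operator `T` with graph `{(q v, z v) | v ∈ E}`. -/
structure IsZPair (T : E →ₗ.[ℂ] E) (z q : Adj A E) : Prop where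
  norm_le : ‖z‖ ≤ 1
  pos : IsPositive A q.op
  sq : q * q = 1 - star z * z
  graph : ∀ x y, (x, y) ∈ T.graph ↔ ∃ v, q.op v = x ∧ z.op v = y

theorem norm_le_of_inner_range_le {p : E → E} (hp : DenseRange p) {w : E} {C : ℝ}
    (hC : 0 ≤ C) (h : ∀ e, ‖inner A (p e) w‖ ≤ ‖p e‖ * C) : ‖w‖ ≤ C := by
  have h1 : ∀ x : E, ‖inner A x w‖ ≤ ‖x‖ * C := fun x => by
    have hc : Continuous fun x : E => inner A x w :=
      CStarModule.continuous_inner.comp (by fun_prop : Continuous fun x : E => (x, w))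
    exact hp.induction_on (p := fun x => ‖inner A x w‖ ≤ ‖x‖ * C) x
      (isClosed_le hc.norm (by fun_prop)) h
  have h2 := h1 w
  rw [← CStarModule.norm_sq_eq A, sq] at h2
  rcases eq_or_ne w 0 with h0 | h0
  · rwa [h0, norm_zero]
  · exact le_of_mul_le_mul_left h2 (norm_pos_iff.mpr h0)

/-- With R = (1 + T⋆T)⁻¹ take q = R^{1/2} and let z extend q e ↦ T R e. It is contractive because
⟨TRe, TRe⟩ = ⟨q e, q e⟩ - ⟨Re, Re⟩, and its adjoint extends v ↦ q T⋆v from the dense domain of T⋆.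
-/
theorem IsRegular.exists_isZPair {T : E →ₗ.[ℂ] E} (hT : IsRegular A T) :
    ∃ z q : Adj A E, IsZPair T z q ∧ DenseRange q.op := by
  obtain ⟨R', N, hRN⟩ := exists_resolvent hT
  have hg := fun e => (hRN e).1
  have ha := fun e => (hRN e).2
  have hN : ∀ e e', inner A (N e) (N e') = inner A (R' e) (e' - R' e') := fun e e' =>
    mem_adjointGraph_iff.mp (ha e') _ _ (hg e)
  have hR : ∀ e e', inner A (R' e) e' = inner A (R' e) (R' e') + inner A (N e) (N e') :=
    fun e e' => by rw [hN, ← CStarModule.inner_add_right, add_sub_cancel]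
  have hRadj : IsAdjointPair A R' R' := fun e e' => by
    rw [hR e, ← CStarModule.star_inner (R' e') e, hR e', star_add, CStarModule.star_inner,
      CStarModule.star_inner]
  set R : Adj A E := Adj.mk hRadj with hRdef
  have hRop : ∀ e, R.op e = R' e := fun e => rfl
  have hRpos : IsPositive A R.op := ⟨hRadj, fun v => by
    rw [hRop, ← hRadj, hR]
    exact add_nonneg CStarModule.inner_self_nonneg CStarModule.inner_self_nonneg⟩
  obtain ⟨q, hq, hqq⟩ := exists_positive_sqrt hRpos
  have hqs := hq.star_eq
  have hRd : DenseRange R.op := by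
    refine Dense.of_closure (hT.dense_domain.mono fun x hx => ?_)
    obtain ⟨y, hy⟩ := LinearPMap.mem_domain_iff.mp hx
    refine Metric.mem_closure_iff.mpr fun ε hε => ?_
    obtain ⟨e, he, -⟩ := exists_resolvent_near hT hRN hy hε
    exact ⟨_, ⟨e, rfl⟩, by rwa [dist_eq_norm]⟩
  have hqd : DenseRange q.op := hRd.mono (by
    rintro _ ⟨e, rfl⟩
    exact ⟨q.op e, by rw [← Adj.mul_op, hqq]⟩)
  have hqR : ∀ e, q.op (q.op e) = R' e := fun e => Adj.congr_op hqq e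
  have hqinner : ∀ e e', inner A (q.op e) e' = inner A e (q.op e') := fun e e' => by
    rw [Adj.inner_left_eq, hqs]
  have hNq : ∀ e, ‖N e‖ ≤ ‖q.op e‖ := fun e => by
    refine norm_le_of_inner_le (A := A) ?_
    rw [hqinner, hqR, ← hRadj, hR]
    exact le_add_of_nonneg_left CStarModule.inner_self_nonneg
  have hNadj : ∀ e (v : (adjoint A T).domain),
      inner A (N e) (v : E) = inner A (q.op e) (q.op (adjoint A T v)) := fun e v => by
    have := LinearPMap.mem_graph (adjoint A T) v
    rw [adjoint_graph hT.dense_domain] at this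
    rw [mem_adjointGraph_iff.mp this _ _ (hg e), ← hqinner, hqR]
  obtain ⟨z, hz1, hz2, hz3⟩ := exists_adjointable_extension (A := A)
    (p := (q.op : E →ₗ[ℂ] E)) (m := (N : E →ₗ[ℂ] E)) (p' := (adjoint A T).domain.subtype)
    (m' := (q.op : E →ₗ[ℂ] E).comp (adjoint A T).toFun) hqd
    (hT.dense_adjoint_domain.denseRange_val) hNq
    (fun v => norm_le_of_inner_range_le (A := A) hqd (norm_nonneg _) fun e => by
      have := hNadj e v
      refine (this ▸ CStarModule.norm_inner_le E :
        ‖inner A (q.op e) (q.op (adjoint A T v))‖ ≤ ‖N e‖ * ‖(v : E)‖).trans ?_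
      exact mul_le_mul_of_nonneg_right (hNq e) (norm_nonneg _)) hNadj
  have hz2' : ∀ e, z.op (q.op e) = N e := hz2
  have hzz : q * q = 1 - star z * z := by
    refine eq_of_mul_eq_of_denseRange hqd (Adj.ext fun e => ?_)
    refine ext_inner_of_denseRange A hqd fun e' => ?_
    simp only [Adj.sub_op, Adj.mul_op, Adj.one_op, CStarModule.inner_sub_right]
    have l1 : inner A (q.op e') (q.op (q.op (q.op e))) = inner A (R' e') (R' e) := by
      rw [← hqinner, hqR, hqR]
    have l2 : inner A (q.op e') (q.op e) = inner A (R' e') e := by rw [← hqinner, hqR]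
    rw [← Adj.inner_left_eq, hz2', hz2', hN, l1, l2, CStarModule.inner_sub_right, sub_sub_cancel]
  refine ⟨z, q, ⟨hz1, hq, hzz, fun x y => ⟨fun hxy => ?_, ?_⟩⟩, hqd⟩
  · have hq1 : ∀ v, q.op (q.op v) + (star z).op (z.op v) = v := fun v => by
      have := Adj.congr_op hzz v
      simp only [Adj.mul_op, Adj.sub_op, Adj.one_op] at this
      rw [this]; abel
    have key : ∀ v, q.op v = q.op (q.op (q.op v) + (star z).op (z.op v)) ∧
        z.op v = z.op (q.op (q.op v) + (star z).op (z.op v)) := fun v => by rw [hq1]; simp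
    -- Since q² + z⋆z = 1, the map (x, y) ↦ q x + z⋆y is a left inverse of v ↦ (q v, z v). That this
    -- vector represents (x, y) is a closed condition, true on the core {(R e, N e)}.
    refine ⟨q.op x + (star z).op y, ?_⟩
    have hcl : IsClosed {p : E × E | q.op (q.op p.1 + (star z).op p.2) = p.1 ∧
        z.op (q.op p.1 + (star z).op p.2) = p.2} :=
      (isClosed_eq (by fun_prop) (by fun_prop)).inter (isClosed_eq (by fun_prop) (by fun_prop))
    have hmem : (x, y) ∈ closure {p : E × E | q.op (q.op p.1 + (star z).op p.2) = p.1 ∧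
        z.op (q.op p.1 + (star z).op p.2) = p.2} := by
      refine Metric.mem_closure_iff.mpr fun ε hε => ?_
      obtain ⟨e, he1, he2⟩ := exists_resolvent_near hT hRN hxy hε
      refine ⟨(R' e, N e), ?_, ?_⟩
      · rw [← hqR, ← hz2']
        exact ⟨(key _).1.symm, (key _).2.symm⟩
      · rw [dist_eq_norm]
        exact max_lt he1 he2
    rw [hcl.closure_eq] at hmem
    exact hmem
  · rintro ⟨v, rfl, rfl⟩
    have hcl : IsClosed {v | (q.op v, z.op v) ∈ T.graph} := by
      have hcl : IsClosed (T.graph : Set (E × E)) := hT.closed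
      exact hcl.preimage (by fun_prop : Continuous fun v => (q.op v, z.op v))
    refine hqd.induction_on (p := fun v => (q.op v, z.op v) ∈ T.graph) v hcl fun e => ?_
    rw [hqR, hz2']
    exact hg e

end ZTransform

/-! ### Uniqueness of the z-transform, and z-transforms of normal operators -/

section ZPair

variable {A : Type*} [NonUnitalCStarAlgebra A] [PartialOrder A] [StarOrderedRing A]
  {E F : Type*}
  [NormedAddCommGroup E] [NormedSpace ℂ E] [SMul A E] [CStarModule A E] [CompleteSpace E]
  [NormedAddCommGroup F] [NormedSpace ℂ F] [SMul A F] [CStarModule A F] [CompleteSpace F]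

/-- Polarisation with x + y and x + i y; additivity and compatibility with i suffice. -/
theorem inner_eq_of_inner_self_eq {W : E → E} (hadd : ∀ x y, W (x + y) = W x + W y)
    (hsmul : ∀ x, W (Complex.I • x) = Complex.I • W x)
    (h : ∀ x, inner A (W x) (W x) = inner A x x) (x y : E) :
    inner A (W x) (W y) = inner A x y := by
  have h1 := h (x + y)
  have h2 := h (x + Complex.I • y)
  rw [hadd] at h1 h2
  rw [hsmul] at h2
  simp only [CStarModule.inner_add_left, CStarModule.inner_add_right,
    CStarModule.inner_smul_left_complex, CStarModule.inner_smul_right_complex, h] at h1 h2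
  simp only [smul_add, smul_smul, Complex.star_def, Complex.conj_I, mul_neg, Complex.I_mul_I,
    neg_neg, one_smul] at h2
  have h3 : inner A (W y) (W x) + inner A (W x) (W y) = inner A y x + inner A x y := by
    have : inner A x x + (inner A (W y) (W x) + inner A (W x) (W y)) + inner A y y =
        inner A x x + (inner A y x + inner A x y) + inner A y y := by
      convert! h1 using 1 <;> abel
    simpa using this
  have h4 : -inner A (W y) (W x) + inner A (W x) (W y) = -inner A y x + inner A x y := by
    have : Complex.I • (-inner A (W y) (W x) + inner A (W x) (W y)) =
        Complex.I • (-inner A y x + inner A x y) := by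
      rw [smul_add, smul_add, smul_neg, smul_neg, ← neg_smul, ← neg_smul]
      have : inner A x x + (-Complex.I • inner A (W y) (W x) + Complex.I • inner A (W x) (W y)) +
          inner A y y = inner A x x + (-Complex.I • inner A y x + Complex.I • inner A x y) +
          inner A y y := by
        convert! h2 using 1 <;> abel
      simpa using this
    exact smul_right_injective A Complex.I_ne_zero this
  have h5 : (2 : ℂ) • inner A (W x) (W y) = (2 : ℂ) • inner A x y := by
    rw [two_smul, two_smul]
    calc _ = (inner A (W y) (W x) + inner A (W x) (W y)) +
          (-inner A (W y) (W x) + inner A (W x) (W y)) := by abel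
      _ = _ := by rw [h3, h4]; abel
  exact smul_right_injective A (two_ne_zero (α := ℂ)) h5

/-- The relation p = qW defines an inner-product preserving W, which is onto as q is injective and
the ranges agree. For w = Wa, ⟨w, W p y⟩ = ⟨a, p y⟩ = ⟨q W a, y⟩ = ⟨w, q y⟩, so Wp = q and p² = qWp
= q². -/
theorem mul_self_eq_of_range {p q : Adj A E} (hp : star p = p) (hq : star q = q)
    (hinj : ∀ v, q.op v = 0 → v = 0)
    (h1 : ∀ a, ∃ b, p.op a = q.op b ∧ inner A b b = inner A a a)
    (h2 : ∀ b, ∃ a, p.op a = q.op b) : p * p = q * q := by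
  choose W hW1 hW2 using h1
  have hinj' : ∀ {x y}, q.op x = q.op y → x = y := fun {x y} h =>
    sub_eq_zero.mp (hinj _ (by rw [map_sub, h, sub_self]))
  have hW : ∀ x y, inner A (W x) (W y) = inner A x y := by
    refine inner_eq_of_inner_self_eq (fun x y => hinj' ?_) (fun x => hinj' ?_) hW2
    · rw [← hW1, map_add, map_add, hW1, hW1]
    · rw [← hW1, map_smul, map_smul, hW1]
  have key : ∀ y, W (p.op y) = q.op y := fun y => ext_inner A fun w => by
    obtain ⟨a, ha⟩ := h2 w
    obtain rfl : W a = w := hinj' (by rw [← hW1, ha])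
    rw [hW, Adj.inner_right_eq, Adj.inner_right_eq, hp, hq, hW1]
  exact Adj.ext fun y => by rw [Adj.mul_op, Adj.mul_op, hW1, key]

theorem op_comm {a b : Adj A E} (h : Commute a b) (v : E) :
    a.op (b.op v) = b.op (a.op v) := Adj.congr_op h.eq v

namespace IsZPair

variable {T : E →ₗ.[ℂ] E} {z q : Adj A E}

theorem add_eq (h : IsZPair T z q) (v : E) : q.op (q.op v) + (star z).op (z.op v) = v := by
  have := Adj.congr_op h.sq v
  simp only [Adj.mul_op, Adj.sub_op, Adj.one_op] at this
  rw [this]; abel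

theorem inner_self_eq (h : IsZPair T z q) (v : E) :
    inner A v v = inner A (q.op v) (q.op v) + inner A (z.op v) (z.op v) := by
  rw [Adj.inner_left_eq, Adj.inner_left_eq, ← CStarModule.inner_add_right, h.pos.star_eq, h.add_eq]

theorem injective (h : IsZPair T z q) {v : E} (hv : q.op v = 0) : v = 0 := by
  have h1 : (0, z.op v) ∈ T.graph := (h.graph _ _).mpr ⟨v, hv, rfl⟩
  have h2 : z.op v = 0 := LinearPMap.graph_fst_eq_zero_snd T h1 rfl
  rw [← h.add_eq v, hv, h2]
  simp

theorem injective' (h : IsZPair T z q) {x y : E} (hv : q.op x = q.op y) : x = y :=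
  sub_eq_zero.mp (h.injective (by rw [map_sub, hv, sub_self]))

theorem mem_domain_iff (h : IsZPair T z q) {x : E} : x ∈ T.domain ↔ ∃ v, q.op v = x := by
  rw [LinearPMap.mem_domain_iff]
  simp only [h.graph]
  exact ⟨fun ⟨_, v, hv, _⟩ => ⟨v, hv⟩, fun ⟨v, hv⟩ => ⟨_, v, hv, rfl⟩⟩

theorem domain_eq (h : IsZPair T z q) : (T.domain : Set E) = Set.range q.op := by
  ext x; exact h.mem_domain_iff

theorem mem_adjointGraph_iff (h : IsZPair T z q) {v w : E} :
    (v, w) ∈ adjointGraph A T ↔ (star z).op v = q.op w := by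
  rw [HilbertModule.mem_adjointGraph_iff]
  constructor
  · intro hvw
    refine ext_inner A fun u => ?_
    rw [← Adj.inner_left_eq, Adj.inner_right_eq, h.pos.star_eq]
    exact hvw _ _ ((h.graph _ _).mpr ⟨u, rfl, rfl⟩)
  · intro hvw x y hxy
    obtain ⟨u, rfl, rfl⟩ := (h.graph _ _).mp hxy
    rw [Adj.inner_left_eq, hvw, Adj.inner_left_eq, h.pos.star_eq]

/-- Both pairs parametrise the same graph, isometrically because ⟨v, v⟩ = ⟨q v, q v⟩ + ⟨z v, z v⟩.
The change of parameter is therefore isometric, which forces q'² = q² and q' = q. -/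
theorem unique {z' q' : Adj A E} (h : IsZPair T z q) (h' : IsZPair T z' q') : z' = z := by
  have hr : ∀ a, ∃ b, q'.op a = q.op b ∧ z'.op a = z.op b := fun a => by
    obtain ⟨b, hb1, hb2⟩ := (h.graph _ _).mp ((h'.graph _ _).mpr ⟨a, rfl, rfl⟩)
    exact ⟨b, hb1.symm, hb2.symm⟩
  have hqq : q' * q' = q * q := by
    refine mul_self_eq_of_range h'.pos.star_eq h.pos.star_eq (fun v => h.injective)
      (fun a => ?_) (fun b => ?_)
    · obtain ⟨b, hb1, hb2⟩ := hr a
      exact ⟨b, hb1, by rw [h.inner_self_eq b, h'.inner_self_eq a, hb1, hb2]⟩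
    · obtain ⟨a, ha1, -⟩ := (h'.graph _ _).mp ((h.graph _ _).mpr ⟨b, rfl, rfl⟩)
      exact ⟨a, ha1⟩
  have hq := eq_of_mul_self_eq h'.pos h.pos hqq
  refine Adj.ext fun a => ?_
  obtain ⟨b, hb1, hb2⟩ := hr a
  rw [hq] at hb1
  rw [hb2, h.injective' hb1]

theorem of_isZTransform {t : E →L[ℂ] E} (h : IsZTransform A T t) :
    ∃ z q : Adj A E, z.op = t ∧ IsZPair T z q := by
  obtain ⟨h1, s, r, hs, hr, hsq, hg⟩ := h
  refine ⟨Adj.mk hs, Adj.mk hr.1, rfl, h1, hr, Adj.ext fun v => ?_, fun x y => ?_⟩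
  · have := DFunLike.congr_fun hsq v
    rw [Adj.sub_op, Adj.mul_op, Adj.mul_op, Adj.one_op, Adj.op_star_eq (t := Adj.mk hs) hs]
    exact this
  · rw [hg, LinearMap.mem_range]
    exact exists_congr fun v => Prod.mk.injEq .. ▸ Iff.rfl

theorem isZTransform (h : IsZPair T z q) : IsZTransform A T z.op := by
  refine ⟨h.norm_le, (star z).op, q.op, Adj.isAdjointPair_star z, h.pos, ?_, ?_⟩
  · exact ContinuousLinearMap.ext fun v => Adj.congr_op h.sq v
  · ext ⟨x, y⟩
    rw [h.graph, LinearMap.mem_range]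
    exact exists_congr fun v => Prod.mk.injEq .. ▸ Iff.rfl

theorem commute (h : IsZPair T z q) (hz : IsStarNormal z) : Commute z q := by
  have h1 : Intertwines z.op (q * q) (q * q) := fun v => by
    have : z * (q * q) = (q * q) * z := by
      rw [h.sq, mul_sub, sub_mul, mul_one, one_mul, ← mul_assoc, hz.star_comm_self.symm.eq]
    exact Adj.congr_op this v
  exact Adj.ext fun v => Intertwines.of_mul_self h.pos h.pos h1 v

theorem commute_star (h : IsZPair T z q) (hz : IsStarNormal z) : Commute (star z) q := by
  have := (h.commute hz).star_star
  rwa [h.pos.star_eq] at this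

theorem add_eq' (h : IsZPair T z q) (hz : IsStarNormal z) (v : E) :
    q.op (q.op v) + z.op ((star z).op v) = v := by
  rw [← Adj.mul_op z, ← hz.star_comm_self.eq]
  exact h.add_eq v

/-- For normal z all of z, z⋆, q commute, so q x + z⋆y is a parameter for any solution of z x = q y.
Describing the graph by an equation turns inclusions such as US ⊆ TU into identities of bounded
operators. -/
theorem mem_graph_iff (h : IsZPair T z q) (hz : IsStarNormal z) {x y : E} :
    (x, y) ∈ T.graph ↔ z.op x = q.op y := by
  rw [h.graph]
  constructor
  · rintro ⟨v, rfl, rfl⟩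
    exact op_comm (h.commute hz) v
  · intro hxy
    refine ⟨q.op x + (star z).op y, ?_, ?_⟩
    · rw [map_add, ← op_comm (h.commute_star hz), ← hxy, h.add_eq]
    · rw [map_add, op_comm (h.commute hz), hxy, h.add_eq' hz]

theorem mem_adjointGraph_iff' (h : IsZPair T z q) (hz : IsStarNormal z) {x y : E} :
    (x, y) ∈ adjointGraph A T ↔ ∃ v, q.op v = x ∧ (star z).op v = y := by
  rw [h.mem_adjointGraph_iff]
  constructor
  · intro hxy
    refine ⟨q.op x + z.op y, ?_, ?_⟩
    · rw [map_add, ← op_comm (h.commute hz), ← hxy, h.add_eq' hz]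
    · rw [map_add, op_comm (h.commute_star hz), hxy, h.add_eq]
  · rintro ⟨v, rfl, rfl⟩
    exact op_comm (h.commute_star hz) v

end IsZPair

theorem norm_one_le_one {B : Type*} [CStarAlgebra B] : ‖(1 : B)‖ ≤ 1 := by
  have := CStarRing.norm_star_mul_self (x := (1 : B))
  rw [star_one, one_mul] at this
  nlinarith [norm_nonneg (1 : B)]

theorem norm_le_one_of_mem_spectrum {B : Type*} [CStarAlgebra B] {a : B} (ha : ‖a‖ ≤ 1) {x : ℂ}
    (hx : x ∈ spectrum ℂ a) : ‖x‖ ≤ 1 := by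
  have h1 := spectrum.norm_le_norm_mul_of_mem hx
  have h2 := norm_one_le_one (B := B)
  nlinarith [norm_nonneg a, norm_nonneg (1 : B)]

theorem cfc_sqrt_one_sub {a : Adj A E} (ha : IsSelfAdjoint a) (h1 : ‖a‖ ≤ 1) :
    IsPositive A (cfc (fun x => ((√(1 - x.re) : ℝ) : ℂ)) a).op ∧
    cfc (fun x => ((√(1 - x.re) : ℝ) : ℂ)) a * cfc (fun x => ((√(1 - x.re) : ℝ) : ℂ)) a =
      1 - a := by
  have hn : IsStarNormal a := ha.isStarNormal
  refine ⟨isPositive_cfc_ofReal (by fun_prop) fun x _ => Real.sqrt_nonneg _, ?_⟩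
  have : (1 : Adj A E) - a = cfc (fun x : ℂ => 1 - x) a := by
    rw [cfc_sub (fun _ : ℂ => 1) (fun x => x) a, cfc_id' ℂ a, cfc_const_one ℂ a]
  rw [this, ← cfc_mul _ _ a (by fun_prop) (by fun_prop)]
  refine cfc_congr fun x hx => ?_
  have h2 : x.re ≤ 1 := (Complex.re_le_norm x).trans (norm_le_one_of_mem_spectrum h1 hx)
  simp only [← Complex.ofReal_mul]
  rw [Real.mul_self_sqrt (by linarith)]
  conv_rhs => rw [ha.mem_spectrum_eq_re hx]
  push_cast; ring

/-- Let p = (1 - z z⋆)^{1/2}. From z⋆p = q z⋆ the pairs (p a, z⋆a) lie in the graph of T⋆. Equality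
of the domains and of the inner squares of Tv and T⋆v makes p and q have the same range with
isometric change of parameter, so p² = q², that is, z z⋆ = z⋆z. -/
theorem IsZPair.isStarNormal {T : E →ₗ.[ℂ] E} {z q : Adj A E} (h : IsZPair T z q)
    (hT : IsNormal A T) : IsStarNormal z := by
  have hs1 : ‖star z * z‖ ≤ 1 := by
    rw [CStarRing.norm_star_mul_self]; nlinarith [norm_nonneg z, h.norm_le]
  have hs2 : ‖z * star z‖ ≤ 1 := by
    rw [CStarRing.norm_self_mul_star]; nlinarith [norm_nonneg z, h.norm_le]
  obtain ⟨hp1, hp2⟩ := cfc_sqrt_one_sub (IsSelfAdjoint.mul_star_self z) hs2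
  obtain ⟨hq1, hq2⟩ := cfc_sqrt_one_sub (IsSelfAdjoint.star_mul_self z) hs1
  set p := cfc (fun x : ℂ => ((√(1 - x.re) : ℝ) : ℂ)) (z * star z) with hp
  have hq : cfc (fun x : ℂ => ((√(1 - x.re) : ℝ) : ℂ)) (star z * z) = q :=
    eq_of_mul_self_eq hq1 h.pos (by rw [hq2, h.sq])
  have hstar : Intertwines (star z).op p q := by
    rw [← hq, hp]
    have h0 : Intertwines (star z).op (z * star z) (star z * z) := fun v => rfl
    refine Intertwines.cfc (IsSelfAdjoint.mul_star_self z).isStarNormal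
      (IsSelfAdjoint.star_mul_self z).isStarNormal h0 ?_ (by fun_prop)
    rwa [(IsSelfAdjoint.mul_star_self z).star_eq, (IsSelfAdjoint.star_mul_self z).star_eq]
  have hzp : star z * p = q * star z := Adj.ext hstar
  have hpz : p * z = z * q := by
    have := congrArg star hzp
    simpa [hp1.star_eq, h.pos.star_eq] using this
  have hpv : ∀ v, p.op (p.op v) + z.op ((star z).op v) = v := fun v => by
    have := Adj.congr_op hp2 v
    simp only [Adj.mul_op, Adj.sub_op, Adj.one_op] at this
    rw [this]; abel
  have hdom : ∀ x, x ∈ T.domain ↔ ∃ w, (x, w) ∈ adjointGraph A T := fun x => by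
    rw [hT.domain_eq, LinearPMap.mem_domain_iff, adjoint_graph hT.regular.dense_domain]
  have hinner : ∀ x y w, (x, y) ∈ T.graph → (x, w) ∈ adjointGraph A T →
      inner A y y = inner A w w := fun x y w hy hw => by
    rw [← adjoint_graph hT.regular.dense_domain] at hw
    obtain ⟨u, hu1, hu2⟩ := (LinearPMap.mem_graph_iff _).mp hy
    obtain ⟨u', hu1', hu2'⟩ := (LinearPMap.mem_graph_iff _).mp hw
    have := hT.inner_eq u u' (hu1.trans hu1'.symm)
    rwa [hu2, hu2'] at this
  have hpp : p * p = q * q := by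
    refine mul_self_eq_of_range hp1.star_eq h.pos.star_eq (fun v => h.injective)
      (fun a => ?_) (fun b => ?_)
    · have hm : (p.op a, (star z).op a) ∈ adjointGraph A T :=
        h.mem_adjointGraph_iff.mpr (hstar a)
      obtain ⟨b, hb⟩ := h.mem_domain_iff.mp ((hdom _).mpr ⟨_, hm⟩)
      refine ⟨b, hb.symm, ?_⟩
      have h1 := hinner _ _ _ ((h.graph (p.op a) (z.op b)).mpr ⟨b, hb, rfl⟩) hm
      rw [h.inner_self_eq, h1, hb, Adj.inner_left_eq, Adj.inner_left_eq,
        ← CStarModule.inner_add_right, hp1.star_eq, star_star, hpv]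
    · obtain ⟨w, hw⟩ := (hdom (q.op b)).mp (h.mem_domain_iff.mpr ⟨b, rfl⟩)
      -- Here p z w = z q w = z z⋆ q b, and p² + z z⋆ = 1, so p sends this vector to q b.
      refine ⟨p.op (q.op b) + z.op w, ?_⟩
      have h1 := Adj.congr_op hpz w
      rw [h.mem_adjointGraph_iff] at hw
      rw [Adj.mul_op, Adj.mul_op, ← hw] at h1
      rw [map_add, h1, hpv]
  rw [hp2, h.sq, sub_right_inj] at hpp
  exact ⟨hpp.symm⟩

theorem IsNormal.exists_isZPair {T : E →ₗ.[ℂ] E} (hT : IsNormal A T) :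
    ∃ z q : Adj A E, IsZPair T z q ∧ IsStarNormal z ∧ DenseRange q.op := by
  obtain ⟨z, q, h, hd⟩ := hT.regular.exists_isZPair
  exact ⟨z, q, h, h.isStarNormal hT, hd⟩

theorem IsZPair.isRegular {T : E →ₗ.[ℂ] E} {z q : Adj A E} (h : IsZPair T z q)
    (hz : IsStarNormal z) (hd : DenseRange q.op) : IsRegular A T := by
  have hdom : Dense (T.domain : Set E) := by rw [h.domain_eq]; exact hd
  refine ⟨hdom, fun a x => ?_, ?_, ?_, ?_⟩
  · obtain ⟨v, hv1, hv2⟩ := (h.graph _ _).mp (LinearPMap.mem_graph T x)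
    have hm : (a • (x : E), a • T x) ∈ T.graph := by
      rw [h.graph]
      refine ⟨a • v, ?_, ?_⟩
      · rw [(Adj.isAdjointPair_star q).map_smul, hv1]
      · rw [(Adj.isAdjointPair_star z).map_smul, hv2]
    obtain ⟨u, hu1, hu2⟩ := (LinearPMap.mem_graph_iff T).mp hm
    have hu1' : (u : E) = a • (x : E) := hu1
    have hu : a • (x : E) ∈ T.domain := hu1' ▸ u.2
    refine ⟨hu, Eq.trans ?_ hu2⟩
    congr 1
    exact Subtype.ext hu1'.symm
  · have : (T.graph : Set (E × E)) = {p | z.op p.1 = q.op p.2} := by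
      ext ⟨x, y⟩; exact h.mem_graph_iff hz
    change IsClosed (T.graph : Set (E × E))
    rw [this]
    exact isClosed_eq (by fun_prop) (by fun_prop)
  · have : ((adjoint A T).domain : Set E) = Set.range q.op := by
      ext x
      rw [SetLike.mem_coe, LinearPMap.mem_domain_iff, adjoint_graph hdom]
      simp only [h.mem_adjointGraph_iff' hz]
      exact ⟨fun ⟨_, v, hv, _⟩ => ⟨v, hv⟩, fun ⟨v, hv⟩ => ⟨_, v, hv, rfl⟩⟩
    rw [this]
    exact hd
  · refine Function.Surjective.denseRange fun v => ?_
    -- T⋆T maps q²v to z⋆z v, so (1 + T⋆T) q²v = v and 1 + T⋆T is even onto.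
    have hm : (q.op (q.op v), (star z).op (z.op v)) ∈ (pcomp (adjoint A T) T).graph := by
      rw [mem_graph_pcomp]
      refine ⟨z.op (q.op v), (h.graph _ _).mpr ⟨_, rfl, rfl⟩, ?_⟩
      rw [adjoint_graph hdom, h.mem_adjointGraph_iff' hz]
      exact ⟨z.op v, (op_comm (h.commute hz) v).symm, rfl⟩
    obtain ⟨u, hu1, hu2⟩ := (LinearPMap.mem_graph_iff _).mp hm
    refine ⟨⟨u, Submodule.mem_inf.mpr ⟨trivial, u.2⟩⟩, ?_⟩
    rw [LinearPMap.toFun_eq_coe, LinearPMap.add_apply]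
    change (u : E) + (pcomp (adjoint A T) T) u = v
    rw [hu2]
    have hu1' : (u : E) = q.op (q.op v) := hu1
    rw [hu1', h.add_eq]

theorem exists_isZPair_of_pair {z q : Adj A E} (hz : ‖z‖ ≤ 1) (hq : IsPositive A q.op)
    (hqq : q * q = 1 - star z * z) (hd : DenseRange q.op) :
    ∃ T : E →ₗ.[ℂ] E, IsZPair T z q := by
  refine ⟨(LinearMap.range ((q.op : E →ₗ[ℂ] E).prod (z.op : E →ₗ[ℂ] E))).toLinearPMap,
    hz, hq, hqq, fun x y => ?_⟩
  rw [Submodule.toLinearPMap_graph_eq, LinearMap.mem_range]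
  · exact exists_congr fun v => Prod.mk.injEq .. ▸ Iff.rfl
  · rintro _ ⟨v, rfl⟩ hv
    have : v = 0 := injective_of_denseRange_star (a := q) (by rwa [hq.star_eq]) hv
    rw [this]
    simp

end ZPair

/-! ### The Fuglede–Putnam theorem for normal regular operators -/

section Fuglede

variable {A : Type*} [NonUnitalCStarAlgebra A] [PartialOrder A] [StarOrderedRing A]
  {E F : Type*}
  [NormedAddCommGroup E] [NormedSpace ℂ E] [SMul A E] [CStarModule A E] [CompleteSpace E]
  [NormedAddCommGroup F] [NormedSpace ℂ F] [SMul A F] [CStarModule A F] [CompleteSpace F]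

theorem mem_graph_toP {U : E →L[ℂ] F} {x : E} {y : F} : (x, y) ∈ (toP U).graph ↔ U x = y := by
  rw [LinearPMap.mem_graph_iff]
  constructor
  · rintro ⟨u, rfl, rfl⟩; rfl
  · rintro rfl; exact ⟨⟨x, trivial⟩, rfl, rfl⟩

theorem mem_graph_toP_pcomp {U : E →L[ℂ] F} {S : E →ₗ.[ℂ] E} {x : E} {y : F} :
    (x, y) ∈ (pcomp (toP U) S).graph ↔ ∃ w, (x, w) ∈ S.graph ∧ U w = y := by
  simp only [mem_graph_pcomp, mem_graph_toP]

theorem mem_graph_pcomp_toP {U : E →L[ℂ] F} {T : F →ₗ.[ℂ] F} {x : E} {y : F} :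
    (x, y) ∈ (pcomp T (toP U)).graph ↔ (U x, y) ∈ T.graph := by
  simp only [mem_graph_pcomp, mem_graph_toP, exists_eq_left']

theorem pcomp_toP_le_iff {U : E →L[ℂ] F} {S : E →ₗ.[ℂ] E} {T : F →ₗ.[ℂ] F} :
    pcomp (toP U) S ≤ pcomp T (toP U) ↔
      ∀ x y, (x, y) ∈ S.graph → (U x, U y) ∈ T.graph := by
  rw [← LinearPMap.le_graph_iff]
  constructor
  · exact fun h x y hxy => mem_graph_pcomp_toP.mp (h (mem_graph_toP_pcomp.mpr ⟨y, hxy, rfl⟩))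
  · rintro h ⟨x, y⟩ hxy
    obtain ⟨w, hw, rfl⟩ := mem_graph_toP_pcomp.mp hxy
    exact mem_graph_pcomp_toP.mpr (h x w hw)

/-- Cut-offs of a positive contraction, with an approximate inverse. -/
theorem exists_cutoff {q : Adj A E} (hq : IsPositive A q.op) {ε : ℝ} (hε : 0 < ε) :
    ∃ χ k : Adj A E, (∀ b, Commute q b → Commute χ b) ∧ (∀ b, Commute q b → Commute k b) ∧
      star k = k ∧ χ * k * q = χ ∧ ‖q - χ * q‖ ≤ 2 * ε := by
  have hsa : IsSelfAdjoint q := hq.star_eq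
  have hn : IsStarNormal q := hsa.isStarNormal
  -- On the nonnegative axis χ is 0 up to ε and 1 from 2ε on, and k(x) = 1/x from ε on. So χ k x =
  -- χ, and x - χ x is at most 2ε.
  set χ : ℂ → ℝ := fun x => min 1 (max 0 (x.re / ε - 1)) with hχ
  set k : ℂ → ℝ := fun x => 1 / max x.re ε with hk
  have hpos : ∀ x : ℂ, 0 < max x.re ε := fun x => lt_max_of_lt_right hε
  have hχc : Continuous χ := by fun_prop
  have hkc : Continuous k := by
    refine continuous_const.div (by fun_prop) fun x => (hpos x).ne'
  have hcomm : ∀ (φ : ℂ → ℂ) (b : Adj A E), Commute q b → Commute (cfc φ q) b := fun φ b hb =>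
    hb.cfc (by rwa [hsa.star_eq]) φ
  refine ⟨cfc (fun x => (χ x : ℂ)) q, cfc (fun x => (k x : ℂ)) q, hcomm _, hcomm _,
    star_cfc_ofReal q k, ?_, ?_⟩
  · have : cfc (fun x => (χ x : ℂ)) q * cfc (fun x => (k x : ℂ)) q * q =
        cfc (fun x => (χ x : ℂ) * (k x : ℂ) * x) q := by
      rw [cfc_mul (fun x => (χ x : ℂ) * (k x : ℂ)) (fun x => x) q (by fun_prop) (by fun_prop),
        cfc_mul (fun x => (χ x : ℂ)) (fun x => (k x : ℂ)) q (by fun_prop) (by fun_prop),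
        cfc_id' ℂ q]
    rw [this]
    refine cfc_congr fun x hx => ?_
    rw [hsa.mem_spectrum_eq_re hx, ← Complex.ofReal_mul, ← Complex.ofReal_mul]
    congr 1
    simp only [hχ, hk, Complex.ofReal_re]
    rcases le_total x.re ε with h | h
    · have : x.re / ε - 1 ≤ 0 := by rw [sub_nonpos, div_le_one hε]; exact h
      rw [max_eq_left this, min_eq_right zero_le_one]; ring
    · rw [max_eq_left h, mul_assoc, one_div, inv_mul_cancel₀ (by linarith), mul_one]
  · have : q - cfc (fun x => (χ x : ℂ)) q * q = cfc (fun x => x - (χ x : ℂ) * x) q := by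
      rw [cfc_sub (fun x => x) (fun x => (χ x : ℂ) * x) q (by fun_prop) (by fun_prop),
        cfc_mul (fun x => (χ x : ℂ)) (fun x => x) q (by fun_prop) (by fun_prop), cfc_id' ℂ q]
    rw [this]
    refine norm_cfc_le (by positivity) fun x hx => ?_
    have h0 := hq.re_nonneg_of_mem_spectrum hx
    have e : x - (χ x : ℂ) * x = (((1 - χ x) * x.re : ℝ) : ℂ) := by
      conv_lhs => rw [hsa.mem_spectrum_eq_re hx]
      simp only [hχ, Complex.ofReal_re]
      push_cast; ring
    rw [e, Complex.norm_real]
    have h1 : χ x ≤ 1 := min_le_left _ _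
    rw [Real.norm_of_nonneg (mul_nonneg (by linarith) h0)]
    rcases le_total x.re (2 * ε) with h | h
    · have h2 : 0 ≤ χ x := le_min zero_le_one (le_max_left _ _)
      nlinarith
    · have : 1 ≤ x.re / ε - 1 := by
        rw [le_sub_iff_add_le, le_div_iff₀ hε]; linarith
      have : χ x = 1 := min_eq_left (this.trans (le_max_right _ _))
      rw [this]; simp; positivity

theorem isStarNormal_mul {B : Type*} [CStarAlgebra B] {z k : B} (hz : IsStarNormal z)
    (hk : star k = k) (h : Commute k z) (h' : Commute k (star z)) : IsStarNormal (z * k) := by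
  refine ⟨?_⟩
  rw [star_mul, hk]
  change k * star z * (z * k) = z * k * (k * star z)
  have e1 : k * star z * (z * k) = star z * z * (k * k) := by
    rw [h'.eq, mul_assoc, ← mul_assoc k, h.eq]; simp only [mul_assoc]
  have e2 : z * k * (k * star z) = z * star z * (k * k) := by
    rw [h'.eq, mul_assoc, ← mul_assoc k, h'.eq]; simp only [mul_assoc]
  rw [e1, e2, hz.star_comm_self.eq]

/-- On the range of χ the operator k inverts q, so z k is a bounded normal substitute for z q⁻¹. The
hypothesis says that χ'Uχ intertwines z k and z'k'; the bounded theorem replaces z, z' by their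
adjoints, and multiplying by q and q' removes k and k'. -/
theorem cutoff_relation {U : E →L[ℂ] F} {z q : Adj A E} {z' q' : Adj A F} (hz : IsStarNormal z)
    (hz' : IsStarNormal z') (hcz : Commute q z) (hczs : Commute q (star z))
    (hcz' : Commute q' z') (hczs' : Commute q' (star z'))
    (h : ∀ v, z'.op (U (q.op v)) = q'.op (U (z.op v))) {χ k : Adj A E} {χ' k' : Adj A F}
    (hχ : ∀ b, Commute q b → Commute χ b) (hk : ∀ b, Commute q b → Commute k b)
    (hks : star k = k) (hχk : χ * k * q = χ) (hχ' : ∀ b, Commute q' b → Commute χ' b)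
    (hk' : ∀ b, Commute q' b → Commute k' b) (hks' : star k' = k') (hχk' : χ' * k' * q' = χ')
    (v : E) : χ'.op ((star z').op (U (q.op (χ.op v)))) =
      χ'.op (q'.op (U ((star z).op (χ.op v)))) := by
  have e1 : ∀ v, χ.op (k.op (q.op v)) = χ.op v := fun v => Adj.congr_op hχk v
  have e2 : ∀ v, χ'.op (k'.op (q'.op v)) = χ'.op v := fun v => Adj.congr_op hχk' v
  have cqk := hk q (Commute.refl q)
  have cqχ := hχ q (Commute.refl q)
  have cqk' := hk' q' (Commute.refl q')
  have cqχ' := hχ' q' (Commute.refl q')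
  have ckχ := hχ k cqk.symm
  have ckχ' := hχ' k' cqk'.symm
  have e1' : ∀ v, q.op (k.op (χ.op v)) = χ.op v := fun v => by
    rw [← op_comm ckχ, ← op_comm cqχ, ← op_comm cqk, e1]
  have e2' : ∀ v, q'.op (k'.op (χ'.op v)) = χ'.op v := fun v => by
    rw [← op_comm ckχ', ← op_comm cqχ', ← op_comm cqk', e2]
  have hX : Intertwines (χ'.op.comp (U.comp χ.op)) (z * k) (z' * k') := fun v => by
    simp only [ContinuousLinearMap.comp_apply, Adj.mul_op]
    symm
    calc z'.op (k'.op (χ'.op (U (χ.op v))))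
        = χ'.op (k'.op (z'.op (U (χ.op v)))) := by
          rw [← op_comm ckχ', ← op_comm (hχ' _ hcz'), ← op_comm (hk' _ hcz')]
      _ = χ'.op (k'.op (z'.op (U (q.op (k.op (χ.op v)))))) := by
          rw [e1']
      _ = χ'.op (k'.op (q'.op (U (z.op (k.op (χ.op v)))))) := by rw [h]
      _ = χ'.op (U (χ.op (z.op (k.op v)))) := by
          rw [e2, ← op_comm ckχ, ← op_comm (hχ _ hcz)]
  have hX' := hX.star_right (isStarNormal_mul hz hks (hk _ hcz) (hk _ hczs))
    (isStarNormal_mul hz' hks' (hk' _ hcz') (hk' _ hczs')) (q.op v)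
  simp only [star_mul, hks, hks', ContinuousLinearMap.comp_apply, Adj.mul_op] at hX'
  have e3 : χ'.op (q'.op (U (χ.op ((star z).op v)))) =
      χ'.op ((star z').op (U (χ.op (q.op v)))) := by
    rw [← op_comm hczs, e1] at hX'
    rw [op_comm cqχ', hX', ← op_comm (hχ' _ hczs'), e2']
  rw [← op_comm cqχ, ← op_comm (hχ _ hczs), e3]

/-- For cut-offs at ε = 1/(n+1) one has χ q → q and χ'q' → q' in norm, while χ'q'Dχq = q'(χ'Dχ)q =
0. -/
theorem eq_zero_of_cutoff {q : Adj A E} {q' : Adj A F} (hq : IsPositive A q.op)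
    (hq' : IsPositive A q'.op) {D : E →L[ℂ] F}
    (key : ∀ {χ k : Adj A E} {χ' k' : Adj A F}, (∀ b, Commute q b → Commute χ b) →
      (∀ b, Commute q b → Commute k b) → star k = k → χ * k * q = χ →
      (∀ b, Commute q' b → Commute χ' b) → (∀ b, Commute q' b → Commute k' b) → star k' = k' →
      χ' * k' * q' = χ' → ∀ v, χ'.op (D (χ.op v)) = 0) (u : E) : q'.op (D (q.op u)) = 0 := by
  have hε : ∀ n : ℕ, (0 : ℝ) < 1 / ((n : ℝ) + 1) := fun n => by positivity
  choose χ k h1 h2 h3 h4 h5 using fun n => exists_cutoff hq (hε n)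
  choose χ' k' h1' h2' h3' h4' h5' using fun n => exists_cutoff hq' (hε n)
  have hlim : Filter.Tendsto (fun n : ℕ => 2 * (1 / ((n : ℝ) + 1))) Filter.atTop (nhds 0) := by
    simpa using tendsto_one_div_add_atTop_nhds_zero_nat.const_mul (2 : ℝ)
  have l1 : Filter.Tendsto (fun n => χ n * q) Filter.atTop (nhds q) :=
    tendsto_iff_norm_sub_tendsto_zero.mpr
      (squeeze_zero (fun n => norm_nonneg _) (fun n => norm_sub_rev q _ ▸ h5 n) hlim)
  have l2 : Filter.Tendsto (fun n => χ' n * q') Filter.atTop (nhds q') :=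
    tendsto_iff_norm_sub_tendsto_zero.mpr
      (squeeze_zero (fun n => norm_nonneg _) (fun n => norm_sub_rev q' _ ▸ h5' n) hlim)
  have l3 : Filter.Tendsto (fun n => (χ n * q).op u) Filter.atTop (nhds (q.op u)) :=
    (isBoundedBilinearMap_apply.continuous.tendsto (q.op, u)).comp
      (((Adj.continuous_op.tendsto _).comp l1).prodMk_nhds tendsto_const_nhds)
  have l4 : Filter.Tendsto (fun n => (χ' n * q').op (D ((χ n * q).op u))) Filter.atTop
      (nhds (q'.op (D (q.op u)))) :=
    (isBoundedBilinearMap_apply.continuous.tendsto (q'.op, D (q.op u))).comp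
      (((Adj.continuous_op.tendsto _).comp l2).prodMk_nhds ((D.continuous.tendsto _).comp l3))
  refine tendsto_nhds_unique l4 (tendsto_const_nhds.congr fun n => ?_)
  simp only [Adj.mul_op]
  rw [op_comm (h1' n q' (Commute.refl q')),
    key (h1 n) (h2 n) (h3 n) (h4 n) (h1' n) (h2' n) (h3' n) (h4' n), map_zero]

/-- The analogue of the bounded Fuglede–Putnam theorem for `z`-transforms. -/
theorem star_relation {U : E →L[ℂ] F} {S : E →ₗ.[ℂ] E} {T : F →ₗ.[ℂ] F} {z q : Adj A E}
    {z' q' : Adj A F} (hS : IsZPair S z q) (hT : IsZPair T z' q') (hz : IsStarNormal z)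
    (hz' : IsStarNormal z') (hd : DenseRange q.op)
    (h : ∀ v, z'.op (U (q.op v)) = q'.op (U (z.op v))) (v : E) :
    (star z').op (U (q.op v)) = q'.op (U ((star z).op v)) := by
  have hcz := (hS.commute hz).symm
  have hczs := (hS.commute_star hz).symm
  have hcz' := (hT.commute hz').symm
  have hczs' := (hT.commute_star hz').symm
  set D : E →L[ℂ] F := (star z').op.comp (U.comp q.op) - q'.op.comp (U.comp (star z).op) with hD
  -- The cut-offs only show q'Dq = 0; injectivity of q' and density of the range of q then give D =
  -- 0.
  have hD0 : ∀ u, D (q.op u) = 0 := fun u => by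
    refine hT.injective (eq_zero_of_cutoff hS.pos hT.pos ?_ u)
    intro χ k χ' k' h1 h2 h3 h4 h5 h6 h7 h8 v
    have := cutoff_relation hz hz' hcz hczs hcz' hczs' h h1 h2 h3 h4 h5 h6 h7 h8 v
    rw [hD, sub_apply, map_sub]
    exact sub_eq_zero.mpr this
  have : D v = 0 := hd.induction_on (p := fun v => D v = 0) v
    (isClosed_eq D.continuous continuous_const) hD0
  rw [hD] at this
  exact sub_eq_zero.mp this

/-- Using both relations, z'⋆z'Uq² = q'²Uz⋆z. Adding q'²Uq² gives Uq² = q'²U, because q² + z⋆z and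
q'² + z'⋆z' are 1. Square roots give Uq = q'U, and then q on the right can be cancelled by density.
-/
theorem intertwines_of_relation {U : E →L[ℂ] F} {S : E →ₗ.[ℂ] E} {T : F →ₗ.[ℂ] F}
    {z q : Adj A E} {z' q' : Adj A F} (hS : IsZPair S z q) (hT : IsZPair T z' q')
    (hz : IsStarNormal z) (hz' : IsStarNormal z') (hd : DenseRange q.op)
    (h : ∀ v, z'.op (U (q.op v)) = q'.op (U (z.op v))) :
    Intertwines U q q' ∧ Intertwines U z z' ∧ Intertwines U (star z) (star z') := by
  have h' := star_relation hS hT hz hz' hd h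
  have hqq : Intertwines U (q * q) (q' * q') := fun v => by
    have e1 : (star z').op (z'.op (U (q.op (q.op v)))) =
        q'.op (q'.op (U ((star z).op (z.op v)))) := by
      rw [h, op_comm (hT.commute_star hz'), op_comm (hS.commute hz), h']
    have e2 := hT.add_eq (U (q.op (q.op v)))
    rw [e1, ← map_add, ← map_add, ← map_add, hS.add_eq] at e2
    exact e2.symm
  have hq : Intertwines U q q' := Intertwines.of_mul_self hS.pos hT.pos hqq
  refine ⟨hq, fun v => ?_, fun v => ?_⟩
  · refine hd.induction_on (p := fun v => U (z.op v) = z'.op (U v)) v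
      (isClosed_eq (by fun_prop) (by fun_prop)) fun u => ?_
    rw [h, op_comm (hS.commute hz), hq]
  · refine hd.induction_on (p := fun v => U ((star z).op v) = (star z').op (U v)) v
      (isClosed_eq (by fun_prop) (by fun_prop)) fun u => ?_
    rw [h', op_comm (hS.commute_star hz), hq]

theorem intertwines_of_pcomp_le {U : E →L[ℂ] F} {S : E →ₗ.[ℂ] E} {T : F →ₗ.[ℂ] F}
    {z q : Adj A E} {z' q' : Adj A F} (hS : IsZPair S z q) (hT : IsZPair T z' q')
    (hz : IsStarNormal z) (hz' : IsStarNormal z') (hd : DenseRange q.op)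
    (h : pcomp (toP U) S ≤ pcomp T (toP U)) :
    Intertwines U q q' ∧ Intertwines U z z' ∧ Intertwines U (star z) (star z') :=
  intertwines_of_relation hS hT hz hz' hd fun v => (hT.mem_graph_iff hz').mp
    (pcomp_toP_le_iff.mp h _ _ ((hS.graph _ _).mpr ⟨v, rfl, rfl⟩))

theorem pcomp_adjoint_le {U : E →L[ℂ] F} {S : E →ₗ.[ℂ] E} {T : F →ₗ.[ℂ] F}
    (hS : IsNormal A S) (hT : IsNormal A T) (h : pcomp (toP U) S ≤ pcomp T (toP U)) :
    pcomp (toP U) (adjoint A S) ≤ pcomp (adjoint A T) (toP U) := by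
  obtain ⟨z, q, h1, hz, hd⟩ := hS.exists_isZPair
  obtain ⟨z', q', h1', hz', hd'⟩ := hT.exists_isZPair
  obtain ⟨hq, -, hzs⟩ := intertwines_of_pcomp_le h1 h1' hz hz' hd h
  refine pcomp_toP_le_iff.mpr fun x y hxy => ?_
  rw [adjoint_graph hS.regular.dense_domain, h1.mem_adjointGraph_iff] at hxy
  rw [adjoint_graph hT.regular.dense_domain, h1'.mem_adjointGraph_iff, ← hzs, ← hq, hxy]

end Fuglede

/-! ### The plane as the open unit disc -/

section DiscCoordinates

/-- `√(1 - |ξ|²)`. -/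
def discRoot (ξ : ℂ) : ℝ := √(1 - ‖ξ‖ ^ 2)

/-- The homeomorphism `c ↦ c / √(1 + |c|²)` of the plane onto the open unit disc. -/
def toDisc (c : ℂ) : ℂ := c / (√(1 + ‖c‖ ^ 2) : ℝ)

/-- The inverse of `toDisc`. -/
def ofDisc (ξ : ℂ) : ℂ := ξ / (discRoot ξ : ℂ)

theorem continuous_discRoot : Continuous discRoot := by unfold discRoot; fun_prop

theorem discRoot_pos {ξ : ℂ} (h : ‖ξ‖ < 1) : 0 < discRoot ξ :=
  Real.sqrt_pos.mpr (by nlinarith [norm_nonneg ξ])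

theorem discRoot_eq_zero {ξ : ℂ} (h : 1 ≤ ‖ξ‖) : discRoot ξ = 0 :=
  Real.sqrt_eq_zero_of_nonpos (by nlinarith)

theorem discRoot_sq {ξ : ℂ} (h : ‖ξ‖ ≤ 1) : discRoot ξ * discRoot ξ = 1 - ‖ξ‖ ^ 2 :=
  Real.mul_self_sqrt (by nlinarith [norm_nonneg ξ])

theorem sqrt_one_add_pos (c : ℂ) : 0 < √(1 + ‖c‖ ^ 2) := by positivity

theorem norm_toDisc (c : ℂ) : ‖toDisc c‖ = ‖c‖ / √(1 + ‖c‖ ^ 2) := by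
  rw [toDisc, norm_div, Complex.norm_real, Real.norm_of_nonneg (sqrt_one_add_pos c).le]

theorem continuous_toDisc : Continuous toDisc := by
  refine continuous_id.div (by fun_prop) fun c => ?_
  exact_mod_cast (sqrt_one_add_pos c).ne'

theorem norm_toDisc_lt_one (c : ℂ) : ‖toDisc c‖ < 1 := by
  rw [norm_toDisc, div_lt_one (sqrt_one_add_pos c)]
  exact Real.lt_sqrt_of_sq_lt (by linarith)

theorem discRoot_toDisc (c : ℂ) : discRoot (toDisc c) = 1 / √(1 + ‖c‖ ^ 2) := by
  have h := sqrt_one_add_pos c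
  have h2 : √(1 + ‖c‖ ^ 2) ^ 2 = 1 + ‖c‖ ^ 2 := Real.sq_sqrt (by positivity)
  rw [discRoot, norm_toDisc]
  refine Real.sqrt_eq_iff_mul_self_eq_of_pos (by positivity) |>.mpr ?_
  rw [div_pow, h2]
  field_simp
  rw [h2]; ring

theorem ofDisc_toDisc (c : ℂ) : ofDisc (toDisc c) = c := by
  have h : ((√(1 + ‖c‖ ^ 2) : ℝ) : ℂ) ≠ 0 := by exact_mod_cast (sqrt_one_add_pos c).ne'
  rw [ofDisc, discRoot_toDisc, toDisc, Complex.ofReal_div, Complex.ofReal_one]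
  field_simp

theorem toDisc_ofDisc {ξ : ℂ} (h : ‖ξ‖ < 1) : toDisc (ofDisc ξ) = ξ := by
  have h0 := discRoot_pos h
  have h1 := discRoot_sq h.le
  have h2 : √(1 + ‖ofDisc ξ‖ ^ 2) = 1 / discRoot ξ := by
    rw [ofDisc, norm_div, Complex.norm_real, Real.norm_of_nonneg h0.le]
    refine Real.sqrt_eq_iff_mul_self_eq_of_pos (by positivity) |>.mpr ?_
    field_simp
    nlinarith
  have h3 : (discRoot ξ : ℂ) ≠ 0 := by exact_mod_cast h0.ne'
  rw [toDisc, h2, ofDisc, Complex.ofReal_div, Complex.ofReal_one]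
  field_simp

/-- This is the symbol of z - c q. For ‖ξ‖ ≥ 1 the root is 0 and the expression reduces to ξ ≠ 0, so
the only zero is the image of c in the disc. -/
theorem sub_mul_discRoot_eq_zero_iff {ξ : ℂ} (c : ℂ) :
    ξ - c * discRoot ξ = 0 ↔ ξ = toDisc c := by
  constructor
  · intro h
    have hlt : ‖ξ‖ < 1 := by
      by_contra hge
      push Not at hge
      rw [discRoot_eq_zero hge] at h
      simp at h
      rw [h] at hge
      norm_num at hge
    have h0 : (discRoot ξ : ℂ) ≠ 0 := by exact_mod_cast (discRoot_pos hlt).ne'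
    have : ofDisc ξ = c := by rw [ofDisc, div_eq_iff h0]; exact sub_eq_zero.mp h
    rw [← this, toDisc_ofDisc hlt]
  · rintro rfl
    rw [discRoot_toDisc, toDisc, Complex.ofReal_div, Complex.ofReal_one]
    ring

theorem continuousOn_ofDisc : ContinuousOn ofDisc {ξ | ‖ξ‖ < 1} := by
  refine continuousOn_id.div
    (Complex.continuous_ofReal.comp continuous_discRoot).continuousOn fun ξ hξ => ?_
  exact_mod_cast (discRoot_pos hξ).ne'

/-- A function vanishing exactly on the unit circle and at the points of `K`, in the coordinate
`ξ = toDisc c`. -/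
def vanishing (K : Finset ℂ) (ξ : ℂ) : ℂ := discRoot ξ * ∏ c ∈ K, (ξ - c * discRoot ξ)

theorem continuous_vanishing (K : Finset ℂ) : Continuous (vanishing K) := by
  have := continuous_discRoot
  unfold vanishing
  fun_prop

theorem vanishing_ne_zero_iff {K : Finset ℂ} {ξ : ℂ} :
    vanishing K ξ ≠ 0 ↔ ‖ξ‖ < 1 ∧ ofDisc ξ ∉ K := by
  rw [vanishing, mul_ne_zero_iff, Finset.prod_ne_zero_iff]
  have h1 : (discRoot ξ : ℂ) ≠ 0 ↔ ‖ξ‖ < 1 := by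
    constructor
    · intro h
      by_contra hge
      exact h (by rw [discRoot_eq_zero (not_lt.mp hge)]; simp)
    · exact fun h => by exact_mod_cast (discRoot_pos h).ne'
  rw [h1]
  refine and_congr_right fun hξ => ?_
  constructor
  · exact fun h hK => h _ hK ((sub_mul_discRoot_eq_zero_iff _).mpr (toDisc_ofDisc hξ).symm)
  · intro h c hc h0
    rw [sub_mul_discRoot_eq_zero_iff] at h0
    rw [h0, ofDisc_toDisc] at h
    exact h hc

open Classical in
/-- A function on `G ⊆ ℂ` in the coordinate `ξ = toDisc c`, extended by zero. -/
def discLift {G : Set ℂ} (g : G → ℂ) (ξ : ℂ) : ℂ :=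
  if h : ‖ξ‖ < 1 ∧ ofDisc ξ ∈ G then g ⟨ofDisc ξ, h.2⟩ else 0

theorem discLift_of_mem {G : Set ℂ} (g : G → ℂ) {ξ : ℂ} (h1 : ‖ξ‖ < 1) (h2 : ofDisc ξ ∈ G) :
    discLift g ξ = g ⟨ofDisc ξ, h2⟩ := dif_pos ⟨h1, h2⟩

theorem discLift_toDisc {G : Set ℂ} (g : G → ℂ) {c : ℂ} (h : c ∈ G) :
    discLift g (toDisc c) = g ⟨c, h⟩ := by
  have h2 : ofDisc (toDisc c) ∈ G := by rwa [ofDisc_toDisc]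
  rw [discLift_of_mem g (norm_toDisc_lt_one c) h2]
  congr 1
  exact Subtype.ext (ofDisc_toDisc c)

theorem norm_discLift_le {G : Set ℂ} {g : G → ℂ} {C : ℝ} (hC : 0 ≤ C) (h : ∀ x, ‖g x‖ ≤ C)
    (ξ : ℂ) : ‖discLift g ξ‖ ≤ C := by
  unfold discLift
  split
  · exact h _
  · rwa [norm_zero]

theorem continuousOn_discLift {G : Set ℂ} {g : G → ℂ} (hg : Continuous g) :
    ContinuousOn (discLift g) {ξ | ‖ξ‖ < 1 ∧ ofDisc ξ ∈ G} := by
  rw [continuousOn_iff_continuous_domRestrict]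
  have h1 : Continuous fun ξ : {ξ : ℂ | ‖ξ‖ < 1 ∧ ofDisc ξ ∈ G} => (⟨ofDisc ξ, ξ.2.2⟩ : G) :=
    ((continuousOn_ofDisc.mono fun ξ (h : ‖ξ‖ < 1 ∧ ofDisc ξ ∈ G) => h.1).domRestrict).subtype_mk _
  convert! hg.comp h1 using 1
  funext ξ
  exact discLift_of_mem g ξ.2.1 ξ.2.2

/-- A bounded factor cannot spoil continuity at a zero of h; elsewhere φ is continuous already. -/
theorem continuousOn_mul_of_vanishing {s : Set ℂ} {φ h : ℂ → ℂ} {C : ℝ} (hh : Continuous h)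
    (hC : ∀ x ∈ s, ‖φ x‖ ≤ C) (hφ : ContinuousOn φ (s ∩ {x | h x ≠ 0})) :
    ContinuousOn (fun x => φ x * h x) s := by
  intro x hx
  by_cases h0 : h x = 0
  · have : Filter.Tendsto (fun y => φ y * h y) (nhdsWithin x s) (nhds 0) := by
      refine squeeze_zero_norm' (a := fun y => C * ‖h y‖) ?_ ?_
      · filter_upwards [self_mem_nhdsWithin] with y hy
        rw [norm_mul]
        exact mul_le_mul_of_nonneg_right (hC y hy) (norm_nonneg _)
      · have : Filter.Tendsto (fun y => C * ‖h y‖) (nhds x) (nhds (C * ‖h x‖)) :=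
          (by fun_prop : Continuous fun y => C * ‖h y‖).tendsto x
        rw [h0, norm_zero, mul_zero] at this
        exact this.mono_left nhdsWithin_le_nhds
    simpa [ContinuousWithinAt, h0] using this
  · have hopen : IsOpen {x | h x ≠ 0} := isOpen_ne_fun hh continuous_const
    have := (hφ x ⟨hx, h0⟩).mul hh.continuousWithinAt
    exact (continuousWithinAt_inter (hopen.mem_nhds h0)).mp this

end DiscCoordinates

/-! ### The spectrum of T in terms of the spectrum of z -/

section Spectrum

variable {A : Type*} [NonUnitalCStarAlgebra A] [PartialOrder A] [StarOrderedRing A]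
  {E : Type*} [NormedAddCommGroup E] [NormedSpace ℂ E] [SMul A E] [CStarModule A E]
  [CompleteSpace E] {T : E →ₗ.[ℂ] E} {z q : Adj A E}

theorem IsZPair.eq_cfc (h : IsZPair T z q) (hz : IsStarNormal z) :
    q = cfc (fun ξ => (discRoot ξ : ℂ)) z := by
  have hc := continuous_discRoot
  refine eq_of_mul_self_eq h.pos
    (isPositive_cfc_ofReal hc.continuousOn fun x _ => Real.sqrt_nonneg _) ?_
  have : (1 : Adj A E) - star z * z = cfc (fun x : ℂ => 1 - star x * x) z := by
    rw [cfc_sub (fun _ : ℂ => 1) (fun x => star x * x) z,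
      cfc_mul (fun x : ℂ => star x) (fun x => x) z, cfc_star (fun x : ℂ => x) z, cfc_id' ℂ z, cfc_const_one ℂ z]
  rw [h.sq, this, ← cfc_mul _ _ z (by fun_prop) (by fun_prop)]
  refine cfc_congr fun x hx => ?_
  simp only [← Complex.ofReal_mul]
  rw [discRoot_sq (norm_le_one_of_mem_spectrum h.norm_le hx)]
  simp [Complex.conj_mul']

theorem IsZPair.sub_smul_eq_cfc (h : IsZPair T z q) (hz : IsStarNormal z) (c : ℂ) :
    z - c • q = cfc (fun ξ => ξ - c * discRoot ξ) z := by
  have hc := continuous_discRoot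
  rw [cfc_sub (fun x => x) (fun x => c * discRoot x) z (by fun_prop) (by fun_prop),
    cfc_const_mul c (fun x => (discRoot x : ℂ)) z (by fun_prop), cfc_id' ℂ z, ← h.eq_cfc hz]

theorem mem_graph_subScalar {c : ℂ} {x y : E} :
    (x, y) ∈ (subScalar T c).graph ↔ (x, y + c • x) ∈ T.graph := by
  rw [LinearPMap.mem_graph_iff, LinearPMap.mem_graph_iff]
  constructor
  · rintro ⟨u, rfl, rfl⟩
    refine ⟨⟨u, u.2.1⟩, rfl, ?_⟩
    exact (sub_add_cancel _ _).symm
  · rintro ⟨u, rfl, hu⟩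
    refine ⟨⟨u, u.2, trivial⟩, rfl, ?_⟩
    have hu' : T u = y + c • (u : E) := hu
    change T u - c • (u : E) = y
    rw [hu', add_sub_cancel_right]

theorem IsZPair.mem_graph_subScalar (h : IsZPair T z q) {c : ℂ} {x y : E} :
    (x, y) ∈ (subScalar T c).graph ↔ ∃ v, q.op v = x ∧ (z - c • q).op v = y := by
  rw [HilbertModule.mem_graph_subScalar, h.graph]
  refine exists_congr fun v => and_congr_right fun hv => ?_
  rw [Adj.sub_op, Adj.smul_op, hv, sub_eq_iff_eq_add]

theorem IsZPair.isAdjointableInvertible_iff (h : IsZPair T z q) (c : ℂ) :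
    IsAdjointableInvertible A (subScalar T c) ↔ IsUnit (z - c • q) := by
  constructor
  · rintro ⟨R', ⟨s, hs⟩, hR1, hR2⟩
    set R : Adj A E := Adj.mk hs with hR
    have hRop : ∀ x, R.op x = R' x := fun _ => rfl
    have g1 : ∀ v, R.op ((z - c • q).op v) = q.op v := fun v => by
      have h1 : (q.op v, R' ((z - c • q).op v)) ∈ (pcomp (toP R') (subScalar T c)).graph :=
        mem_graph_toP_pcomp.mpr ⟨_, h.mem_graph_subScalar.mpr ⟨v, rfl, rfl⟩, rfl⟩
      have h2 := LinearPMap.le_graph_of_le hR1 h1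
      exact (mem_graph_toP.mp h2).symm
    have g2 : ∀ y, ∃ v, q.op v = R.op y ∧ (z - c • q).op v = y := fun y => by
      have h1 : (y, y) ∈ (pcomp (subScalar T c) (toP R')).graph := by
        rw [hR2, mem_graph_toP]; rfl
      exact h.mem_graph_subScalar.mp (mem_graph_pcomp_toP.mp h1)
    -- If y = (z - c q)v and q v = R y, then z v = y + c R y, and v = q(q v) + z⋆(z v) recovers v
    -- from y.
    set B : Adj A E := q * R + star z * (1 + c • R) with hB
    have hBv : ∀ v, B.op ((z - c • q).op v) = v := fun v => by
      rw [hB, Adj.add_op, Adj.mul_op, Adj.mul_op, Adj.add_op, Adj.one_op, Adj.smul_op, g1,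
        Adj.sub_op, Adj.smul_op, sub_add_cancel, h.add_eq]
    refine isUnit_iff_exists.mpr ⟨B, Adj.ext fun y => ?_, Adj.ext fun v => ?_⟩
    · obtain ⟨v, -, rfl⟩ := g2 y
      rw [Adj.mul_op, hBv, Adj.one_op]
    · rw [Adj.mul_op, hBv, Adj.one_op]
  · intro hu
    obtain ⟨u, hu1, hu2⟩ := isUnit_iff_exists.mp hu
    have e1 : ∀ v, (z - c • q).op (u.op v) = v := fun v => Adj.congr_op hu1 v
    have e2 : ∀ v, u.op ((z - c • q).op v) = v := fun v => Adj.congr_op hu2 v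
    refine ⟨(q * u).op, ⟨_, Adj.isAdjointPair_star _⟩, ?_, ?_⟩
    · rw [← LinearPMap.le_graph_iff]
      rintro ⟨x, y⟩ hxy
      obtain ⟨w, hw, rfl⟩ := mem_graph_toP_pcomp.mp hxy
      obtain ⟨v, rfl, rfl⟩ := h.mem_graph_subScalar.mp hw
      rw [mem_graph_toP, Adj.mul_op, e2]; rfl
    · refine LinearPMap.eq_of_eq_graph ?_
      ext ⟨x, y⟩
      rw [mem_graph_pcomp_toP, mem_graph_toP, h.mem_graph_subScalar]
      constructor
      · rintro ⟨v, hv, rfl⟩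
        rw [Adj.mul_op] at hv
        rw [h.injective' hv, e1]; rfl
      · rintro rfl
        exact ⟨u.op x, rfl, e1 x⟩

/-- T - c is invertible exactly when z - c q is, and z - c q is the function ξ - c √(1-|ξ|²) of z,
whose only zero is `toDisc c`. -/
theorem IsZPair.mem_spec_iff (h : IsZPair T z q) (hz : IsStarNormal z) (c : ℂ) :
    c ∈ spec A T ↔ toDisc c ∈ spectrum ℂ z := by
  have hc := continuous_discRoot
  change ¬ IsAdjointableInvertible A (subScalar T c) ↔ _
  rw [h.isAdjointableInvertible_iff, h.sub_smul_eq_cfc hz,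
    isUnit_cfc_iff (fun ξ => ξ - c * discRoot ξ) z (by fun_prop)]
  push Not
  constructor
  · rintro ⟨x, hx, h0⟩
    rwa [← (sub_mul_discRoot_eq_zero_iff c).mp h0]
  · exact fun hx => ⟨_, hx, (sub_mul_discRoot_eq_zero_iff c).mpr rfl⟩

theorem IsZPair.ofDisc_mem_spec (h : IsZPair T z q) (hz : IsStarNormal z) {ξ : ℂ}
    (hξ : ξ ∈ spectrum ℂ z) (h1 : ‖ξ‖ < 1) : ofDisc ξ ∈ spec A T := by
  rw [h.mem_spec_iff hz, toDisc_ofDisc h1]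
  exact hξ

theorem IsZPair.denseRange_of_isInvertible (h : IsZPair T z q) {c : ℂ}
    (hc : IsInvertible A (subScalar T c)) : DenseRange (z - c • q).op := by
  have hd := hc.2.dense_domain
  rw [LinearPMap.inverse_domain] at hd
  refine hd.mono ?_
  rintro _ ⟨x, rfl⟩
  obtain ⟨v, -, hv⟩ := h.mem_graph_subScalar.mp (LinearPMap.mem_graph (subScalar T c) x)
  exact ⟨v, hv⟩

theorem IsZPair.denseRange_of_notMem_spec (h : IsZPair T z q) {c : ℂ} (hc : c ∉ spec A T) :
    DenseRange (z - c • q).op := by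
  have hu := (h.isAdjointableInvertible_iff c).mp (not_not.mp hc)
  obtain ⟨u, hu1, -⟩ := isUnit_iff_exists.mp hu
  exact Function.Surjective.denseRange fun v => ⟨u.op v, Adj.congr_op hu1 v⟩

/-- The operator is q ∏ (z - c q), a product of factors of dense range. It can therefore be
cancelled on the right in identities between bounded operators. -/
theorem IsZPair.denseRange_vanishing (h : IsZPair T z q) (hz : IsStarNormal z)
    (hd : DenseRange q.op) {K : Finset ℂ} (hK : ∀ c ∈ K, DenseRange (z - c • q).op) :
    DenseRange (cfc (vanishing K) z).op := by
  have hc := continuous_discRoot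
  have hc' : Continuous fun ξ => (discRoot ξ : ℂ) := by fun_prop
  induction K using Finset.induction_on with
  | empty =>
    have : vanishing ∅ = fun ξ => (discRoot ξ : ℂ) := by funext ξ; simp [vanishing]
    rwa [this, ← h.eq_cfc hz]
  | insert c K hcK ih =>
    have : vanishing (insert c K) = fun ξ => (ξ - c * discRoot ξ) * vanishing K ξ := by
      funext ξ
      simp only [vanishing]
      rw [Finset.prod_insert hcK]; ring
    rw [this, cfc_mul _ _ z (by fun_prop) (continuous_vanishing K).continuousOn,
      ← h.sub_smul_eq_cfc hz]
    exact denseRange_mul (hK c (Finset.mem_insert_self c K))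
      (ih fun c' hc' => hK c' (Finset.mem_insert_of_mem hc'))

theorem IsZPair.continuousOn_discLift_mul (h : IsZPair T z q) (hz : IsStarNormal z)
    {K : Finset ℂ} {G : Set ℂ} (hG : spec A T \ K ⊆ G) {g : G → ℂ} (hg : Continuous g) {C : ℝ}
    (hC : 0 ≤ C) (hgC : ∀ x, ‖g x‖ ≤ C) :
    ContinuousOn (fun ξ => discLift g ξ * vanishing K ξ) (spectrum ℂ z) := by
  refine continuousOn_mul_of_vanishing (continuous_vanishing K)
    (fun x _ => norm_discLift_le hC hgC x) ((continuousOn_discLift hg).mono ?_)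
  rintro ξ ⟨hξ, h0⟩
  obtain ⟨h1, h2⟩ := vanishing_ne_zero_iff.mp h0
  exact ⟨h1, hG ⟨h.ofDisc_mem_spec hz hξ h1, h2⟩⟩

end Spectrum

/-! ### The z-transform of f(T) -/

section Values

variable {A : Type*} [NonUnitalCStarAlgebra A] [PartialOrder A] [StarOrderedRing A]
  {E : Type*} [NormedAddCommGroup E] [NormedSpace ℂ E] [SMul A E] [CStarModule A E]
  [CompleteSpace E] {T : E →ₗ.[ℂ] E} {z q t : Adj A E}

/-- A bounded operator that multiplies `h(z)`, of dense range, to `(F h)(z)` does so for every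
admissible function. -/
theorem mul_cfc_of_mul_cfc {F h φ : ℂ → ℂ} (hd : DenseRange (cfc h z).op)
    (hh : ContinuousOn h (spectrum ℂ z))
    (hFh : ContinuousOn (fun x => F x * h x) (spectrum ℂ z))
    (hφ : ContinuousOn φ (spectrum ℂ z))
    (hFφ : ContinuousOn (fun x => F x * φ x) (spectrum ℂ z))
    (ht : t * cfc h z = cfc (fun x => F x * h x) z) :
    t * cfc φ z = cfc (fun x => F x * φ x) z := by
  refine eq_of_mul_eq_of_denseRange hd ?_
  rw [mul_assoc, (cfc_commute_cfc φ h z).eq, ← mul_assoc, ht, ← cfc_mul _ _ z hFh hφ,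
    ← cfc_mul _ _ z hFφ hh]
  exact cfc_congr fun x _ => by ring

theorem norm_zFun_lt {X : Type*} [TopologicalSpace X] (f : C(X, ℂ)) (x : X) : ‖zFun f x‖ < 1 :=
  norm_toDisc_lt_one (f x)

theorem norm_discLift_zFun_lt {G : Set ℂ} (f : C(G, ℂ)) (ξ : ℂ) : ‖discLift (zFun f) ξ‖ < 1 := by
  unfold discLift
  split
  · exact norm_zFun_lt f _
  · simp

theorem star_discLift {G : Set ℂ} (g : G → ℂ) (ξ : ℂ) :
    star (discLift g ξ) = discLift (fun x => star (g x)) ξ := by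
  unfold discLift
  split <;> simp

theorem IsZPair.continuousOn_zFun (h : IsZPair T z q) (hz : IsStarNormal z) {K : Finset ℂ}
    {G : Set ℂ} (hG : spec A T \ K ⊆ G) (f : C(G, ℂ)) :
    ContinuousOn (fun ξ => discLift (zFun f) ξ * vanishing K ξ) (spectrum ℂ z) :=
  h.continuousOn_discLift_mul hz hG (zFun f).continuous zero_le_one (norm_zFun_le f)

/-- The `z`-transform of `f(T)`, with the positive square root that goes with it. -/
theorem IsZPair.exists_value (h : IsZPair T z q) (hz : IsStarNormal z) {K : Finset ℂ} {G : Set ℂ}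
    (hG : spec A T \ K ⊆ G) (hd : DenseRange (cfc (vanishing K) z).op) (f : C(G, ℂ)) :
    ∃ t r : Adj A E, ‖t‖ ≤ 1 ∧ IsStarNormal t ∧ IsPositive A r.op ∧ r * r = 1 - star t * t ∧
      DenseRange r.op ∧
      t * cfc (vanishing K) z = cfc (fun ξ => discLift (zFun f) ξ * vanishing K ξ) z := by
  set Φ := discLift (zFun f) with hΦ
  have hh : ContinuousOn (vanishing K) (spectrum ℂ z) := (continuous_vanishing K).continuousOn
  have hc : ContinuousOn (fun ξ => Φ ξ * vanishing K ξ) (spectrum ℂ z) :=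
    h.continuousOn_zFun hz hG f
  have hc' : ContinuousOn (fun ξ => star (Φ ξ) * vanishing K ξ) (spectrum ℂ z) := by
    simp only [hΦ, star_discLift]
    exact h.continuousOn_discLift_mul hz hG (zFun f).continuous.star zero_le_one
      fun x => by rw [norm_star]; exact norm_zFun_le f x
  have hcc : ContinuousOn (fun ξ => star (Φ ξ) * (Φ ξ * vanishing K ξ)) (spectrum ℂ z) := by
    have := h.continuousOn_discLift_mul hz hG (g := fun x => star (zFun f x) * zFun f x)
      ((zFun f).continuous.star.mul (zFun f).continuous) zero_le_one fun x => by
        rw [norm_mul, norm_star]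
        exact mul_le_one₀ (norm_zFun_le f x) (norm_nonneg _) (norm_zFun_le f x)
    refine this.congr fun ξ _ => ?_
    have e : star (Φ ξ) * Φ ξ = discLift (fun x => star (zFun f x) * zFun f x) ξ := by
      simp only [hΦ, discLift]
      split <;> simp
    rw [← mul_assoc, e]
  have hcc' : ContinuousOn (fun ξ => Φ ξ * (star (Φ ξ) * vanishing K ξ)) (spectrum ℂ z) :=
    hcc.congr fun ξ _ => by ring
  obtain ⟨t, ht1, ht, hts⟩ := exists_multiplier
    (fun ξ _ => (norm_discLift_zFun_lt f ξ).le) hh hc hc' hd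
  have e1 : star t * t * cfc (vanishing K) z =
      cfc (fun ξ => star (Φ ξ) * (Φ ξ * vanishing K ξ)) z := by
    rw [mul_assoc, ht]
    exact mul_cfc_of_mul_cfc (F := fun ξ => star (Φ ξ)) hd hh hc' hc hcc hts
  have e2 : t * star t * cfc (vanishing K) z =
      cfc (fun ξ => star (Φ ξ) * (Φ ξ * vanishing K ξ)) z := by
    rw [mul_assoc, hts, mul_cfc_of_mul_cfc (F := Φ) hd hh hc hc' hcc' ht]
    exact cfc_congr fun ξ _ => by ring
  have hn : ‖star t * t‖ ≤ 1 := by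
    rw [CStarRing.norm_star_mul_self]
    exact mul_le_one₀ ht1 (norm_nonneg _) ht1
  obtain ⟨hr, hrr⟩ := cfc_sqrt_one_sub (.star_mul_self t) hn
  refine ⟨t, _, ht1, ⟨eq_of_mul_eq_of_denseRange hd (e1.trans e2.symm)⟩, hr, hrr, ?_, ht⟩
  set r := cfc (fun x : ℂ => ((√(1 - x.re) : ℝ) : ℂ)) (star t * t)
  have e3 : r * r * cfc (vanishing K) z =
      cfc (fun ξ => vanishing K ξ - star (Φ ξ) * (Φ ξ * vanishing K ξ)) z := by
    rw [hrr, sub_mul, one_mul, e1, ← cfc_sub _ _ z hh hcc]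
  have hd3 : DenseRange (r * r * cfc (vanishing K) z).op := by
    rw [e3]
    -- The strict bound |Φ| < 1 shows that (1 - |Φ|²)h has no zeros other than those of h, so r²h(z)
    -- has dense range, and with it r.
    refine denseRange_cfc (hh.sub hcc) hh (fun ξ _ h0 => ?_) hd
    have h1 : (1 - star (Φ ξ) * Φ ξ) * vanishing K ξ = 0 := by rw [← h0]; ring
    refine (mul_eq_zero.mp h1).resolve_left fun h2 => ?_
    have h3 : ‖star (Φ ξ) * Φ ξ‖ = 1 := by rw [← sub_eq_zero.mp h2]; simp
    rw [norm_mul, norm_star] at h3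
    nlinarith [norm_discLift_zFun_lt f ξ, norm_nonneg (Φ ξ)]
  refine hd3.mono ?_
  rintro _ ⟨v, rfl⟩
  exact ⟨r.op ((cfc (vanishing K) z).op v), rfl⟩

/-- The defining relation of the `z`-transform of `f(T)` for one exceptional set implies it for
every other. -/
theorem IsZPair.mul_cfc_vanishing (h : IsZPair T z q) (hz : IsStarNormal z) {K K' : Finset ℂ}
    {G : Set ℂ} (hG : spec A T \ K ⊆ G) (hG' : spec A T \ K' ⊆ G)
    (hd : DenseRange (cfc (vanishing K) z).op) {f : C(G, ℂ)}
    (ht : t * cfc (vanishing K) z = cfc (fun ξ => discLift (zFun f) ξ * vanishing K ξ) z) :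
    t * cfc (vanishing K') z = cfc (fun ξ => discLift (zFun f) ξ * vanishing K' ξ) z :=
  mul_cfc_of_mul_cfc hd (continuous_vanishing K).continuousOn (h.continuousOn_zFun hz hG f)
    (continuous_vanishing K').continuousOn (h.continuousOn_zFun hz hG' f) ht

end Values

/-! ### Multipliers of C₀(X) under a non-degenerate representation -/

section Characterisation

open scoped BoundedContinuousFunction

variable {X : Type*} [TopologicalSpace X]

/-- The product of a bounded continuous function and a function vanishing at infinity. -/
def boundedMul (b : X →ᵇ ℂ) (g : C₀(X, ℂ)) : C₀(X, ℂ) where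
  toFun x := b x * g x
  continuous_toFun := b.continuous.mul (map_continuous g)
  zero_at_infty' := by
    refine squeeze_zero_norm (a := fun x => ‖b‖ * ‖g x‖) (fun x => ?_) ?_
    · rw [norm_mul]
      exact mul_le_mul_of_nonneg_right (b.norm_coe_le_norm x) (norm_nonneg _)
    · simpa using (zero_at_infty g).norm.const_mul ‖b‖

theorem boundedMul_apply (b : X →ᵇ ℂ) (g : C₀(X, ℂ)) (x : X) : boundedMul b g x = b x * g x := rfl

theorem norm_boundedMul_le (b : X →ᵇ ℂ) (g : C₀(X, ℂ)) : ‖boundedMul b g‖ ≤ ‖g‖ * ‖b‖ := by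
  rw [← ZeroAtInftyContinuousMap.norm_toBCF_eq_norm]
  refine (BoundedContinuousFunction.norm_le (by positivity)).mpr fun x => ?_
  change ‖b x * g x‖ ≤ _
  rw [norm_mul, mul_comm]
  refine mul_le_mul ?_ (b.norm_coe_le_norm x) (norm_nonneg _) (norm_nonneg _)
  rw [← ZeroAtInftyContinuousMap.norm_toBCF_eq_norm]
  exact g.toBCF.norm_coe_le_norm x

theorem continuous_boundedMul (g : C₀(X, ℂ)) : Continuous fun b => boundedMul b g := by
  let L : (X →ᵇ ℂ) →ₗ[ℂ] C₀(X, ℂ) :=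
    { toFun := fun b => boundedMul b g
      map_add' := fun b b' => by ext x; exact add_mul (b x) (b' x) (g x)
      map_smul' := fun c b => by ext x; exact smul_mul_assoc c (b x) (g x) }
  exact (L.mkContinuous ‖g‖ fun b => norm_boundedMul_le b g).continuous

variable {A : Type*} [NonUnitalCStarAlgebra A] [PartialOrder A] [StarOrderedRing A]
  {E : Type*} [NormedAddCommGroup E] [NormedSpace ℂ E] [SMul A E] [CStarModule A E]
  [CompleteSpace E]

/-- A `⋆`-homomorphism into `𝓛(E)`, with values in the C⋆-algebra `Adj A E`. -/
def IsNondegenerateStarHom.toAdj {π : C₀(X, ℂ) →ₙₐ[ℂ] (E →L[ℂ] E)}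
    (hπ : IsNondegenerateStarHom A π) : C₀(X, ℂ) →⋆ₙₐ[ℂ] Adj A E where
  toFun g := Adj.mk (hπ.adjoint g)
  map_smul' c g := Adj.ext fun v => by
    change π (c • g) v = c • π g v
    rw [map_smul]; rfl
  map_zero' := Adj.ext fun v => by
    change π 0 v = 0
    rw [map_zero]; rfl
  map_add' g g' := Adj.ext fun v => by
    change π (g + g') v = π g v + π g' v
    rw [map_add]; rfl
  map_mul' g g' := Adj.ext fun v => by
    change π (g * g') v = π g (π g' v)
    rw [map_mul]; rfl
  map_star' g := Adj.ext fun v => by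
    rw [Adj.op_star_eq (t := Adj.mk (hπ.adjoint g)) (hπ.adjoint g)]; rfl

theorem IsNondegenerateStarHom.eq_of_mul_eq {π : C₀(X, ℂ) →ₙₐ[ℂ] (E →L[ℂ] E)}
    (hπ : IsNondegenerateStarHom A π) {a b : Adj A E}
    (h : ∀ g, a * hπ.toAdj g = b * hπ.toAdj g) : a = b := by
  refine Adj.ext fun v => ?_
  refine congrFun (Continuous.ext_on hπ.nondegenerate a.op.continuous b.op.continuous ?_) v
  have : Set.EqOn (a.op : E →ₗ[ℂ] E) (b.op : E →ₗ[ℂ] E)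
      {y : E | ∃ (g : C₀(X, ℂ)) (v : E), π g v = y} := by
    rintro _ ⟨g, v, rfl⟩
    exact Adj.congr_op (h g) v
  exact LinearMap.eqOn_span' this

theorem IsNondegenerateStarHom.star_mul_eq {π : C₀(X, ℂ) →ₙₐ[ℂ] (E →L[ℂ] E)}
    (hπ : IsNondegenerateStarHom A π) {a : Adj A E} {b : X →ᵇ ℂ}
    (h : ∀ g, a * hπ.toAdj g = hπ.toAdj (boundedMul b g)) (g : C₀(X, ℂ)) :
    star a * hπ.toAdj g = hπ.toAdj (boundedMul (star b) g) := by
  have key : star (star a * hπ.toAdj g) = star (hπ.toAdj (boundedMul (star b) g)) := by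
    refine hπ.eq_of_mul_eq fun g' => ?_
    rw [star_mul, star_star, mul_assoc, h g', ← map_star, ← map_star, ← map_mul, ← map_mul]
    congr 1
    ext x
    change star (g x) * (b x * g' x) = star (star (b x) * g x) * g' x
    rw [star_mul, star_star]
    ring
  exact star_injective key

theorem cfc_boundedContinuous_apply {φ : ℂ → ℂ} (hφ : Continuous φ) (b : X →ᵇ ℂ) (x : X) :
    cfc φ b x = φ (b x) := by
  let ev : (X →ᵇ ℂ) →⋆ₐ[ℂ] ℂ :=
    { toFun := fun b => b x
      map_one' := rfl
      map_mul' := fun _ _ => rfl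
      map_zero' := rfl
      map_add' := fun _ _ => rfl
      commutes' := fun _ => rfl
      map_star' := fun _ => rfl }
  have hev : Continuous ev := (BoundedContinuousFunction.evalCLM ℂ x).continuous
  have hb : IsStarNormal b := ⟨mul_comm _ _⟩
  have := ev.map_cfc φ b hφ.continuousOn hev hb ⟨mul_comm _ _⟩
  change ev (cfc φ b) = _
  rw [this]
  have e : ev b = algebraMap ℂ ℂ (b x) := rfl
  rw [e, cfc_algebraMap]
  rfl

/-- The relation "a acts on π(g) as multiplication by b" between 𝓛(E) and C_b(X) is closed,
algebraic and stable under adjoints, so `cfc_rel` applies. -/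
theorem IsNondegenerateStarHom.cfc_mul_eq {π : C₀(X, ℂ) →ₙₐ[ℂ] (E →L[ℂ] E)}
    (hπ : IsNondegenerateStarHom A π) {z : Adj A E} (hz : IsStarNormal z) {b : X →ᵇ ℂ}
    (h : ∀ g, z * hπ.toAdj g = hπ.toAdj (boundedMul b g)) {φ : ℂ → ℂ} (hφ : Continuous φ)
    (g : C₀(X, ℂ)) : cfc φ z * hπ.toAdj g = hπ.toAdj (boundedMul (cfc φ b) g) := by
  have hcont : Continuous hπ.toAdj :=
    AddMonoidHomClass.continuous_of_bound hπ.toAdj 1 fun g => by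
      rw [one_mul]; exact NonUnitalStarAlgHom.norm_apply_le hπ.toAdj g
  refine cfc_rel (P := fun (a : Adj A E) (b : X →ᵇ ℂ) =>
    ∀ g, a * hπ.toAdj g = hπ.toAdj (boundedMul b g)) (fun c g => ?_) (fun x x' y y' h1 h2 g => ?_)
    (fun x x' y y' h1 h2 g => ?_) ?_ hz ⟨mul_comm _ _⟩ hφ.continuousOn h (hπ.star_mul_eq h) g
  · rw [Algebra.algebraMap_eq_smul_one, smul_one_mul, ← map_smul]
    rfl
  · rw [add_mul, h1, h2, ← map_add]
    congr 1
    ext x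
    exact (add_mul _ _ _).symm
  · rw [mul_assoc, h2, h1]
    congr 1
    ext x
    exact (mul_assoc _ _ _).symm
  · simp only [Set.ofPred_forall]
    refine isClosed_iInter fun g => isClosed_eq (continuous_fst.mul continuous_const) ?_
    exact hcont.comp ((continuous_boundedMul g).comp continuous_snd)

end Characterisation

/-! ### Every version of f(T) satisfies the defining relation -/

section FunctionOf

open scoped BoundedContinuousFunction

variable {A : Type*} [NonUnitalCStarAlgebra A] [PartialOrder A] [StarOrderedRing A]
  {E : Type*} [NormedAddCommGroup E] [NormedSpace ℂ E] [SMul A E] [CStarModule A E]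
  [CompleteSpace E] {T R : E →ₗ.[ℂ] E} {z q : Adj A E}

theorem IsNondegenerateStarHom.cfc_mul_eq_of_continuousOn {X : Set ℂ}
    {π : C₀(X, ℂ) →ₙₐ[ℂ] (E →L[ℂ] E)}
    (hπ : IsNondegenerateStarHom A π) (hz : IsStarNormal z) (hX : ∀ x ∈ X, toDisc x ∈ spectrum ℂ z)
    (h : ∀ g v, z.op (π g v) = π (zMul ⟨fun x => (x : ℂ), continuous_subtype_val⟩ g) v) {φ : ℂ → ℂ}
    (hφ : ContinuousOn φ (spectrum ℂ z)) {g g' : C₀(X, ℂ)} (hg : ∀ x, g' x = φ (toDisc x) * g x) :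
    cfc φ z * hπ.toAdj g = hπ.toAdj g' := by
  -- Tietze extension to the plane, so that the function can also be applied to the bounded function
  -- x ↦ `toDisc x`. Its values lie in the spectrum of z, where the extension is still φ.
  obtain ⟨ψ, hψ⟩ := ContinuousMap.exists_restrict_eq (spectrum.isClosed (𝕜 := ℂ) z)
    ⟨_, continuousOn_iff_continuous_domRestrict.mp hφ⟩
  have hψ' : ∀ x ∈ spectrum ℂ z, ψ x = φ x := fun x hx => DFunLike.congr_fun hψ ⟨x, hx⟩
  set b : X →ᵇ ℂ := BoundedContinuousFunction.ofNormedAddCommGroup (fun x : X => toDisc x)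
    (continuous_toDisc.comp continuous_subtype_val) 1 fun x => (norm_toDisc_lt_one _).le with hb
  have hzb : ∀ g, z * hπ.toAdj g = hπ.toAdj (boundedMul b g) := fun g => Adj.ext fun v => h g v
  rw [cfc_congr (g := ψ) fun x hx => (hψ' x hx).symm, hπ.cfc_mul_eq hz hzb ψ.continuous g]
  congr 1
  ext x
  rw [boundedMul_apply, cfc_boundedContinuous_apply ψ.continuous, hg]
  congr 1
  exact hψ' _ (hX x x.2)

/-- Any version of `f(T)` has the `z`-transform determined by the continuous functional calculus
of the `z`-transform of `T`. -/
theorem IsFunctionOf.exists_isZPair (h : IsZPair T z q) (hz : IsStarNormal z) {G : Set ℂ}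
    {f : C(G, ℂ)} (hR : IsFunctionOf A T f R) :
    ∃ (K : Finset ℂ) (t r : Adj A E), (∀ c ∈ K, IsInvertible A (subScalar T c)) ∧
      spec A T \ K ⊆ G ∧ IsZPair R t r ∧
      t * cfc (vanishing K) z = cfc (fun ξ => discLift (zFun f) ξ * vanishing K ξ) z := by
  obtain ⟨K', hK', hinv, hG, π, hπ, ⟨-, z', hz', hπz⟩, -, t', ht', hπt⟩ := hR
  lift K' to Finset ℂ using hK'
  obtain ⟨z₁, q₁, rfl, h₁⟩ := IsZPair.of_isZTransform hz'
  obtain rfl := h.unique h₁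
  obtain ⟨t, r, rfl, ht⟩ := IsZPair.of_isZTransform ht'
  refine ⟨K', t, r, hinv, hG, ht, ?_⟩
  have hX : ∀ x ∈ spec A T \ K', toDisc x ∈ spectrum ℂ z₁ := fun x hx =>
    (h.mem_spec_iff hz x).mp hx.1
  -- By non-degeneracy the identity may be tested after each π(g), where h(z), t and (Φh)(z) all act
  -- as multiplication by functions on σ(T) \ K.
  refine hπ.eq_of_mul_eq fun g => ?_
  let j : C((spec A T \ K' : Set ℂ), spectrum ℂ z₁) := ⟨fun x => ⟨toDisc x, hX x x.2⟩,
    (continuous_toDisc.comp continuous_subtype_val).subtype_mk _⟩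
  let b : (spec A T \ K' : Set ℂ) →ᵇ ℂ := (BoundedContinuousFunction.mkOfCompact
    ⟨fun x : spectrum ℂ z₁ => vanishing K' x,
      (continuous_vanishing K').comp continuous_subtype_val⟩).compContinuous j
  have e1 : cfc (vanishing K') z₁ * hπ.toAdj g = hπ.toAdj (boundedMul b g) :=
    hπ.cfc_mul_eq_of_continuousOn hz hX hπz (continuous_vanishing K').continuousOn fun _ => rfl
  have e2 : t * hπ.toAdj (boundedMul b g) = hπ.toAdj
      (zMul (f.comp ⟨Set.inclusion hG, continuous_inclusion hG⟩) (boundedMul b g)) :=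
    Adj.ext fun v => hπt _ v
  rw [mul_assoc, e1, e2]
  refine (hπ.cfc_mul_eq_of_continuousOn hz hX hπz (h.continuousOn_zFun hz hG f) fun x => ?_).symm
  rw [discLift_toDisc (zFun f) (hG x.2), mul_assoc]
  rfl

end FunctionOf

/-! ### Existence of the functional calculus -/

section Existence

variable {A : Type*} [NonUnitalCStarAlgebra A] [PartialOrder A] [StarOrderedRing A]
  {E : Type*} [NormedAddCommGroup E] [NormedSpace ℂ E] [SMul A E] [CStarModule A E]
  [CompleteSpace E] {T : E →ₗ.[ℂ] E} {z q : Adj A E}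

theorem vanishing_toDisc_ne_zero {K : Finset ℂ} {c : ℂ} (hc : c ∉ K) :
    vanishing K (toDisc c) ≠ 0 :=
  vanishing_ne_zero_iff.mpr ⟨norm_toDisc_lt_one c, by rwa [ofDisc_toDisc]⟩

/-- The zeros of `vanishing K` in the spectrum are the points missing from the image of σ(T) \ K.
Such a point lies off the image of the compact set outside which g is small, so extension by 0 is
continuous there. -/
theorem IsZPair.continuousOn_discLift_zeroAtInfty (h : IsZPair T z q) (hz : IsStarNormal z)
    {K : Finset ℂ} (g : C₀((spec A T \ K : Set ℂ), ℂ)) :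
    ContinuousOn (discLift g) (spectrum ℂ z) := by
  intro ξ hξ
  by_cases h0 : vanishing K ξ = 0
  · have hnot : ¬ (‖ξ‖ < 1 ∧ ofDisc ξ ∈ (spec A T \ K : Set ℂ)) := fun hx =>
      vanishing_ne_zero_iff.mpr ⟨hx.1, hx.2.2⟩ h0
    have hξ0 : discLift g ξ = 0 := dif_neg hnot
    rw [ContinuousWithinAt, hξ0, Metric.tendsto_nhds]
    intro ε hε
    obtain ⟨C, hC, hCg⟩ := Filter.mem_cocompact.mp
      ((Metric.tendsto_nhds.mp (zero_at_infty g)) ε hε)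
    have hcomp : IsCompact ((fun x : (spec A T \ K : Set ℂ) => toDisc x) '' C) :=
      hC.image (continuous_toDisc.comp continuous_subtype_val)
    have hmem : ξ ∉ (fun x : (spec A T \ K : Set ℂ) => toDisc x) '' C := by
      rintro ⟨x, -, rfl⟩
      exact vanishing_toDisc_ne_zero x.2.2 h0
    filter_upwards [mem_nhdsWithin_of_mem_nhds (hcomp.isClosed.isOpen_compl.mem_nhds hmem)]
      with η hη
    by_cases hX : ‖η‖ < 1 ∧ ofDisc η ∈ (spec A T \ K : Set ℂ)
    · rw [discLift_of_mem g hX.1 hX.2]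
      refine hCg fun hC' => hη ⟨_, hC', toDisc_ofDisc hX.1⟩
    · rw [discLift, dif_neg hX, dist_self]
      exact hε
  · have hopen : IsOpen {x | vanishing K x ≠ 0} :=
      isOpen_ne_fun (continuous_vanishing K) continuous_const
    refine (continuousWithinAt_inter (hopen.mem_nhds h0)).mp ?_
    refine (continuousOn_discLift (map_continuous g)).mono ?_ ξ ⟨hξ, h0⟩
    rintro η ⟨hη, hη0⟩
    obtain ⟨h1, h2⟩ := vanishing_ne_zero_iff.mp hη0
    exact ⟨h1, h.ofDisc_mem_spec hz hη h1, h2⟩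

/-- The representation of `C₀(σ(T) \ K)` given by the functional calculus of the `z`-transform. -/
def IsZPair.rep (h : IsZPair T z q) (hz : IsStarNormal z) (K : Finset ℂ) :
    C₀((spec A T \ K : Set ℂ), ℂ) →ₙₐ[ℂ] (E →L[ℂ] E) where
  toFun g := (cfc (discLift g) z).op
  map_smul' c g := by
    have : cfc (discLift (c • g)) z = c • cfc (discLift g) z := by
      rw [← cfc_smul c _ z (h.continuousOn_discLift_zeroAtInfty hz g)]
      refine cfc_congr fun ξ _ => ?_
      simp only [discLift]
      split <;> simp
    rw [this]; rfl
  map_zero' := by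
    have : cfc (discLift (0 : C₀((spec A T \ K : Set ℂ), ℂ))) z = 0 := by
      rw [← cfc_zero ℂ z]
      refine cfc_congr fun ξ _ => ?_
      simp [discLift]
    rw [this]; rfl
  map_add' g g' := by
    have : cfc (discLift (g + g')) z = cfc (discLift g) z + cfc (discLift g') z := by
      rw [← cfc_add z _ _ (h.continuousOn_discLift_zeroAtInfty hz g)
        (h.continuousOn_discLift_zeroAtInfty hz g')]
      refine cfc_congr fun ξ _ => ?_
      simp only [discLift]
      split <;> simp
    rw [this]; rfl
  map_mul' g g' := by
    have : cfc (discLift (g * g')) z = cfc (discLift g) z * cfc (discLift g') z := by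
      rw [← cfc_mul _ _ z (h.continuousOn_discLift_zeroAtInfty hz g)
        (h.continuousOn_discLift_zeroAtInfty hz g')]
      refine cfc_congr fun ξ _ => ?_
      simp only [discLift]
      split <;> simp
    rw [this]; rfl

theorem IsZPair.rep_apply (h : IsZPair T z q) (hz : IsStarNormal z) (K : Finset ℂ)
    (g : C₀((spec A T \ K : Set ℂ), ℂ)) : h.rep hz K g = (cfc (discLift g) z).op := rfl

/-- The function `vanishing K`, as an element of `C₀(σ(T) \ K)`. -/
def IsZPair.vanishingZeroAtInfty (h : IsZPair T z q) (hz : IsStarNormal z) (K : Finset ℂ) :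
    C₀((spec A T \ K : Set ℂ), ℂ) where
  toFun x := vanishing K (toDisc x)
  continuous_toFun :=
    (continuous_vanishing K).comp (continuous_toDisc.comp continuous_subtype_val)
  zero_at_infty' := by
    rw [Metric.tendsto_nhds]
    intro ε hε
    have hcl : IsClosed {ξ | ε ≤ ‖vanishing K ξ‖} :=
      isClosed_le continuous_const (continuous_vanishing K).norm
    have hsub : ∀ ξ, ε ≤ ‖vanishing K ξ‖ → ‖ξ‖ < 1 ∧ ofDisc ξ ∉ K := fun ξ hξ =>
      vanishing_ne_zero_iff.mp (norm_pos_iff.mp (hε.trans_le hξ))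
    -- The part of the compact spectrum where the function is at least ε stays inside the open disc,
    -- where `ofDisc` is continuous.
    have hcomp : IsCompact (ofDisc '' (spectrum ℂ z ∩ {ξ | ε ≤ ‖vanishing K ξ‖})) :=
      ((spectrum.isCompact z).inter_right hcl).image_of_continuousOn
        (continuousOn_ofDisc.mono fun ξ hξ => (hsub ξ hξ.2).1)
    refine Filter.mem_cocompact.mpr
      ⟨{x | ε ≤ ‖vanishing K (toDisc x)‖}, ?_, fun x hx => ?_⟩
    · rw [Subtype.isCompact_iff]
      convert! hcomp using 1
      ext c
      constructor
      · rintro ⟨x, hx, rfl⟩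
        exact ⟨toDisc x, ⟨(h.mem_spec_iff hz x).mp x.2.1, hx⟩, ofDisc_toDisc x⟩
      · rintro ⟨ξ, ⟨hξ, hε'⟩, rfl⟩
        obtain ⟨h1, h2⟩ := hsub ξ hε'
        refine ⟨⟨ofDisc ξ, h.ofDisc_mem_spec hz hξ h1, h2⟩, ?_, rfl⟩
        change ε ≤ ‖vanishing K (toDisc (ofDisc ξ))‖
        rwa [toDisc_ofDisc h1]
    · change dist (vanishing K (toDisc x)) 0 < ε
      rw [dist_zero_right]
      exact not_le.mp hx

theorem IsZPair.isNondegenerateStarHom_rep (h : IsZPair T z q) (hz : IsStarNormal z)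
    {K : Finset ℂ} (hd : DenseRange (cfc (vanishing K) z).op) :
    IsNondegenerateStarHom A (h.rep hz K) where
  adjoint g := by
    have : cfc (discLift ⇑(star g)) z = star (cfc (discLift g) z) := by
      rw [← cfc_star]
      refine cfc_congr fun ξ _ => ?_
      rw [star_discLift]; rfl
    rw [h.rep_apply, h.rep_apply, this]
    exact Adj.isAdjointPair_star _
  nondegenerate := by
    -- A single element of C₀(σ(T) \ K) already acts with dense range, which gives non-degeneracy.
    have e : cfc (discLift (h.vanishingZeroAtInfty hz K)) z = cfc (vanishing K) z := by
      refine cfc_congr fun ξ hξ => ?_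
      by_cases h0 : vanishing K ξ = 0
      · rw [h0]
        have hnot : ¬ (‖ξ‖ < 1 ∧ ofDisc ξ ∈ (spec A T \ K : Set ℂ)) := fun hx =>
          vanishing_ne_zero_iff.mpr ⟨hx.1, hx.2.2⟩ h0
        exact dif_neg hnot
      · obtain ⟨h1, h2⟩ := vanishing_ne_zero_iff.mp h0
        have hX : ofDisc ξ ∈ (spec A T \ K : Set ℂ) := ⟨h.ofDisc_mem_spec hz hξ h1, h2⟩
        rw [discLift_of_mem _ h1 hX]
        change vanishing K (toDisc (ofDisc ξ)) = _
        rw [toDisc_ofDisc h1]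
    refine hd.mono ?_
    rintro _ ⟨v, rfl⟩
    refine Submodule.subset_span ⟨h.vanishingZeroAtInfty hz K, v, ?_⟩
    rw [h.rep_apply, e]

theorem IsNormal.exists_isFunctionOf (hT : IsNormal A T) {G : Set ℂ} (hG : IsCompatible A T G)
    (f : C(G, ℂ)) : ∃ R : E →ₗ.[ℂ] E, IsFunctionOf A T f R := by
  obtain ⟨z, q, h, hz, hdq⟩ := hT.exists_isZPair
  obtain ⟨-, K, hK, hinv, hsub⟩ := hG
  lift K to Finset ℂ using hK
  have hd := h.denseRange_vanishing hz hdq fun c hc => h.denseRange_of_isInvertible (hinv c hc)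
  obtain ⟨t, r, ht1, htn, hr, hrr, hdr, ht⟩ := h.exists_value hz hsub hd f
  obtain ⟨R, hR⟩ := exists_isZPair_of_pair ht1 hr hrr hdr
  refine ⟨R, K, K.finite_toSet, hinv, hsub, h.rep hz K, h.isNondegenerateStarHom_rep hz hd,
    ⟨hT.regular, z.op, h.isZTransform, fun g v => ?_⟩,
    ⟨hR.isRegular htn hdr, t.op, hR.isZTransform, fun g v => ?_⟩⟩
  · have : z * cfc (discLift g) z =
        cfc (discLift (zMul (⟨fun x => (x : ℂ), continuous_subtype_val⟩ :
          C((spec A T \ K : Set ℂ), ℂ)) g)) z := by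
      nth_rewrite 1 [← cfc_id' ℂ z]
      rw [← cfc_mul _ _ z (by fun_prop) (h.continuousOn_discLift_zeroAtInfty hz g)]
      refine cfc_congr fun ξ _ => ?_
      simp only [discLift]
      split
      · rename_i hx
        change _ = toDisc (ofDisc ξ) * _
        rw [toDisc_ofDisc hx.1]
      · simp
    exact Adj.congr_op this v
  · have e : ∀ ξ, discLift (zFun f) ξ * discLift g ξ =
        discLift (zMul (f.comp ⟨Set.inclusion hsub, continuous_inclusion hsub⟩) g) ξ := fun ξ => by
      by_cases hx : ‖ξ‖ < 1 ∧ ofDisc ξ ∈ (spec A T \ K : Set ℂ)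
      · rw [discLift_of_mem _ hx.1 hx.2, discLift_of_mem _ hx.1 hx.2,
          discLift_of_mem _ hx.1 (hsub hx.2)]
        rfl
      · rw [discLift, discLift, discLift, dif_neg hx, dif_neg hx, mul_zero]
    have : t * cfc (discLift g) z =
        cfc (discLift (zMul (f.comp ⟨Set.inclusion hsub, continuous_inclusion hsub⟩) g)) z := by
      rw [mul_cfc_of_mul_cfc hd (continuous_vanishing K).continuousOn (h.continuousOn_zFun hz hsub f)
        (h.continuousOn_discLift_zeroAtInfty hz g)
        ((h.continuousOn_discLift_zeroAtInfty hz _).congr fun ξ _ => e ξ) ht]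
      exact cfc_congr fun ξ _ => e ξ
    exact Adj.congr_op this v

end Existence

/-! ### Intertwining of f(S) and f(T), and uniqueness -/

section Intertwining

variable {A : Type*} [NonUnitalCStarAlgebra A] [PartialOrder A] [StarOrderedRing A]
  {E F : Type*}
  [NormedAddCommGroup E] [NormedSpace ℂ E] [SMul A E] [CStarModule A E] [CompleteSpace E]
  [NormedAddCommGroup F] [NormedSpace ℂ F] [SMul A F] [CStarModule A F] [CompleteSpace F]

theorem Intertwines.mul {U : E →L[ℂ] F} {a b : Adj A E} {a' b' : Adj A F}
    (h1 : Intertwines U a a') (h2 : Intertwines U b b') : Intertwines U (a * b) (a' * b') :=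
  fun x => by rw [Adj.mul_op, Adj.mul_op, h1, h2]

theorem Intertwines.of_mul_right {U : E →L[ℂ] F} {a b : Adj A E} {a' b' : Adj A F}
    (hd : DenseRange b.op) (hb : Intertwines U b b') (h : Intertwines U (a * b) (a' * b')) :
    Intertwines U a a' := by
  refine fun x => congrFun (hd.equalizer (U.continuous.comp a.op.continuous)
    (a'.op.continuous.comp U.continuous) (funext fun w => ?_)) x
  have := h w
  rw [Adj.mul_op, Adj.mul_op, ← hb] at this
  exact this

theorem pcomp_le_of_intertwines {U : E →L[ℂ] F} {S : E →ₗ.[ℂ] E} {T : F →ₗ.[ℂ] F}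
    {t r : Adj A E} {t' r' : Adj A F} (hS : IsZPair S t r) (hT : IsZPair T t' r')
    (ht : Intertwines U t t') (hr : Intertwines U r r') :
    pcomp (toP U) S ≤ pcomp T (toP U) := by
  rw [pcomp_toP_le_iff]
  intro x y hxy
  obtain ⟨v, rfl, rfl⟩ := (hS.graph _ _).mp hxy
  exact (hT.graph _ _).mpr ⟨U v, (hr v).symm, (ht v).symm⟩

theorem pcomp_eq_of_intertwines {U : E →L[ℂ] F} {S : E →ₗ.[ℂ] E} {T : F →ₗ.[ℂ] F}
    {t r : Adj A E} {t' r' : Adj A F} (hS : IsZPair S t r) (hT : IsZPair T t' r')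
    (ht : Intertwines U t t') (hr : Intertwines U r r') (hU : Function.Bijective U) :
    pcomp (toP U) S = pcomp T (toP U) := by
  refine LinearPMap.eq_of_eq_graph (le_antisymm
    (LinearPMap.le_graph_of_le (pcomp_le_of_intertwines hS hT ht hr)) ?_)
  rintro ⟨x, y⟩ hxy
  obtain ⟨w, hw, rfl⟩ := (hT.graph _ _).mp (mem_graph_pcomp_toP.mp hxy)
  obtain ⟨v, rfl⟩ := hU.2 w
  rw [← hr] at hw
  exact mem_graph_toP_pcomp.mpr ⟨_, (hS.graph _ _).mpr ⟨v, hU.1 hw, rfl⟩, ht v⟩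

/-- A point outside G either belongs to K, where T - c is invertible by assumption, or is not in the
spectrum at all. -/
theorem IsZPair.denseRange_vanishing_of_disjoint {T : E →ₗ.[ℂ] E} {z q : Adj A E}
    (h : IsZPair T z q) (hz : IsStarNormal z) (hd : DenseRange q.op) {K L : Finset ℂ} {G : Set ℂ}
    (hK : ∀ c ∈ K, IsInvertible A (subScalar T c)) (hG : spec A T \ K ⊆ G) (hL : ∀ c ∈ L, c ∉ G) :
    DenseRange (cfc (vanishing L) z).op := by
  refine h.denseRange_vanishing hz hd fun c hc => ?_
  by_cases hcK : c ∈ K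
  · exact h.denseRange_of_isInvertible (hK c hcK)
  · exact h.denseRange_of_notMem_spec fun hs => hL c hc (hG ⟨hs, hcK⟩)

theorem IsZPair.isStarNormal_of_mul_cfc {T : E →ₗ.[ℂ] E} {z q t : Adj A E}
    (h : IsZPair T z q) (hz : IsStarNormal z) {K : Finset ℂ} {G : Set ℂ} (hG : spec A T \ K ⊆ G)
    (hd : DenseRange (cfc (vanishing K) z).op) {f : C(G, ℂ)}
    (ht : t * cfc (vanishing K) z = cfc (fun ξ => discLift (zFun f) ξ * vanishing K ξ) z) :
    IsStarNormal t := by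
  obtain ⟨t₀, -, -, hn, -, -, -, ht₀⟩ := h.exists_value hz hG hd f
  rwa [eq_of_mul_eq_of_denseRange hd (ht.trans ht₀.symm)]

/-- U intertwines h(z) and (Φh)(z) with h(z') and (Φh)(z'), so cancelling h(z) gives Ut = t'U. The
bounded theorem gives the same for t⋆, hence for 1 - t⋆t and its square root r. -/
theorem intertwines_of_isFunctionOf {U : E →L[ℂ] F} {S fS : E →ₗ.[ℂ] E} {T fT : F →ₗ.[ℂ] F}
    (hS : IsNormal A S) (hT : IsNormal A T) (hU : pcomp (toP U) S ≤ pcomp T (toP U)) {G : Set ℂ}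
    {f : C(G, ℂ)} (hfS : IsFunctionOf A S f fS) (hfT : IsFunctionOf A T f fT) :
    ∃ (t r : Adj A E) (t' r' : Adj A F), IsZPair fS t r ∧ IsZPair fT t' r' ∧
      Intertwines U t t' ∧ Intertwines U r r' := by
  classical
  obtain ⟨z, q, h, hz, hdq⟩ := hS.exists_isZPair
  obtain ⟨z', q', h', hz', hdq'⟩ := hT.exists_isZPair
  obtain ⟨-, iz, izs⟩ := intertwines_of_pcomp_le h h' hz hz' hdq hU
  obtain ⟨K, t, r, hK, hKG, htr, ht⟩ := hfS.exists_isZPair h hz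
  obtain ⟨K', t', r', hK', hKG', htr', ht'⟩ := hfT.exists_isZPair h' hz'
  have hdK := h.denseRange_vanishing hz hdq fun c hc => h.denseRange_of_isInvertible (hK c hc)
  have hdK' := h'.denseRange_vanishing hz' hdq' fun c hc =>
    h'.denseRange_of_isInvertible (hK' c hc)
  have htn := h.isStarNormal_of_mul_cfc hz hKG hdK ht
  have htn' := h'.isStarNormal_of_mul_cfc hz' hKG' hdK' ht'
  -- One function h must serve both operators. The union K ∪ K' would not do, since T - c need not
  -- be injective for c in K; keeping only the points outside G avoids this and still leaves σ(S) \
  -- L and σ(T) \ L inside G.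
  set L := (K ∪ K').filter fun c => c ∉ G with hL
  have hLG : ∀ c ∈ L, c ∉ G := fun c hc => (Finset.mem_filter.mp hc).2
  have hsub : ∀ {Y : Set ℂ} {M : Finset ℂ}, M ⊆ K ∪ K' → Y \ M ⊆ G → Y \ L ⊆ G := by
    intro Y M hM hY c hc
    by_contra hcG
    refine hc.2 (Finset.mem_coe.mpr (Finset.mem_filter.mpr ⟨hM ?_, hcG⟩))
    by_contra hcM
    exact hcG (hY ⟨hc.1, hcM⟩)
  have hLS := hsub Finset.subset_union_left hKG
  have hLT := hsub Finset.subset_union_right hKG'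
  have hdL := h.denseRange_vanishing_of_disjoint hz hdq hK hKG hLG
  have htL := h.mul_cfc_vanishing hz hKG hLS hdK ht
  have htL' := h'.mul_cfc_vanishing hz' hKG' hLT hdK' ht'
  have iL : Intertwines U (cfc (vanishing L) z) (cfc (vanishing L) z') :=
    iz.cfc hz hz' izs (continuous_vanishing L).continuousOn
  -- Φh is the same function for both operators; continuity on each of the two closed spectra gives
  -- continuity on their union.
  have iF := iz.cfc hz hz' izs ((h.continuousOn_zFun hz hLS f).union_of_isClosed
    (h'.continuousOn_zFun hz' hLT f) (spectrum.isClosed z) (spectrum.isClosed z'))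
  rw [← htL, ← htL'] at iF
  have it : Intertwines U t t' := Intertwines.of_mul_right hdL iL iF
  have its := it.star_right htn htn'
  refine ⟨t, r, t', r', htr, htr', it, Intertwines.of_mul_self htr.pos htr'.pos fun x => ?_⟩
  rw [htr.sq, htr'.sq, Adj.sub_op, Adj.sub_op, map_sub, Adj.one_op, Adj.one_op, its.mul it]

/-- The intertwining result for the identity operator, with two choices of K and π, identifies the
two z-transforms. -/
theorem IsFunctionOf.unique {T R R' : E →ₗ.[ℂ] E} (hT : IsNormal A T) {G : Set ℂ} {f : C(G, ℂ)}
    (h : IsFunctionOf A T f R) (h' : IsFunctionOf A T f R') : R = R' := by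
  obtain ⟨t, r, t', r', hR, hR', it, ir⟩ := intertwines_of_isFunctionOf
    (U := ContinuousLinearMap.id ℂ E) hT hT (pcomp_toP_le_iff.mpr fun _ _ hxy => hxy) h h'
  obtain rfl : t = t' := Adj.ext it
  obtain rfl : r = r' := Adj.ext ir
  refine LinearPMap.eq_of_eq_graph ?_
  ext ⟨x, y⟩
  rw [hR.graph, hR'.graph]

theorem IsNormal.existsUnique_isFunctionOf {T : E →ₗ.[ℂ] E} (hT : IsNormal A T) {G : Set ℂ}
    (hG : IsCompatible A T G) (f : C(G, ℂ)) : ∃! R : E →ₗ.[ℂ] E, IsFunctionOf A T f R := by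
  obtain ⟨R, hR⟩ := hT.exists_isFunctionOf hG f
  exact ⟨R, hR, fun R' hR' => hR'.unique hT hR⟩

theorem IsUnitary.bijective {U : E →L[ℂ] F} (hU : IsUnitary A U) : Function.Bijective U := by
  obtain ⟨V, -, h1, h2⟩ := hU
  exact Function.bijective_iff_has_inverse.mpr
    ⟨V, fun x => DFunLike.congr_fun h1 x, fun y => DFunLike.congr_fun h2 y⟩

end Intertwining

end

end HilbertModule

/-! ### The main theorem -/

open HilbertModule in
theorem mainTheorem1
    {A : Type*} [NonUnitalCStarAlgebra A] [PartialOrder A] [StarOrderedRing A]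
    {E F : Type*}
    [NormedAddCommGroup E] [NormedSpace ℂ E] [SMul A E] [CStarModule A E] [CompleteSpace E]
    [NormedAddCommGroup F] [NormedSpace ℂ F] [SMul A F] [CStarModule A F] [CompleteSpace F]
    (U : E →L[ℂ] F) (S : E →ₗ.[ℂ] E) (T : F →ₗ.[ℂ] F)
    (hS : IsNormal A S) (hT : IsNormal A T)
    (hUST : pcomp (toP U) S ≤ pcomp T (toP U)) :
    pcomp (toP U) (adjoint A S) ≤ pcomp (adjoint A T) (toP U) ∧
    ∀ G : Set ℂ, IsCompatible A S G → IsCompatible A T G → ∀ f : C(G, ℂ),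
      (∃! fS : E →ₗ.[ℂ] E, IsFunctionOf A S f fS) ∧
      (∃! fT : F →ₗ.[ℂ] F, IsFunctionOf A T f fT) ∧
      ∀ (fS : E →ₗ.[ℂ] E) (fT : F →ₗ.[ℂ] F),
        IsFunctionOf A S f fS → IsFunctionOf A T f fT →
          pcomp (toP U) fS ≤ pcomp fT (toP U) ∧
          (IsUnitary A U → pcomp (toP U) fS = pcomp fT (toP U)) := by
  refine ⟨pcomp_adjoint_le hS hT hUST, fun G hGS hGT f =>
    ⟨hS.existsUnique_isFunctionOf hGS f, hT.existsUnique_isFunctionOf hGT f,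
      fun fS fT hfS hfT => ?_⟩⟩
  obtain ⟨t, r, t', r', htr, htr', ht, hr⟩ := intertwines_of_isFunctionOf hS hT hUST hfS hfT
  exact ⟨pcomp_le_of_intertwines htr htr' ht hr, fun hU =>
    pcomp_eq_of_intertwines htr htr' ht hr hU.bijective⟩
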